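/- Let $0<a<\infty$, $I=(-a,a)$, and let $F$ be one of the function classes $L^p$ ($1\le p\le\infty$) or $C^k$ ($k\in\mathbb N_0$) of complex-valued functions. Let $F_{loc}(I)$ be the space of functions that are in $L^p(K)$ for every compact $K\subset I$ if $F=L^p$, and $F_{loc}(I)=C^k(I)$ if $F=C^k$. Put $W^2(I;F)=\{\phi\in W^{1,1}(I):\phi''\in F(I)\}$ with the norm $\|\phi\|_{W^{1,1}}+\|\phi''\|_F$. Let $F_c(I)$ and $W^2_c(I;F)$ be the subspaces of $F(I)$ and $W^2(I;F)$ of the elements with compact support in $I$, with the (locally convex) inductive limit topology over the compact sets $K\subset I$ containing the support. Their dual spaces $(F_c(I))'$ and $(W^2_c(I;F))'$ of continuous linear functionals carry the topology of pointwise convergence. Let $q\in F_{loc}(I)$ be complex-valued. Then the integral equation $$H(u,v)=\frac12\int_0^u q(s)\,ds+\int_0^u\int_0^v q(\alpha+\beta)H(\alpha,\beta)\,d\beta\,d\alpha,\qquad |u|+|v|<a,$$ has a unique continuous solution $H$. Set $K(x,t)=H\left(\frac{x+t}2,\frac{x-t}2\right)$ for $x,t\in I$, and define, for $g\in L^1_{loc}(I)$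 and for $\psi\in L^1(I)$ with compact support in $I$, $$\mathbf Tg(x)=g(x)+\int_{-x}^{x}K(x,t)g(t)\,dt,$$ $$\mathbf T^{\square}\psi(x)=\psi(x)-\int_{-a}^{-|x|}K(t,x)\psi(t)\,dt+\int_{|x|}^{a}K(t,x)\psi(t)\,dt .$$ Then $\mathbf T^\square$ maps $W^2_c(I;F)$ into itself and $F_c(I)$ into itself, and the rule $\langle\mathbf Tu,\phi\rangle=\langle u,\mathbf T^\square\phi\rangle$ defines on each of $(W^2_c(I;F))'$ and $(F_c(I))'$ a continuous invertible linear operator $\mathbf T$ with continuous inverse. On each of these duals it extends $\mathbf T$ from functions: if $u$ is the functional $\phi\mapsto\int_I g\phi\,dx$ with $g\in L^1_{loc}(I)$ (all these integrals being absolutely convergent), then $\mathbf Tu$ is the functional $\phi\mapsto\int_I(\mathbf Tg)\phi\,dx$. Moreover, $\mathbf T$ is a transmutation operator on $(F_c(I))'$. That is, restriction to $W^2_c(I;F)$, $\langle u'',\phi\rangle=\langle u,\phi''\rangle$ and $\langle qu,\phi\rangle=\langle u,q\phi\rangle$ define continuous linear maps from $(F_c(I))'$ to $(W^2_c(I;F))'$,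 the two operators $\mathbf T$ are compatible with the restriction map, and for every $u\in(F_c(I))'$ $$(\mathbf Tu)''-q\,\mathbf Tu=\mathbf T(u'')\qquad\text{in }(W^2_c(I;F))'.$$ -/

import Mathlib

open MeasureTheory Set Topology
open scoped ENNReal ContDiff

noncomputable section

namespace Transmutation

/-- Complex-valued measurable functions on `I = (-a, a)`, modulo equality almost everywhere. -/
abbrev AEFun (a : ℝ) : Type := ℝ →ₘ[volume.restrict (Ioo (-a) a)] ℂ

/-- `f` vanishes almost everywhere in `I` outside `K`; for `K ⊆ I` closed in `I` this says
that the (essential) support of `f` is contained in `K`. -/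
def SuppIn {a : ℝ} (f : AEFun a) (K : Set ℝ) : Prop :=
  ∀ᵐ x ∂(volume.restrict (Ioo (-a) a)), x ∉ K → f x = 0

/-! ### The spaces `F(I)`: `L^p(I)` for `1 ≤ p ≤ ∞`, and `C^k(I)` for `k ∈ ℕ` -/

/-- Names of the admissible function classes `F`. -/
inductive FunctionClass : Type
  | Lp (p : ℝ≥0∞) (hp : 1 ≤ p) : FunctionClass
  | Ck (k : ℕ) : FunctionClass

/-- `g` is a `C^k` representative on `I` of the class `f`. -/
def IsCkRep {a : ℝ} (k : ℕ) (f : AEFun a) (g : ℝ → ℂ) : Prop :=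
  ContDiffOn ℝ k g (Ioo (-a) a) ∧ f =ᵐ[volume.restrict (Ioo (-a) a)] g

/-- The space `F(I)`. -/
def FI (a : ℝ) : FunctionClass → Submodule ℂ (AEFun a)
  | .Lp p _ =>
    { carrier := {f | MemLp f p (volume.restrict (Ioo (-a) a))}
      zero_mem' := (memLp_congr_ae AEEqFun.coeFn_zero).2 MemLp.zero
      add_mem' := fun {f g} hf hg => (memLp_congr_ae (AEEqFun.coeFn_add f g)).2 (hf.add hg)
      smul_mem' := fun c f hf =>
        (memLp_congr_ae (AEEqFun.coeFn_smul c f)).2 (hf.const_smul c) }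
  | .Ck k =>
    { carrier := {f | ∃ g, IsCkRep k f g}
      zero_mem' := ⟨0, contDiffOn_const, AEEqFun.coeFn_zero⟩
      add_mem' := by
        rintro f g ⟨f', hf, hff⟩ ⟨g', hg, hgg⟩
        exact ⟨f' + g', hf.add hg, (AEEqFun.coeFn_add f g).trans (hff.add hgg)⟩
      smul_mem' := by
        rintro c f ⟨f', hf, hff⟩
        exact ⟨c • f', hf.const_smul c, (AEEqFun.coeFn_smul c f).trans (hff.const_smul c)⟩ }

/-- The (extended) norm of `F(I)`. For `C^k` the infimum runs over the `C^k` representatives,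
all of which agree on `I`; it is `∞` if there is none. -/
def normF (a : ℝ) : FunctionClass → AEFun a → ℝ≥0∞
  | .Lp p _, f => eLpNorm f p (volume.restrict (Ioo (-a) a))
  | .Ck k, f => ⨅ g ∈ {g : ℝ → ℂ | IsCkRep k f g},
      ∑ j ∈ Finset.range (k + 1), ⨆ x ∈ Ioo (-a) a, ‖iteratedDerivWithin j g (Ioo (-a) a) x‖ₑ

/-- The local space `F_loc(I)`: `L^p` on every compact subset of `I`, respectively `C^k(I)`. -/
def MemFloc (a : ℝ) : FunctionClass → (ℝ → ℂ) → Prop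
  | .Lp p _, q => ∀ K : Set ℝ, IsCompact K → K ⊆ Ioo (-a) a → MemLp q p (volume.restrict K)
  | .Ck k, q => ContDiffOn ℝ k q (Ioo (-a) a)

/-! ### Weak derivatives and the spaces `W²(I; F)` -/

/-- `g` is the weak (distributional) derivative of `f` on `I`. -/
structure HasWeakDeriv {a : ℝ} (f g : AEFun a) : Prop where
  left : LocallyIntegrableOn f (Ioo (-a) a)
  right : LocallyIntegrableOn g (Ioo (-a) a)
  eq : ∀ η : ℝ → ℂ, ContDiff ℝ ∞ η → HasCompactSupport η → tsupport η ⊆ Ioo (-a) a →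
    ∫ x in Ioo (-a) a, f x * deriv η x = - ∫ x in Ioo (-a) a, g x * η x

/-- `ψ = φ''` weakly on `I`. -/
def HasWeakDeriv2 {a : ℝ} (φ ψ : AEFun a) : Prop :=
  ∃ χ : AEFun a, HasWeakDeriv φ χ ∧ HasWeakDeriv χ ψ

theorem locallyIntegrableOn_congr {a : ℝ} {f g : ℝ → ℂ}
    (h : f =ᵐ[volume.restrict (Ioo (-a) a)] g)
    (hf : LocallyIntegrableOn f (Ioo (-a) a)) : LocallyIntegrableOn g (Ioo (-a) a) := by
  rw [locallyIntegrableOn_iff isOpen_Ioo.isLocallyClosed] at hf ⊢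
  intro K hK hKc
  exact (hf K hK hKc).congr_fun_ae (ae_restrict_of_ae_restrict_of_subset hK h)

theorem integrableOn_mul_test {a : ℝ} {f η : ℝ → ℂ}
    (hf : LocallyIntegrableOn f (Ioo (-a) a)) (hη : Continuous η) (hc : HasCompactSupport η)
    (hs : tsupport η ⊆ Ioo (-a) a) : IntegrableOn (fun x => f x * η x) (Ioo (-a) a) := by
  have h1 : IntegrableOn f (tsupport η) := hf.integrableOn_compact_subset hs hc
  have h2 : IntegrableOn (fun x => f x * η x) (tsupport η) :=
    h1.mul_continuousOn hη.continuousOn hc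
  refine ((integrableOn_iff_integrable_of_support_subset ?_).1 h2).integrableOn
  intro x hx
  apply subset_tsupport
  intro h0
  exact hx (by simp [h0])

theorem HasWeakDeriv.add {a : ℝ} {f g f' g' : AEFun a} (h : HasWeakDeriv f g)
    (h' : HasWeakDeriv f' g') : HasWeakDeriv (f + f') (g + g') where
  left := locallyIntegrableOn_congr (AEEqFun.coeFn_add f f').symm (h.left.add h'.left)
  right := locallyIntegrableOn_congr (AEEqFun.coeFn_add g g').symm (h.right.add h'.right)
  eq := by
    intro η hη hc hs
    have hd : Continuous (deriv η) := hη.continuous_deriv (by simp)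
    have hs' : tsupport (deriv η) ⊆ Ioo (-a) a := (tsupport_deriv_subset (f := η)).trans hs
    have e1 : ∫ x in Ioo (-a) a, (f + f') x * deriv η x
        = ∫ x in Ioo (-a) a, (f x * deriv η x + f' x * deriv η x) := by
      refine integral_congr_ae ?_
      filter_upwards [AEEqFun.coeFn_add f f'] with x hx
      rw [hx, Pi.add_apply, add_mul]
    have e2 : ∫ x in Ioo (-a) a, (g + g') x * η x
        = ∫ x in Ioo (-a) a, (g x * η x + g' x * η x) := by
      refine integral_congr_ae ?_
      filter_upwards [AEEqFun.coeFn_add g g'] with x hx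
      rw [hx, Pi.add_apply, add_mul]
    rw [e1, e2, integral_add (integrableOn_mul_test h.left hd hc.deriv hs')
      (integrableOn_mul_test h'.left hd hc.deriv hs'),
      integral_add (integrableOn_mul_test h.right hη.continuous hc hs)
      (integrableOn_mul_test h'.right hη.continuous hc hs),
      h.eq η hη hc hs, h'.eq η hη hc hs, neg_add]

theorem HasWeakDeriv.smul {a : ℝ} {f g : AEFun a} (c : ℂ) (h : HasWeakDeriv f g) :
    HasWeakDeriv (c • f) (c • g) where
  left := locallyIntegrableOn_congr (AEEqFun.coeFn_smul c f).symm (h.left.smul c)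
  right := locallyIntegrableOn_congr (AEEqFun.coeFn_smul c g).symm (h.right.smul c)
  eq := by
    intro η hη hc hs
    have e1 : ∫ x in Ioo (-a) a, (c • f) x * deriv η x
        = ∫ x in Ioo (-a) a, c * (f x * deriv η x) := by
      refine integral_congr_ae ?_
      filter_upwards [AEEqFun.coeFn_smul c f] with x hx
      rw [hx, Pi.smul_apply, smul_eq_mul, mul_assoc]
    have e2 : ∫ x in Ioo (-a) a, (c • g) x * η x
        = ∫ x in Ioo (-a) a, c * (g x * η x) := by
      refine integral_congr_ae ?_
      filter_upwards [AEEqFun.coeFn_smul c g] with x hx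
      rw [hx, Pi.smul_apply, smul_eq_mul, mul_assoc]
    rw [e1, e2, integral_const_mul, integral_const_mul, h.eq η hη hc hs, mul_neg]

theorem HasWeakDeriv.zero {a : ℝ} : HasWeakDeriv (0 : AEFun a) 0 where
  left := locallyIntegrableOn_congr AEEqFun.coeFn_zero.symm locallyIntegrableOn_zero
  right := locallyIntegrableOn_congr AEEqFun.coeFn_zero.symm locallyIntegrableOn_zero
  eq := by
    intro η _ _ _
    have e (θ : ℝ → ℂ) : ∫ x in Ioo (-a) a, (0 : AEFun a) x * θ x = 0 := by
      refine integral_eq_zero_of_ae ?_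
      filter_upwards [AEEqFun.coeFn_zero (β := ℂ) (μ := volume.restrict (Ioo (-a) a))] with x hx
      rw [hx]; simp
    rw [e, e, neg_zero]

/-- `W²(I; F) = {φ ∈ W^{1,1}(I) : φ'' ∈ F(I)}`. -/
def W2I (a : ℝ) (F : FunctionClass) : Submodule ℂ (AEFun a) where
  carrier := {φ | ∃ χ ψ : AEFun a, HasWeakDeriv φ χ ∧ HasWeakDeriv χ ψ ∧
    φ ∈ FI a (.Lp 1 le_rfl) ∧ χ ∈ FI a (.Lp 1 le_rfl) ∧ ψ ∈ FI a F}
  zero_mem' := ⟨0, 0, .zero, .zero, zero_mem _, zero_mem _, zero_mem _⟩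
  add_mem' := by
    rintro f g ⟨χ, ψ, h1, h2, h3, h4, h5⟩ ⟨χ', ψ', h1', h2', h3', h4', h5'⟩
    exact ⟨χ + χ', ψ + ψ', h1.add h1', h2.add h2', add_mem h3 h3', add_mem h4 h4',
      add_mem h5 h5'⟩
  smul_mem' := by
    rintro c f ⟨χ, ψ, h1, h2, h3, h4, h5⟩
    exact ⟨c • χ, c • ψ, h1.smul c, h2.smul c, Submodule.smul_mem _ c h3,
      Submodule.smul_mem _ c h4, Submodule.smul_mem _ c h5⟩

/-- The norm `‖φ‖_{L¹} + ‖φ'‖_{L¹} + ‖φ''‖_F` of `W²(I; F)`. Weak derivatives being unique, the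
infimum runs over at most one pair. -/
def normW2 (a : ℝ) (F : FunctionClass) (φ : AEFun a) : ℝ≥0∞ :=
  ⨅ p ∈ {p : AEFun a × AEFun a | HasWeakDeriv φ p.1 ∧ HasWeakDeriv p.1 p.2},
    normF a (.Lp 1 le_rfl) φ + normF a (.Lp 1 le_rfl) p.1 + normF a F p.2

/-! ### Compactly supported subspaces with the inductive limit topology -/

/-- The elements of the function space `X` with compact support in `I`. -/
def compactlySupported {a : ℝ} (X : Submodule ℂ (AEFun a)) : Submodule ℂ (AEFun a) where
  carrier := {f | f ∈ X ∧ ∃ K : Set ℝ, IsCompact K ∧ K ⊆ Ioo (-a) a ∧ SuppIn f K}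
  zero_mem' := by
    refine ⟨zero_mem _, ∅, isCompact_empty, empty_subset _, ?_⟩
    filter_upwards [AEEqFun.coeFn_zero (β := ℂ) (μ := volume.restrict (Ioo (-a) a))] with x hx _
    rw [hx]; rfl
  add_mem' := by
    rintro f g ⟨hf, K, hK, hKI, hfK⟩ ⟨hg, L, hL, hLI, hgL⟩
    refine ⟨add_mem hf hg, K ∪ L, hK.union hL, union_subset hKI hLI, ?_⟩
    filter_upwards [AEEqFun.coeFn_add f g, hfK, hgL] with x hx h1 h2 hn
    rw [hx, Pi.add_apply, h1 fun h => hn (Or.inl h), h2 fun h => hn (Or.inr h), add_zero]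
  smul_mem' := by
    rintro c f ⟨hf, K, hK, hKI, hfK⟩
    refine ⟨Submodule.smul_mem _ c hf, K, hK, hKI, ?_⟩
    filter_upwards [AEEqFun.coeFn_smul c f, hfK] with x hx h1 hn
    rw [hx, Pi.smul_apply, h1 hn, smul_zero]

/-- The space `X_c(I)` of compactly supported elements of a function space `X` on `I` with
(extended) norm `N`. -/
def CSpace {a : ℝ} (X : Submodule ℂ (AEFun a)) (_N : AEFun a → ℝ≥0∞) : Type :=
  ↥(compactlySupported X)

namespace CSpace

variable {a : ℝ} {X : Submodule ℂ (AEFun a)} {N : AEFun a → ℝ≥0∞}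

instance : AddCommGroup (CSpace X N) := inferInstanceAs (AddCommGroup ↥(compactlySupported X))

instance : Module ℂ (CSpace X N) := inferInstanceAs (Module ℂ ↥(compactlySupported X))

instance : Module ℝ (CSpace X N) := Module.complexToReal _

/-- The underlying function (class) on `I`. -/
def toAEFun (φ : CSpace X N) : AEFun a := φ.1

/-- The inductive limit topology: the finest locally convex vector space topology on `X_c(I)`
for which, for every compact `K ⊆ I`, the inclusion of the normed space
`X_K = {φ ∈ X : supp φ ⊆ K}` is continuous (at `0`, hence everywhere, being linear). -/
instance : TopologicalSpace (CSpace X N) :=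
  sInf {t | @IsTopologicalAddGroup _ t _ ∧ @ContinuousSMul ℂ _ _ _ t ∧
    @LocallyConvexSpace ℝ _ _ _ _ _ t ∧
    ∀ K : Set ℝ, IsCompact K → K ⊆ Ioo (-a) a → ∀ U ∈ @nhds _ t 0,
      ∃ ε : ℝ≥0∞, 0 < ε ∧ ∀ φ : CSpace X N,
        SuppIn φ.toAEFun K → N φ.toAEFun < ε → φ ∈ U}

end CSpace

/-- `F_c(I)` with the inductive limit topology. -/
abbrev Fc (a : ℝ) (F : FunctionClass) : Type := CSpace (FI a F) (normF a F)

/-- `W²_c(I; F)` with the inductive limit topology. -/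
abbrev W2c (a : ℝ) (F : FunctionClass) : Type := CSpace (W2I a F) (normW2 a F)

/-! ### The kernel and the operators -/

/-- `H` is a continuous solution, on the open square `|u| + |v| < a`, of
`H(u,v) = ½ ∫₀ᵘ q(s) ds + ∫₀ᵘ ∫₀ᵛ q(α+β) H(α,β) dβ dα`. -/
def IsGoursatSolution (a : ℝ) (q : ℝ → ℂ) (H : ℝ → ℝ → ℂ) : Prop :=
  ContinuousOn (fun z : ℝ × ℝ => H z.1 z.2) {z | |z.1| + |z.2| < a} ∧
  ∀ u v : ℝ, |u| + |v| < a →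
    H u v = (1 / 2) * (∫ s in (0 : ℝ)..u, q s)
      + ∫ α in (0 : ℝ)..u, ∫ β in (0 : ℝ)..v, q (α + β) * H α β

/-- `K(x,t) = H((x+t)/2, (x-t)/2)`. -/
def kernel (H : ℝ → ℝ → ℂ) (x t : ℝ) : ℂ := H ((x + t) / 2) ((x - t) / 2)

/-- `𝐓u(x) = u(x) + ∫_{-x}^{x} K(x,t) u(t) dt`. -/
def volterra (K : ℝ → ℝ → ℂ) (u : ℝ → ℂ) (x : ℝ) : ℂ :=
  u x + ∫ t in (-x)..x, K x t * u t

/-- The transpose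
`𝐓□ψ(x) = ψ(x) - ∫_{-a}^{-|x|} K(t,x) ψ(t) dt + ∫_{|x|}^{a} K(t,x) ψ(t) dt`. -/
def volterraTranspose (a : ℝ) (K : ℝ → ℝ → ℂ) (ψ : ℝ → ℂ) (x : ℝ) : ℂ :=
  ψ x - (∫ t in (-a)..(-|x|), K t x * ψ t) + ∫ t in |x|..a, K t x * ψ t

section Duality

variable {a : ℝ} {X Y : Submodule ℂ (AEFun a)} {N M : AEFun a → ℝ≥0∞}

/-- The map `A` between duals is given by the rule `⟨A u, φ⟩ = ⟨u, B φ⟩`, where `B` is the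
(everywhere defined) operator on test functions whose graph is `B φ = ψ ↔ graph φ ψ`. -/
def IsTransposeOf (A : WeakDual ℂ (CSpace X N) → WeakDual ℂ (CSpace Y M))
    (graph : AEFun a → AEFun a → Prop) : Prop :=
  (∀ φ : CSpace Y M, ∃ ψ : CSpace X N, graph φ.toAEFun ψ.toAEFun) ∧
  ∀ (u : WeakDual ℂ (CSpace X N)) (φ : CSpace Y M) (ψ : CSpace X N),
    graph φ.toAEFun ψ.toAEFun → A u φ = u ψ

/-- `u` is the regular functional `φ ↦ ∫_I g φ` with density `g ∈ L¹_loc(I)`. -/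
def IsRegular (g : ℝ → ℂ) (u : WeakDual ℂ (CSpace X N)) : Prop :=
  LocallyIntegrableOn g (Ioo (-a) a) ∧
  ∀ φ : CSpace X N, IntegrableOn (fun x => g x * φ.toAEFun x) (Ioo (-a) a) ∧
    u φ = ∫ x in Ioo (-a) a, g x * φ.toAEFun x

end Duality

/-- `ψ = 𝐓□ φ`. -/
def VolterraTransposeGraph {a : ℝ} (K : ℝ → ℝ → ℂ) (φ ψ : AEFun a) : Prop :=
  ψ =ᵐ[volume.restrict (Ioo (-a) a)] volterraTranspose a K φ

/-- `ψ = q φ`. -/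
def MulGraph {a : ℝ} (q : ℝ → ℂ) (φ ψ : AEFun a) : Prop :=
  ψ =ᵐ[volume.restrict (Ioo (-a) a)] fun x => q x * φ x

end Transmutation

end

open MeasureTheory Set Topology
open scoped ENNReal ContDiff

noncomputable section

namespace Transmutation

/-! Every claim about the duals is the transpose of a claim about `𝐓□` on test functions. If `𝐓□` is
a continuous bijection of `F_c(I)` and of `W²_c(I; F)` with continuous inverse, then precomposition
with it is an invertible operator on each weak dual, and `(𝐓u)'' - q 𝐓u = 𝐓(u'')` is the transpose
of the commutation relation `(𝐓□φ)'' = 𝐓□(φ'' - qφ)` for `φ` in `W²_c(I; F)`.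

Localisation. A test function lives on some `[-b, b]` with `b < a`. On functions that vanish off
`[-b, b]` one has `𝐓□ = 1 + S` with `S = skew b M`, the support is not enlarged, and only `q` on
`[-b, b]` matters. So `q` may be replaced by a potential `p` of class `F` on the whole line and the
kernel by a continuous function `M` on the plane (`IsModelKernel`). Continuity for the inductive
limit topology reduces to one norm bound for each `b` (`CSpace.continuous_of_bounded`).

Volterra structure. In supremum norms with weight `exp(l|u|)` for the Goursat equation and
`exp(-l|x|)` for `S`, the integral operators have norm at most `1/2` once `l` is large. The Neumann
series gives solutions (`exists_eq_add_of_halving`); iterating the a priori estimate gives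
uniqueness and stability (`norm_le_of_improvement`). In particular the Goursat solution depends on
the potential continuously, from `L¹` to the supremum norm on compact squares (`goursat_stability`).

Commutation. For `q` of class `C¹` the kernel solves `M_tt - M_xx = q(t) M` with `2 M(x, x) = ∫₀ˣ q`
and `M(-x, x) = 0`. Differentiating `Sφ` twice and integrating by parts gives `(Sφ)'' = S(φ'' - qφ)
- qφ` (`IsWaveKernel.second_deriv_eq`). Integrated twice, this identity involves only `q` in `L¹`
and `M` in the supremum norm, so it passes to integrable `q` by approximation (`skew_eq_prim_prim`).
Likewise, if `(1 + S)φ = f` and `(1 + S)w = f''`, then `φ'' = w + qφ` (`eq_prim_prim_of_add_skew`).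
These two formulas turn bounds for `1 + S` and its inverse in `F` into bounds in `W²(I; F)`.

Bounds in `F`. For `L^p`, `S` maps `L¹` into bounded continuous functions. For `C^k`, the kernel is
itself `C^k` and `S` gains derivatives, so regularity is obtained by bootstrapping. Agreement with
`𝐓` on functions is Fubini on the double cone `|t| < |x|` (`integral_volterra_mul`). -/

theorem SuppIn.mono {a : ℝ} {f : AEFun a} {K L : Set ℝ} (h : SuppIn f K) (hKL : K ⊆ L) :
    SuppIn f L := by
  filter_upwards [h] with x hx hn using hx fun hk => hn (hKL hk)

/-- Symmetric intervals are cofinal among the compact subsets of `I`, so all estimates may be made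
on them. -/
theorem exists_subset_Icc {a : ℝ} (ha : 0 < a) {K : Set ℝ} (hK : IsCompact K)
    (hKI : K ⊆ Ioo (-a) a) : ∃ b, 0 < b ∧ b < a ∧ K ⊆ Icc (-b) b := by
  rcases K.eq_empty_or_nonempty with rfl | hne
  · exact ⟨a / 2, by linarith, by linarith, empty_subset _⟩
  obtain ⟨x, hx, hmax⟩ := hK.exists_isMaxOn hne continuous_abs.continuousOn
  have hxa : |x| < a := abs_lt.2 (hKI hx)
  refine ⟨(|x| + a) / 2, by linarith [abs_nonneg x], by linarith, fun y hy => ?_⟩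
  have : |y| ≤ |x| := hmax hy
  exact abs_le.1 (by linarith)

theorem Icc_subset_Ioo_of_lt {a b : ℝ} (h : b < a) : Icc (-b) b ⊆ Ioo (-a) a :=
  fun _ hx => ⟨by linarith [hx.1], by linarith [hx.2]⟩

/-! ### The inductive limit topology and its continuous linear maps -/

namespace CSpace

variable {a : ℝ} {X Y : Submodule ℂ (AEFun a)} {N M : AEFun a → ℝ≥0∞}

theorem toAEFun_injective : Function.Injective (toAEFun : CSpace X N → AEFun a) :=
  Subtype.val_injective

theorem exists_suppIn_Icc (ha : 0 < a) (φ : CSpace X N) :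
    ∃ b, 0 < b ∧ b < a ∧ SuppIn φ.toAEFun (Icc (-b) b) := by
  obtain ⟨K, hK, hKI, h⟩ := φ.2.2
  obtain ⟨b, h0, hb, hKb⟩ := exists_subset_Icc ha hK hKI
  exact ⟨b, h0, hb, h.mono hKb⟩

instance : IsTopologicalAddGroup (CSpace X N) := topologicalAddGroup_sInf fun _ h => h.1

instance : ContinuousSMul ℂ (CSpace X N) := continuousSMul_sInf fun _ h => h.2.1

instance : LocallyConvexSpace ℝ (CSpace X N) := LocallyConvexSpace.sInf fun _ h => h.2.2.1

/-- The defining property of the inductive limit topology passes to the infimum. -/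
theorem exists_norm_lt_subset {K : Set ℝ} (hK : IsCompact K) (hKI : K ⊆ Ioo (-a) a)
    {U : Set (CSpace X N)} (hU : U ∈ 𝓝 (0 : CSpace X N)) :
    ∃ ε : ℝ≥0∞, 0 < ε ∧ ∀ φ : CSpace X N,
      SuppIn φ.toAEFun K → N φ.toAEFun < ε → φ ∈ U := by
  have hle : 𝓝 (0 : CSpace X N) = ⨅ t ∈ {t : TopologicalSpace (CSpace X N) |
      @IsTopologicalAddGroup _ t _ ∧ @ContinuousSMul ℂ _ _ _ t ∧
      @LocallyConvexSpace ℝ _ _ _ _ _ t ∧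
      ∀ K : Set ℝ, IsCompact K → K ⊆ Ioo (-a) a → ∀ U ∈ @nhds _ t 0,
        ∃ ε : ℝ≥0∞, 0 < ε ∧ ∀ φ : CSpace X N,
          SuppIn φ.toAEFun K → N φ.toAEFun < ε → φ ∈ U}, @nhds _ t 0 := nhds_sInf
  -- The sets that contain a ball of the normed space `X_K` form a filter. It is finer than the
  -- neighbourhood filter of `0` in each competing topology, hence finer than the infimum of these.
  let G : Filter (CSpace X N) :=
    { sets := {U | ∃ ε : ℝ≥0∞, 0 < ε ∧ ∀ φ : CSpace X N,
        SuppIn φ.toAEFun K → N φ.toAEFun < ε → φ ∈ U}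
      univ_sets := ⟨1, one_pos, fun _ _ _ => mem_univ _⟩
      sets_of_superset := by
        rintro U V ⟨ε, h0, h⟩ hUV
        exact ⟨ε, h0, fun φ h1 h2 => hUV (h φ h1 h2)⟩
      inter_sets := by
        rintro U V ⟨ε, h0, h⟩ ⟨δ, h0', h'⟩
        exact ⟨min ε δ, lt_min h0 h0', fun φ h1 h2 =>
          ⟨h φ h1 (h2.trans_le (min_le_left _ _)), h' φ h1 (h2.trans_le (min_le_right _ _))⟩⟩ }
  have hG : G ≤ 𝓝 (0 : CSpace X N) := by
    rw [hle]
    exact le_iInf₂ fun t ht U hU => ht.2.2.2 K hK hKI U hU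
  exact hG hU

/-- A linear map between compactly supported spaces that is bounded on the elements supported
in each `[-b, b]` is continuous. -/
theorem continuous_of_bounded (ha : 0 < a) (T : CSpace X N →ₗ[ℂ] CSpace Y M)
    (hT : ∀ b, 0 < b → b < a → ∃ C : NNReal, ∀ φ : CSpace X N, SuppIn φ.toAEFun (Icc (-b) b) →
      ∀ B : NNReal, N φ.toAEFun ≤ B →
        SuppIn (T φ).toAEFun (Icc (-b) b) ∧ M (T φ).toAEFun ≤ (C * B : NNReal)) :
    Continuous T := by
  rw [continuous_iff_le_induced]
  -- The topology induced by `T` is itself one of the competing topologies, so the infimum is finer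
  -- than it.
  refine sInf_le ⟨topologicalAddGroup_induced T, continuousSMul_induced T,
    LocallyConvexSpace.induced (T.restrictScalars ℝ), ?_⟩
  intro K hK hKI U hU
  rw [nhds_induced, map_zero] at hU
  obtain ⟨V, hV, hVU⟩ := hU
  obtain ⟨b, h0, hb, hKb⟩ := exists_subset_Icc ha hK hKI
  obtain ⟨C, hC⟩ := hT b h0 hb
  obtain ⟨ε, hε, h⟩ := exists_norm_lt_subset isCompact_Icc (Icc_subset_Ioo_of_lt hb) hV
  obtain ⟨δ, hδ, hδε⟩ := ENNReal.lt_iff_exists_nnreal_btwn.1 hε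
  have hδ0 : 0 < δ := by exact_mod_cast hδ
  -- The denominator is `C + 1` so that the radius is positive also when `C = 0`.
  refine ⟨((δ / (C + 1) : NNReal) : ℝ≥0∞), 
    ENNReal.coe_pos.2 (div_pos hδ0 (by positivity)), fun φ hφ hN => hVU ?_⟩
  obtain ⟨h1, h2⟩ := hC φ (hφ.mono hKb) _ hN.le
  refine h _ h1 (h2.trans_lt (lt_of_le_of_lt ?_ hδε))
  have : C * (δ / (C + 1)) ≤ δ := by
    rw [mul_div_left_comm]
    exact mul_le_of_le_one_right (by positivity) (div_le_one_of_le₀ (by simp) (by positivity))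
  exact_mod_cast this

/-- A linear relation that is bounded on the elements supported in each `[-b, b]` is the graph of
a continuous linear map. -/
theorem exists_continuousLinearMap (ha : 0 < a) (R : AEFun a → AEFun a → Prop)
    (huniq : ∀ φ : CSpace X N, ∀ ψ ψ' : CSpace Y M, R φ.toAEFun ψ.toAEFun →
      R φ.toAEFun ψ'.toAEFun → ψ.toAEFun = ψ'.toAEFun)
    (hadd : ∀ φ φ' : CSpace X N, ∀ ψ ψ' : CSpace Y M, R φ.toAEFun ψ.toAEFun →
      R φ'.toAEFun ψ'.toAEFun → R (φ.toAEFun + φ'.toAEFun) (ψ.toAEFun + ψ'.toAEFun))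
    (hsmul : ∀ (c : ℂ) (φ : CSpace X N) (ψ : CSpace Y M), R φ.toAEFun ψ.toAEFun →
      R (c • φ.toAEFun) (c • ψ.toAEFun))
    (hfin : ∀ φ : CSpace X N, N φ.toAEFun < ⊤)
    (hb : ∀ b, 0 < b → b < a → ∃ C : NNReal, ∀ φ : CSpace X N, SuppIn φ.toAEFun (Icc (-b) b) →
      ∀ B : NNReal, N φ.toAEFun ≤ B → ∃ ψ : CSpace Y M, SuppIn ψ.toAEFun (Icc (-b) b) ∧
        R φ.toAEFun ψ.toAEFun ∧ M ψ.toAEFun ≤ (C * B : NNReal)) :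
    ∃ T : CSpace X N →L[ℂ] CSpace Y M, ∀ φ, R φ.toAEFun (T φ).toAEFun := by
  have hex : ∀ φ : CSpace X N, ∃ ψ : CSpace Y M, R φ.toAEFun ψ.toAEFun := by
    intro φ
    obtain ⟨b, h0, hba, hs⟩ := exists_suppIn_Icc ha φ
    obtain ⟨C, hC⟩ := hb b h0 hba
    obtain ⟨ψ, -, h, -⟩ := hC φ hs (N φ.toAEFun).toNNReal (ENNReal.coe_toNNReal (hfin φ).ne).ge
    exact ⟨ψ, h⟩
  choose T hT using hex
  let L : CSpace X N →ₗ[ℂ] CSpace Y M :=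
    { toFun := T
      map_add' := fun φ ψ => toAEFun_injective <|
        huniq (φ + ψ) _ (T φ + T ψ) (hT _) (hadd _ _ _ _ (hT φ) (hT ψ))
      map_smul' := fun c φ => toAEFun_injective <|
        huniq (c • φ) _ (c • T φ) (hT _) (hsmul _ _ _ (hT φ)) }
  refine ⟨⟨L, continuous_of_bounded ha L fun b h0 hba => ?_⟩, hT⟩
  obtain ⟨C, hC⟩ := hb b h0 hba
  refine ⟨C, fun φ hs B hB => ?_⟩
  obtain ⟨ψ, h1, h2, h3⟩ := hC φ hs B hB
  have : (L φ).toAEFun = ψ.toAEFun := huniq φ _ _ (hT φ) h2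
  rw [this]
  exact ⟨h1, h3⟩

end CSpace

/-! ### Transposes on weak duals -/

section Precomposition

variable {E G : Type*} [AddCommGroup E] [Module ℂ E] [TopologicalSpace E]
  [AddCommGroup G] [Module ℂ G] [TopologicalSpace G]

/-- Precomposition with a continuous linear map, as a map between weak duals. -/
def weakDualPrecomp (T : E →L[ℂ] G) : WeakDual ℂ G →L[ℂ] WeakDual ℂ E where
  toFun u := (WeakDual.toStrongDual u ∘L T : E →L[ℂ] ℂ)
  map_add' _ _ := rfl
  map_smul' _ _ := rfl
  cont := WeakDual.continuous_of_continuous_eval fun x => WeakDual.eval_continuous (T x)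

theorem weakDualPrecomp_apply (T : E →L[ℂ] G) (u : WeakDual ℂ G) (x : E) :
    weakDualPrecomp T u x = u (T x) := rfl

/-- Precomposition with an invertible continuous linear map, as an equivalence of weak duals. -/
def weakDualPrecompEquiv (T : E →L[ℂ] G) (S : G →L[ℂ] E) (hTS : ∀ x, T (S x) = x)
    (hST : ∀ x, S (T x) = x) : WeakDual ℂ G ≃L[ℂ] WeakDual ℂ E :=
  ContinuousLinearEquiv.equivOfInverse (weakDualPrecomp T) (weakDualPrecomp S)
    (fun u => DFunLike.ext _ _ fun x => by simp only [weakDualPrecomp_apply, hTS])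
    (fun u => DFunLike.ext _ _ fun x => by simp only [weakDualPrecomp_apply, hST])

theorem weakDualPrecompEquiv_apply (T : E →L[ℂ] G) (S : G →L[ℂ] E) (hTS : ∀ x, T (S x) = x)
    (hST : ∀ x, S (T x) = x) (u : WeakDual ℂ G) (x : E) :
    weakDualPrecompEquiv T S hTS hST u x = u (T x) := rfl

end Precomposition

/-! ### Abstract Volterra iteration -/

section VolterraIteration

/-- If every bound `A` for `D` can be improved to `B + A / 2`, then `D` is bounded by `2 B`. -/
theorem norm_le_of_improvement {X : Type*} {s : Set X} {D : X → ℂ} {w : X → ℝ} {A B : ℝ}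
    (hA : 0 ≤ A) (hB : 0 ≤ B)
    (hD : ∀ x ∈ s, ‖D x‖ ≤ A * w x)
    (h : ∀ A', 0 ≤ A' → (∀ x ∈ s, ‖D x‖ ≤ A' * w x) → ∀ x ∈ s, ‖D x‖ ≤ (B + A' / 2) * w x) :
    ∀ x ∈ s, ‖D x‖ ≤ 2 * B * w x := by
  -- `2 * B` is the fixed point of `A ↦ B + A / 2`, so the excess over it halves with each use of
  -- `h`.
  have key : ∀ n : ℕ, ∀ x ∈ s, ‖D x‖ ≤ (2 * B + A * (1 / 2) ^ n) * w x := by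
    intro n
    induction n with
    | zero =>
      intro x hx
      have h1 := h A hA hD x hx
      have hw : 0 ≤ A * w x := (norm_nonneg _).trans (hD x hx)
      -- The weight is not assumed nonnegative. For `A > 0` this follows from `hD`; for `A = 0` one
      -- improvement already gives `0 ≤ B * w x`.
      rcases hA.eq_or_lt with h0 | h0
      · subst h0
        have := hD x hx
        have h2 := h1
        have h3 : ‖D x‖ = 0 := le_antisymm (by simpa using this) (norm_nonneg _)
        rw [h3] at h2 ⊢
        simp only [zero_div, add_zero, zero_mul] at h2 ⊢
        linarith
      · have hw' : 0 ≤ w x := nonneg_of_mul_nonneg_right hw h0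
        have := hD x hx
        simp only [pow_zero, mul_one]
        nlinarith [mul_nonneg hB hw']
    | succ n ih =>
      intro x hx
      have := h _ (by positivity) ih x hx
      convert this using 2
      ring
  intro x hx
  have hlim : Filter.Tendsto (fun n : ℕ => (2 * B + A * (1 / 2 : ℝ) ^ n) * w x) Filter.atTop
      (𝓝 ((2 * B + A * 0) * w x)) :=
    ((tendsto_const_nhds.mul
      (tendsto_pow_atTop_nhds_zero_of_lt_one (by norm_num) (by norm_num))).const_add _).mul_const _
  simpa using ge_of_tendsto' hlim fun n => key n x hx

/-- Solution of `h = f + V h` by iteration when `V` halves a weighted supremum norm. -/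
theorem exists_eq_add_of_halving {X : Type*} [TopologicalSpace X] (V : (X → ℂ) → X → ℂ)
    {w : X → ℝ} (hw : Continuous w) (hw0 : ∀ x, 0 < w x)
    (hc : ∀ h, Continuous h → Continuous (V h))
    (hsub : ∀ h g, Continuous h → Continuous g → ∀ x, V (h - g) x = V h x - V g x)
    (hV : ∀ h, Continuous h → ∀ B : ℝ, 0 ≤ B → (∀ x, ‖h x‖ ≤ B * w x) →
      ∀ x, ‖V h x‖ ≤ B / 2 * w x)
    {f : X → ℂ} (hf : Continuous f) {B : ℝ} (hB : 0 ≤ B) (hfB : ∀ x, ‖f x‖ ≤ B * w x) :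
    ∃ h : X → ℂ, Continuous h ∧ (∀ x, ‖h x‖ ≤ 2 * B * w x) ∧ ∀ x, h x = f x + V h x := by
  -- The terms of the Neumann series.
  let g : ℕ → X → ℂ := fun n => V^[n] f
  have hgs : ∀ n, g (n + 1) = V (g n) := fun n => Function.iterate_succ_apply' V n f
  have hgc : ∀ n, Continuous (g n) := by
    intro n
    induction n with
    | zero => exact hf
    | succ n ih => rw [hgs]; exact hc _ ih
  have hgb : ∀ n x, ‖g n x‖ ≤ B * (1 / 2) ^ n * w x := by
    intro n
    induction n with
    | zero => intro x; simpa [g] using hfB x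
    | succ n ih =>
      intro x
      rw [hgs]
      refine (hV _ (hgc n) _ (by positivity) ih x).trans_eq ?_
      ring
  have hsum : Summable fun n : ℕ => B * (1 / 2 : ℝ) ^ n :=
    (summable_geometric_of_lt_one (by norm_num) (by norm_num)).mul_left B
  have htot : ∑' n : ℕ, B * (1 / 2 : ℝ) ^ n = 2 * B := by
    rw [tsum_mul_left, tsum_geometric_of_lt_one (by norm_num) (by norm_num)]; ring
  have hsx : ∀ x, Summable fun n => g n x := fun x =>
    Summable.of_norm_bounded (hsum.mul_right (w x)) fun n => hgb n x
  let h : X → ℂ := fun x => ∑' n, g n x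
  have hhb : ∀ x, ‖h x‖ ≤ 2 * B * w x := by
    intro x
    rw [← htot, ← tsum_mul_right]
    exact tsum_of_norm_bounded (hsum.mul_right (w x)).hasSum fun n => hgb n x
  have hhc : Continuous h := by
    -- The convergence is uniform only after division by the weight.
    have h1 : Continuous fun x => ∑' n, g n x / (w x : ℂ) := by
      refine continuous_tsum (fun n => (hgc n).div (Complex.continuous_ofReal.comp hw)
        fun x => Complex.ofReal_ne_zero.2 (hw0 x).ne') hsum fun n x => ?_
      rw [norm_div, Complex.norm_real, Real.norm_of_nonneg (hw0 x).le, div_le_iff₀ (hw0 x)]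
      exact hgb n x
    have h2 : h = fun x => (∑' n, g n x / (w x : ℂ)) * (w x : ℂ) := by
      funext x
      rw [tsum_div_const, div_mul_cancel₀ _ (Complex.ofReal_ne_zero.2 (hw0 x).ne')]
    rw [h2]
    exact h1.mul (Complex.continuous_ofReal.comp hw)
  let p : ℕ → X → ℂ := fun n x => ∑ i ∈ Finset.range n, g i x
  have hpc : ∀ n, Continuous (p n) := fun n => continuous_finsetSum _ fun i _ => hgc i
  have hps : ∀ n x, p (n + 1) x = f x + V (p n) x := by
    intro n
    induction n with
    | zero =>
      intro x
      have h0 := hsub f f hf hf x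
      -- The empty sum is written as a difference because `V 0 = 0` is available only through
      -- `hsub`.
      have : p 0 = f - f := by funext y; simp [p]
      rw [this, h0]
      simp [p, g]
    | succ n ih =>
      intro x
      have h1 : p n = p (n + 1) - g n := by
        funext y; simp [p, Finset.sum_range_succ]
      have h2 := ih x
      rw [h1, hsub _ _ (hpc _) (hgc _), ← hgs] at h2
      have h3 : p (n + 1 + 1) x = p (n + 1) x + g (n + 1) x := by
        simp [p, Finset.sum_range_succ]
      rw [h3, h2]
      ring
  have htail : ∀ n x, ‖(h - p n) x‖ ≤ (2 * B * (1 / 2) ^ n) * w x := by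
    intro n x
    have : (h - p n) x = ∑' i, g (i + n) x := by
      simp only [Pi.sub_apply, h, p]
      rw [← (hsx x).sum_add_tsum_nat_add n]; ring
    rw [this]
    have hh : HasSum (fun i : ℕ => B * (1 / 2 : ℝ) ^ (i + n) * w x)
        ((2 * B * (1 / 2) ^ n) * w x) := by
      have := (hsum.hasSum.mul_right ((1 / 2 : ℝ) ^ n * w x))
      rw [htot] at this
      rw [show (2 * B * (1 / 2) ^ n) * w x = 2 * B * ((1 / 2) ^ n * w x) by ring]
      have hfun : (fun i : ℕ => B * (1 / 2 : ℝ) ^ (i + n) * w x) =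
          fun i : ℕ => B * (1 / 2) ^ i * ((1 / 2) ^ n * w x) := by
        funext i; rw [pow_add]; ring
      rwa [hfun]
    exact tsum_of_norm_bounded hh fun i => hgb _ x
  refine ⟨h, hhc, hhb, fun x => ?_⟩
  -- The residual is a tail of the series minus `V` of a tail, and both are of order `2⁻ⁿ`.
  have hle : ∀ n : ℕ, ‖h x - (f x + V h x)‖ ≤ (2 * B * w x) * (1 / 2 : ℝ) ^ n := by
    intro n
    have h1 := hV _ (hhc.sub (hpc n)) _ (by positivity) (htail n) x
    have h2 := htail (n + 1) x
    rw [hsub _ _ hhc (hpc n)] at h1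
    have : h x - (f x + V h x) = (h - p (n + 1)) x - (V h x - V (p n) x) := by
      rw [Pi.sub_apply, hps]; ring
    rw [this]
    refine (norm_sub_le _ _).trans ((add_le_add h2 h1).trans_eq ?_)
    rw [pow_succ]; ring
  have hlim : Filter.Tendsto (fun n : ℕ => (2 * B * w x) * (1 / 2 : ℝ) ^ n) Filter.atTop
      (𝓝 ((2 * B * w x) * 0)) :=
    tendsto_const_nhds.mul (tendsto_pow_atTop_nhds_zero_of_lt_one (by norm_num) (by norm_num))
  have := ge_of_tendsto' hlim hle
  rw [mul_zero] at this
  exact sub_eq_zero.1 (norm_le_zero_iff.1 this)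

end VolterraIteration

/-! ### Continuity of integrals with an integrable factor -/

section ParametricIntegral

/-- Dominated convergence: `g` is bounded over a compact neighbourhood of the parameter, so a
multiple of `‖q‖` is a majorant. No continuity of `q` is needed, since the parameter enters only `g`
and the limit of integration. -/
theorem continuous_primitive_mul {X : Type*} [TopologicalSpace X] [FirstCountableTopology X]
    [LocallyCompactSpace X] {q : ℝ → ℂ} (hq : LocallyIntegrable q) {g : X → ℝ → ℂ}
    (hg : Continuous fun p : X × ℝ => g p.1 p.2) :
    Continuous fun p : X × ℝ => ∫ t in (0 : ℝ)..p.2, q t * g p.1 t := by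
  rw [continuous_iff_continuousAt]
  rintro ⟨x₀, b₀⟩
  obtain ⟨K, hK, hKx⟩ := exists_compact_mem_nhds x₀
  -- The interval from `l` to `r` contains both `0` and `b₀` in its interior.
  set l : ℝ := -(|b₀| + 1) with hl
  set r : ℝ := |b₀| + 1 with hr
  obtain ⟨A, hA⟩ := (hK.prod (isCompact_Icc (a := l) (b := r))).exists_bound_of_continuousOn
    hg.continuousOn
  have hlr : l ≤ r := by rw [hl, hr]; linarith [abs_nonneg b₀]
  refine intervalIntegral.continuousAt_parametric_primitive_of_dominated (X := X)
    (F := fun x t => q t * g x t) (fun t => ‖q t‖ * A) l r ?_ ?_ ?_ ?_ ?_ ?_ ?_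
  · intro x
    exact hq.aestronglyMeasurable.restrict.mul
      (hg.comp (Continuous.prodMk_right x)).aestronglyMeasurable
  · filter_upwards [hKx] with x hx
    refine (ae_restrict_iff' measurableSet_uIoc).2 (Filter.Eventually.of_forall fun t ht => ?_)
    rw [uIoc_of_le hlr] at ht
    rw [norm_mul]
    exact mul_le_mul_of_nonneg_left (hA (x, t) ⟨hx, ht.1.le, ht.2⟩) (norm_nonneg _)
  · exact (hq.integrableOn_isCompact isCompact_uIcc).intervalIntegrable.norm.mul_const A
  · exact Filter.Eventually.of_forall fun t =>
      continuousAt_const.mul (hg.comp (Continuous.prodMk_left t)).continuousAt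
  · constructor <;> simp only [hl, hr] <;> linarith [abs_nonneg b₀]
  · constructor <;> simp only [hl, hr] <;> linarith [le_abs_self b₀, neg_abs_le b₀]
  · simp

theorem continuous_intervalIntegral_mul {X : Type*} [TopologicalSpace X]
    [FirstCountableTopology X] [LocallyCompactSpace X] {q : ℝ → ℂ} (hq : LocallyIntegrable q)
    {g : X → ℝ → ℂ} (hg : Continuous fun p : X × ℝ => g p.1 p.2) {c d : X → ℝ}
    (hc : Continuous c) (hd : Continuous d) :
    Continuous fun x => ∫ t in c x..d x, q t * g x t := by
  have h := continuous_primitive_mul hq hg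
  have hi : ∀ x u v, IntervalIntegrable (fun t => q t * g x t) volume u v := fun x u v =>
    (hq.integrableOn_isCompact isCompact_uIcc).intervalIntegrable.mul_continuousOn
      (hg.comp (Continuous.prodMk_right x)).continuousOn
  have e : (fun x => ∫ t in c x..d x, q t * g x t) = fun x =>
      (∫ t in (0 : ℝ)..d x, q t * g x t) - ∫ t in (0 : ℝ)..c x, q t * g x t := by
    funext x
    rw [intervalIntegral.integral_interval_sub_left (hi _ _ _) (hi _ _ _)]
  rw [e]
  exact (h.comp (continuous_id.prodMk hd)).sub (h.comp (continuous_id.prodMk hc))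

end ParametricIntegral

/-! ### The Goursat integral equation -/

/-- The integral operator of the Goursat problem. -/
def goursatOp (q : ℝ → ℂ) (h : ℝ × ℝ → ℂ) (z : ℝ × ℝ) : ℂ :=
  ∫ α in (0 : ℝ)..z.1, ∫ β in (0 : ℝ)..z.2, q (α + β) * h (α, β)

/-- The right-hand side of the Goursat integral equation without the integral operator. -/
def goursatInit (q : ℝ → ℂ) (z : ℝ × ℝ) : ℂ := (1 / 2) * ∫ s in (0 : ℝ)..z.1, q s

/-- The closed square `|u| + |v| ≤ r`. -/
def diamond (r : ℝ) : Set (ℝ × ℝ) := {z | |z.1| + |z.2| ≤ r}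

theorem isCompact_diamond (r : ℝ) : IsCompact (diamond r) := by
  refine Metric.isCompact_of_isClosed_isBounded
    (isClosed_le (by fun_prop) continuous_const) ?_
  refine (Metric.isBounded_closedBall (x := (0 : ℝ × ℝ)) (r := r)).subset fun y hy => ?_
  have hy' : |y.1| + |y.2| ≤ r := hy
  rw [mem_closedBall_zero_iff, Prod.norm_def]
  exact max_le (by rw [Real.norm_eq_abs]; linarith [abs_nonneg y.2])
    (by rw [Real.norm_eq_abs]; linarith [abs_nonneg y.1])

theorem abs_le_of_mem_uIcc_zero {x y : ℝ} (h : x ∈ uIcc 0 y) : |x| ≤ |y| := by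
  simpa using abs_sub_left_of_mem_uIcc h

/-- The rectangle spanned by the origin and a point of the diamond stays in the diamond, so the
integral equation closes on each diamond. -/
theorem mem_diamond_of_mem_uIcc {r u v α β : ℝ} (h : (u, v) ∈ diamond r) (hα : α ∈ uIcc 0 u)
    (hβ : β ∈ uIcc 0 v) : (α, β) ∈ diamond r :=
  (add_le_add (abs_le_of_mem_uIcc_zero hα) (abs_le_of_mem_uIcc_zero hβ)).trans h

theorem norm_intervalIntegral_le_integral_norm {q : ℝ → ℂ} (hq : Integrable q) (u v : ℝ) :
    |∫ s in u..v, ‖q s‖| ≤ ∫ s, ‖q s‖ := by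
  have h0 : 0 ≤ᵐ[volume] fun s => ‖q s‖ := Filter.Eventually.of_forall fun s => norm_nonneg _
  rw [intervalIntegral.abs_integral_eq_abs_integral_uIoc, abs_of_nonneg
    (setIntegral_nonneg measurableSet_uIoc fun s _ => norm_nonneg _)]
  exact setIntegral_le_integral hq.norm h0

theorem norm_integral_mul_le {q f : ℝ → ℂ} (hq : Integrable q) {A u v : ℝ}
    (hf : ∀ s ∈ uIcc u v, ‖f s‖ ≤ A) : ‖∫ s in u..v, q s * f s‖ ≤ (∫ s, ‖q s‖) * A := by
  have hA : 0 ≤ A := (norm_nonneg _).trans (hf u left_mem_uIcc)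
  have h1 := intervalIntegral.norm_integral_le_abs_of_norm_le (f := fun s => q s * f s)
    (g := fun s => ‖q s‖ * A) (a := u) (b := v) (μ := volume) ?_
    (hq.norm.mul_const A).intervalIntegrable
  · refine h1.trans ?_
    rw [intervalIntegral.integral_mul_const, abs_mul, abs_of_nonneg hA]
    exact mul_le_mul_of_nonneg_right (norm_intervalIntegral_le_integral_norm hq u v) hA
  · refine (ae_restrict_iff' measurableSet_uIoc).2 (Filter.Eventually.of_forall fun s hs => ?_)
    rw [norm_mul]
    exact mul_le_mul_of_nonneg_left (hf s (uIoc_subset_uIcc hs)) (norm_nonneg _)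

theorem abs_integral_exp_abs_le {l : ℝ} (hl : 0 < l) (u : ℝ) :
    |∫ α in (0 : ℝ)..u, Real.exp (l * |α|)| ≤ Real.exp (l * |u|) / l := by
  have key : ∀ v : ℝ, 0 ≤ v → ∫ α in (0 : ℝ)..v, Real.exp (l * |α|) ≤ Real.exp (l * v) / l := by
    intro v hv
    have : ∫ α in (0 : ℝ)..v, Real.exp (l * |α|) = ∫ α in (0 : ℝ)..v, Real.exp (l * α) := by
      refine intervalIntegral.integral_congr fun α hα => ?_
      rw [uIcc_of_le hv] at hα
      simp only [abs_of_nonneg hα.1]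
    rw [this, intervalIntegral.integral_comp_mul_left _ hl.ne', integral_exp, smul_eq_mul,
      inv_mul_eq_div]
    gcongr
    linarith [Real.exp_pos (l * 0)]
  have hsym : |∫ α in (0 : ℝ)..u, Real.exp (l * |α|)| =
      ∫ α in (0 : ℝ)..|u|, Real.exp (l * |α|) := by
    rcases le_total 0 u with h | h
    · rw [abs_of_nonneg h, abs_of_nonneg]
      exact intervalIntegral.integral_nonneg h fun _ _ => (Real.exp_pos _).le
    · have : ∫ α in (0 : ℝ)..u, Real.exp (l * |α|) = -∫ α in (0 : ℝ)..(-u), Real.exp (l * |α|) := by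
        have := intervalIntegral.integral_comp_neg (a := 0) (b := -u)
          (fun α => Real.exp (l * |α|))
        simp only [abs_neg, neg_neg, neg_zero] at this
        rw [this, intervalIntegral.integral_symm]
      rw [this, abs_neg, abs_of_nonpos h, abs_of_nonneg]
      exact intervalIntegral.integral_nonneg (by linarith) fun _ _ => (Real.exp_pos _).le
  rw [hsym]
  exact key _ (abs_nonneg u)

/-- The inner integral costs the `L¹` norm of `q`, by translation invariance, while integrating the
weight in `α` gains `1 / l`. A large `l` therefore makes the operator small. -/
theorem norm_goursatOp_le {q : ℝ → ℂ} (hq : Integrable q) {h : ℝ × ℝ → ℂ} {l B u v : ℝ}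
    (hl : 0 < l) (hB : 0 ≤ B)
    (hh : ∀ α ∈ uIcc 0 u, ∀ β ∈ uIcc 0 v, ‖h (α, β)‖ ≤ B * Real.exp (l * |α|)) :
    ‖goursatOp q h (u, v)‖ ≤ (∫ s, ‖q s‖) / l * B * Real.exp (l * |u|) := by
  have hn : 0 ≤ ∫ s, ‖q s‖ := integral_nonneg fun s => norm_nonneg _
  have h1 : ∀ α ∈ uIcc 0 u, ‖∫ β in (0 : ℝ)..v, q (α + β) * h (α, β)‖ ≤
      (∫ s, ‖q s‖) * B * Real.exp (l * |α|) := by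
    intro α hα
    have := norm_integral_mul_le (hq.comp_add_left α) (hh α hα)
    rw [integral_add_left_eq_self (fun s => ‖q s‖) α] at this
    rwa [mul_assoc]
  have h2 := intervalIntegral.norm_integral_le_abs_of_norm_le (a := 0) (b := u) (μ := volume)
    (f := fun α => ∫ β in (0 : ℝ)..v, q (α + β) * h (α, β))
    (g := fun α => (∫ s, ‖q s‖) * B * Real.exp (l * |α|))
    ((ae_restrict_iff' measurableSet_uIoc).2
      (Filter.Eventually.of_forall fun α hα => h1 α (uIoc_subset_uIcc hα)))
    (by apply Continuous.intervalIntegrable; fun_prop)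
  refine h2.trans ?_
  rw [intervalIntegral.integral_const_mul, abs_mul, abs_of_nonneg (mul_nonneg hn hB)]
  refine (mul_le_mul_of_nonneg_left (abs_integral_exp_abs_le hl u)
    (mul_nonneg hn hB)).trans_eq ?_
  ring

/-- The substitution `s = z.1 + β` removes the parameter from `q`, which need not be continuous, and
puts it into the continuous factor and the limits. -/
theorem continuous_goursat_inner {q : ℝ → ℂ} (hq : Integrable q) {h : ℝ × ℝ → ℂ}
    (hh : Continuous h) :
    Continuous fun z : ℝ × ℝ => ∫ β in (0 : ℝ)..z.2, q (z.1 + β) * h (z.1, β) := by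
  have h1 := continuous_intervalIntegral_mul (X := ℝ × ℝ) hq.locallyIntegrable
    (g := fun z s => h (z.1, s - z.1)) (by fun_prop) (c := fun z => z.1)
    (d := fun z => z.1 + z.2) (by fun_prop) (by fun_prop)
  refine h1.congr fun z => ?_
  have := intervalIntegral.integral_comp_add_left (a := 0) (b := z.2)
    (fun s => q s * h (z.1, s - z.1)) z.1
  simp only [add_zero, add_sub_cancel_left] at this
  rw [this]

theorem continuous_goursatOp {q : ℝ → ℂ} (hq : Integrable q) {h : ℝ × ℝ → ℂ}
    (hh : Continuous h) : Continuous (goursatOp q h) := by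
  have h1 := continuous_goursat_inner hq hh
  exact intervalIntegral.continuous_parametric_intervalIntegral_of_continuous
    (f := fun (z : ℝ × ℝ) α => ∫ β in (0 : ℝ)..z.2, q (α + β) * h (α, β))
    (h1.comp (by fun_prop : Continuous fun p : (ℝ × ℝ) × ℝ => (p.2, p.1.2))) continuous_fst

theorem intervalIntegrable_goursat {q : ℝ → ℂ} (hq : Integrable q) {h : ℝ × ℝ → ℂ}
    (hh : Continuous h) (α v : ℝ) :
    IntervalIntegrable (fun β => q (α + β) * h (α, β)) volume 0 v :=
  (hq.comp_add_left α).intervalIntegrable.mul_continuousOn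
    (hh.comp (Continuous.prodMk_right α)).continuousOn

theorem intervalIntegrable_goursat_inner {q : ℝ → ℂ} (hq : Integrable q) {h : ℝ × ℝ → ℂ}
    (hh : Continuous h) (u v : ℝ) :
    IntervalIntegrable (fun α => ∫ β in (0 : ℝ)..v, q (α + β) * h (α, β)) volume 0 u :=
  ((continuous_goursat_inner hq hh).comp (Continuous.prodMk_left v)).intervalIntegrable _ _

theorem goursatOp_sub {q : ℝ → ℂ} (hq : Integrable q) {h g : ℝ × ℝ → ℂ}
    (hh : Continuous h) (hg : Continuous g) (z : ℝ × ℝ) :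
    goursatOp q (h - g) z = goursatOp q h z - goursatOp q g z := by
  unfold goursatOp
  rw [← intervalIntegral.integral_sub (intervalIntegrable_goursat_inner hq hh _ _)
    (intervalIntegrable_goursat_inner hq hg _ _)]
  refine intervalIntegral.integral_congr fun α _ => ?_
  rw [← intervalIntegral.integral_sub (intervalIntegrable_goursat hq hh _ _)
    (intervalIntegrable_goursat hq hg _ _)]
  refine intervalIntegral.integral_congr fun β _ => ?_
  simp only [Pi.sub_apply]
  ring

theorem goursatOp_sub_left {q p : ℝ → ℂ} (hq : Integrable q) (hp : Integrable p)
    {h : ℝ × ℝ → ℂ} (hh : Continuous h) (z : ℝ × ℝ) :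
    goursatOp (q - p) h z = goursatOp q h z - goursatOp p h z := by
  unfold goursatOp
  rw [← intervalIntegral.integral_sub (intervalIntegrable_goursat_inner hq hh _ _)
    (intervalIntegrable_goursat_inner hp hh _ _)]
  refine intervalIntegral.integral_congr fun α _ => ?_
  rw [← intervalIntegral.integral_sub (intervalIntegrable_goursat hq hh _ _)
    (intervalIntegrable_goursat hp hh _ _)]
  refine intervalIntegral.integral_congr fun β _ => ?_
  simp only [Pi.sub_apply]
  ring

/-- Since `|α + β| ≤ |α| + |β| ≤ r`, the operator on the diamond sees the potential only on `[-r,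
r]`. This allows potentials to be cut off. -/
theorem goursatOp_congr {q p : ℝ → ℂ} {h g : ℝ × ℝ → ℂ} {r : ℝ}
    (hqp : ∀ s ∈ Icc (-r) r, q s = p s) (hhg : ∀ z ∈ diamond r, h z = g z) {z : ℝ × ℝ}
    (hz : z ∈ diamond r) : goursatOp q h z = goursatOp p g z := by
  obtain ⟨u, v⟩ := z
  refine intervalIntegral.integral_congr fun α hα => ?_
  refine intervalIntegral.integral_congr fun β hβ => ?_
  have h1 := mem_diamond_of_mem_uIcc hz hα hβ
  rw [hhg _ h1, hqp _ (abs_le.1 ((abs_add_le α β).trans h1))]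

theorem goursatInit_congr {q p : ℝ → ℂ} {r : ℝ}
    (hqp : ∀ s ∈ Icc (-r) r, q s = p s) {z : ℝ × ℝ}
    (hz : z ∈ diamond r) : goursatInit q z = goursatInit p z := by
  unfold goursatInit
  congr 1
  refine intervalIntegral.integral_congr fun s hs => ?_
  have h1 : |z.1| + |z.2| ≤ r := hz
  exact hqp _ (abs_le.1 ((abs_le_of_mem_uIcc_zero hs).trans
    (by linarith [abs_nonneg z.2])))

theorem norm_goursatInit_le {q : ℝ → ℂ} (hq : Integrable q) (z : ℝ × ℝ) :
    ‖goursatInit q z‖ ≤ ∫ s, ‖q s‖ := by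
  have h1 := norm_integral_mul_le (f := fun _ => (1 / 2 : ℂ)) (A := 1 / 2) (u := 0) (v := z.1) hq
    (fun s _ => by norm_num)
  rw [intervalIntegral.integral_mul_const, mul_comm] at h1
  have hn : 0 ≤ ∫ s, ‖q s‖ := integral_nonneg fun s => norm_nonneg _
  exact h1.trans (by linarith)

theorem continuous_goursatInit {q : ℝ → ℂ} (hq : Integrable q) : Continuous (goursatInit q) :=
  continuous_const.mul ((intervalIntegral.continuous_primitive
    (fun _ _ => hq.intervalIntegrable) 0).comp continuous_fst)

theorem exists_global_goursat {q : ℝ → ℂ} (hq : Integrable q) :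
    ∃ H : ℝ × ℝ → ℂ, Continuous H ∧ ∀ z, H z = goursatInit q z + goursatOp q H z := by
  have hn : 0 ≤ ∫ s, ‖q s‖ := integral_nonneg fun s => norm_nonneg _
  -- With this `l` the factor `(∫ s, ‖q s‖) / l` is at most `1 / 2`.
  set l : ℝ := 2 * (∫ s, ‖q s‖) + 1 with hl
  have hl0 : 0 < l := by positivity
  have h1 : ∀ h : ℝ × ℝ → ℂ, Continuous h → ∀ B : ℝ, 0 ≤ B →
      (∀ z, ‖h z‖ ≤ B * Real.exp (l * |z.1|)) →
      ∀ z, ‖goursatOp q h z‖ ≤ B / 2 * Real.exp (l * |z.1|) := by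
    intro h _ B hB hb z
    refine (norm_goursatOp_le hq hl0 hB fun α _ β _ => hb (α, β)).trans ?_
    gcongr
    rw [div_mul_eq_mul_div, div_le_div_iff₀ hl0 two_pos, hl]
    nlinarith
  have h2 : ∀ z : ℝ × ℝ, ‖goursatInit q z‖ ≤ (∫ s, ‖q s‖) * Real.exp (l * |z.1|) := fun z =>
    (norm_goursatInit_le hq z).trans
      (le_mul_of_one_le_right hn (Real.one_le_exp (by positivity)))
  obtain ⟨H, h3, -, h4⟩ := exists_eq_add_of_halving (goursatOp q)
    (w := fun z : ℝ × ℝ => Real.exp (l * |z.1|)) (by fun_prop) (fun _ => Real.exp_pos _)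
    (fun h hh => continuous_goursatOp hq hh) (fun h g hh hg z => goursatOp_sub hq hh hg z)
    h1 (continuous_goursatInit hq) hn h2
  exact ⟨H, h3, h4⟩

/-- The difference `D = G - H` solves `D = goursatInit (p - q) + goursatOp (p - q) H + goursatOp p
D`, whose source is of size `(1 + A) ∫ ‖p - q‖`. Only an upper bound `L` of `∫ ‖p‖` enters the
constant, so the estimate is uniform along approximations of `q`. -/
theorem goursat_stability {q p : ℝ → ℂ} (hq : Integrable q) (hp : Integrable p)
    {H G : ℝ × ℝ → ℂ} (hH : Continuous H) (hG : Continuous G) {r A L : ℝ}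
    (hHe : ∀ z ∈ diamond r, H z = goursatInit q z + goursatOp q H z)
    (hGe : ∀ z ∈ diamond r, G z = goursatInit p z + goursatOp p G z)
    (hA : ∀ z ∈ diamond r, ‖H z‖ ≤ A) (hL : ∫ s, ‖p s‖ ≤ L) {z : ℝ × ℝ} (hz : z ∈ diamond r) :
    ‖G z - H z‖ ≤ 2 * ((1 + A) * ∫ s, ‖p s - q s‖) * Real.exp ((2 * L + 1) * r) := by
  have hn : 0 ≤ ∫ s, ‖p s - q s‖ := integral_nonneg fun s => norm_nonneg _
  have hnp : 0 ≤ ∫ s, ‖p s‖ := integral_nonneg fun s => norm_nonneg _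
  have hL0 : 0 ≤ L := hnp.trans hL
  have hA0 : 0 ≤ A := (norm_nonneg _).trans (hA z hz)
  set l : ℝ := 2 * L + 1 with hl
  have hl0 : 0 < l := by positivity
  -- A crude bound from compactness starts the iteration and does not appear in the result.
  obtain ⟨A₁, hA₁⟩ := (isCompact_diamond r).exists_bound_of_continuousOn (hG.sub hH).continuousOn
  have hA₁0 : 0 ≤ A₁ := (norm_nonneg _).trans (hA₁ z hz)
  have hdiff : ∀ y ∈ diamond r, G y - H y =
      goursatInit (p - q) y + goursatOp (p - q) H y + goursatOp p (G - H) y := by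
    intro y hy
    rw [goursatOp_sub hp hG hH, goursatOp_sub_left hp hq hH]
    have : goursatInit (p - q) y = goursatInit p y - goursatInit q y := by
      unfold goursatInit
      rw [← mul_sub, ← intervalIntegral.integral_sub hp.intervalIntegrable hq.intervalIntegrable]
      rfl
    rw [this]
    linear_combination hGe y hy - hHe y hy
  have hmain := norm_le_of_improvement (s := diamond r) (D := fun z => G z - H z)
    (w := fun z => Real.exp (l * |z.1|)) (B := (1 + A) * ∫ s, ‖p s - q s‖) hA₁0 (by positivity)
    (fun y hy => (hA₁ y hy).trans (le_mul_of_one_le_right hA₁0 (Real.one_le_exp (by positivity))))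
    (fun A' hA' hb y hy => ?_) z hz
  · refine hmain.trans ?_
    have hz' : |z.1| + |z.2| ≤ r := hz
    gcongr
    linarith [abs_nonneg z.2]
  · obtain ⟨u, v⟩ := y
    have e1 : ‖goursatInit (p - q) (u, v)‖ ≤ ∫ s, ‖p s - q s‖ :=
      norm_goursatInit_le (hp.sub hq) _
    have e2 : ‖goursatOp (p - q) H (u, v)‖ ≤
        (∫ s, ‖p s - q s‖) / l * A * Real.exp (l * |u|) :=
      norm_goursatOp_le (hp.sub hq) hl0 hA0 fun α hα β hβ =>
        (hA _ (mem_diamond_of_mem_uIcc hy hα hβ)).trans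
          (le_mul_of_one_le_right hA0 (Real.one_le_exp (by positivity)))
    have e3 : ‖goursatOp p (G - H) (u, v)‖ ≤
        (∫ s, ‖p s‖) / l * A' * Real.exp (l * |u|) :=
      norm_goursatOp_le hp hl0 hA' fun α hα β hβ =>
        hb _ (mem_diamond_of_mem_uIcc hy hα hβ)
    rw [hdiff _ hy]
    refine (norm_add₃_le).trans ?_
    have hE : 1 ≤ Real.exp (l * |u|) := Real.one_le_exp (by positivity)
    have f2 : (∫ s, ‖p s - q s‖) / l ≤ ∫ s, ‖p s - q s‖ :=
      div_le_self hn (by rw [hl]; linarith)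
    have f3 : (∫ s, ‖p s‖) / l ≤ 1 / 2 := by
      rw [div_le_div_iff₀ hl0 two_pos, hl]; linarith
    have g1 : ‖goursatInit (p - q) (u, v)‖ ≤ (∫ s, ‖p s - q s‖) * Real.exp (l * |u|) :=
      e1.trans (le_mul_of_one_le_right hn hE)
    have g2 : ‖goursatOp (p - q) H (u, v)‖ ≤ (∫ s, ‖p s - q s‖) * A * Real.exp (l * |u|) :=
      e2.trans (by gcongr)
    have g3 : ‖goursatOp p (G - H) (u, v)‖ ≤ 1 / 2 * A' * Real.exp (l * |u|) :=
      e3.trans (by gcongr)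
    refine (add_le_add (add_le_add g1 g2) g3).trans_eq ?_
    ring

theorem goursat_unique {q p : ℝ → ℂ} (hp : Integrable p)
    {H G : ℝ × ℝ → ℂ} (hH : Continuous H) (hG : Continuous G) {r : ℝ}
    (hqp : ∀ s ∈ Icc (-r) r, q s = p s)
    (hHe : ∀ z ∈ diamond r, H z = goursatInit q z + goursatOp q H z)
    (hGe : ∀ z ∈ diamond r, G z = goursatInit p z + goursatOp p G z) {z : ℝ × ℝ}
    (hz : z ∈ diamond r) : H z = G z := by
  have hHe' : ∀ z ∈ diamond r, H z = goursatInit p z + goursatOp p H z := by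
    intro y hy
    rw [hHe y hy, goursatInit_congr hqp hy, goursatOp_congr hqp (fun _ _ => rfl) hy]
  obtain ⟨A, hA⟩ := (isCompact_diamond r).exists_bound_of_continuousOn hH.continuousOn
  have hz0 := goursat_stability hp hp hH hG hHe' hGe hA le_rfl hz
  simp only [sub_self, norm_zero, integral_zero, mul_zero, zero_mul] at hz0
  exact (sub_eq_zero.1 (norm_le_zero_iff.1 hz0)).symm

theorem integrable_indicator_Icc {q : ℝ → ℂ} {r : ℝ} (hq : IntegrableOn q (Icc (-r) r)) :
    Integrable ((Icc (-r) r).indicator q) :=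
  (integrable_indicator_iff measurableSet_Icc).2 hq

/-- Existence and uniqueness for the Goursat integral equation, and agreement of its solution on
smaller squares with the solutions for modified potentials. -/
theorem exists_goursatSolution {a : ℝ} {q : ℝ → ℂ}
    (hq : ∀ r, r < a → IntegrableOn q (Icc (-r) r)) :
    ∃ H : ℝ → ℝ → ℂ, IsGoursatSolution a q H ∧
      (∀ H' : ℝ → ℝ → ℂ, IsGoursatSolution a q H' →
        ∀ u v : ℝ, |u| + |v| < a → H' u v = H u v) ∧
      ∀ r, r < a → ∀ p : ℝ → ℂ, Integrable p → (∀ s ∈ Icc (-r) r, p s = q s) →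
        ∀ G : ℝ × ℝ → ℂ, Continuous G → (∀ z, G z = goursatInit p z + goursatOp p G z) →
          ∀ z ∈ diamond r, H z.1 z.2 = G z := by
  have hi : ∀ r, r < a → Integrable ((Icc (-r) r).indicator q) := fun r hr =>
    integrable_indicator_Icc (hq r hr)
  choose! G hGc hGe using fun r hr => exists_global_goursat (hi r hr)
  have hind : ∀ r, ∀ s ∈ Icc (-r) r, (Icc (-r) r).indicator q s = q s := fun r s hs =>
    indicator_of_mem hs q
  have hagree : ∀ r, r < a → ∀ p : ℝ → ℂ, Integrable p → (∀ s ∈ Icc (-r) r, p s = q s) →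
      ∀ F : ℝ × ℝ → ℂ, Continuous F → (∀ z, F z = goursatInit p z + goursatOp p F z) →
        ∀ z ∈ diamond r, G (|z.1| + |z.2|) z = F z := by
    intro r hr p hp hpq F hF hFe z hz
    have hz' : |z.1| + |z.2| ≤ r := hz
    refine goursat_unique (r := |z.1| + |z.2|) hp (hGc _ (hz'.trans_lt hr)) hF (fun s hs => ?_)
      (fun y _ => hGe _ (hz'.trans_lt hr) y) (fun y _ => hFe y) (le_refl (|z.1| + |z.2|))
    rw [hind _ s hs, hpq s ⟨by linarith [hs.1], hs.2.trans hz'⟩]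
  have hGG : ∀ r, r < a → ∀ z ∈ diamond r, G (|z.1| + |z.2|) z = G r z := fun r hr =>
    hagree r hr _ (hi r hr) (hind r) _ (hGc r hr) (hGe r hr)
  -- Each point uses the potential cut off to the smallest diamond that contains the point; by
  -- `hagree` every larger diamond with `r < a` gives the same value.
  refine ⟨fun u v => G (|u| + |v|) (u, v), ⟨?_, ?_⟩, ?_, hagree⟩
  · intro z hz
    obtain ⟨r, hr1, hr2⟩ := exists_between (show |z.1| + |z.2| < a from hz)
    have hev : ∀ᶠ y : ℝ × ℝ in 𝓝 z, |y.1| + |y.2| < r :=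
      (by fun_prop : Continuous fun y : ℝ × ℝ => |y.1| + |y.2|).continuousAt.eventually_lt_const hr1
    refine (((hGc r hr2).continuousAt (x := z)).congr ?_).continuousWithinAt
    filter_upwards [hev] with y hy
    exact (hGG r hr2 y hy.le).symm
  · intro u v huv
    have e := hGe _ huv (u, v)
    have hmem : (u, v) ∈ diamond (|u| + |v|) := le_refl (|u| + |v|)
    rw [goursatInit_congr (hind _) hmem, goursatOp_congr (hind _)
      (g := fun y => G (|y.1| + |y.2|) y) (fun y hy => (hGG _ huv y hy).symm) hmem] at e
    exact e
  · intro H' hH' u v huv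
    set r := |u| + |v| with hr
    have hmem : (u, v) ∈ diamond r := le_refl (|u| + |v|)
    have hsub : diamond r ⊆ {z : ℝ × ℝ | |z.1| + |z.2| < a} := fun y hy => lt_of_le_of_lt hy huv
    -- Tietze extension, because `goursat_unique` compares functions that are continuous on the
    -- whole plane.
    obtain ⟨F, hF⟩ := ContinuousMap.exists_restrict_eq (isCompact_diamond r).isClosed
      ⟨(diamond r).domRestrict fun z : ℝ × ℝ => H' z.1 z.2, (hH'.1.mono hsub).domRestrict⟩
    have hFH : ∀ z ∈ diamond r, F z = H' z.1 z.2 := fun z hz =>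
      congrArg (fun f => f ⟨z, hz⟩) hF
    change H' (u, v).1 (u, v).2 = G r (u, v)
    rw [← hFH _ hmem]
    refine goursat_unique (q := (Icc (-r) r).indicator q) (hi r huv) F.continuous (hGc r huv)
      (fun _ _ => rfl)
      (fun z hz => ?_) (fun y _ => hGe _ huv y) hmem
    rw [hFH z hz, hH'.2 _ _ (hsub hz), goursatInit_congr (hind r) hz,
      goursatOp_congr (hind r) hFH hz]
    rfl

/-! ### The integral part of the transposed operator -/

/-- `ψ` vanishes outside `[-b, b]`. -/
def VanishesOff (b : ℝ) (ψ : ℝ → ℂ) : Prop := ∀ x, x ∉ Icc (-b) b → ψ x = 0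

/-- The integral part of `𝐓□`, for functions that vanish outside `[-b, b]`. -/
def skew (b : ℝ) (M : ℝ × ℝ → ℂ) (ψ : ℝ → ℂ) (x : ℝ) : ℂ :=
  (∫ t in x..b, ψ t * M (t, x)) - ∫ t in (-b)..(-x), ψ t * M (t, x)

section Skew

variable {b : ℝ} {M : ℝ × ℝ → ℂ} {ψ : ℝ → ℂ}

theorem VanishesOff.add {φ : ℝ → ℂ} (h : VanishesOff b ψ) (h' : VanishesOff b φ) :
    VanishesOff b (ψ + φ) := fun x hx => by rw [Pi.add_apply, h x hx, h' x hx, add_zero]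

theorem VanishesOff.sub {φ : ℝ → ℂ} (h : VanishesOff b ψ) (h' : VanishesOff b φ) :
    VanishesOff b (ψ - φ) := fun x hx => by rw [Pi.sub_apply, h x hx, h' x hx, sub_zero]

theorem VanishesOff.mul_left (h : VanishesOff b ψ) (q : ℝ → ℂ) :
    VanishesOff b (q * ψ) := fun x hx => by rw [Pi.mul_apply, h x hx, mul_zero]

theorem intervalIntegrable_mul_kernel (hM : Continuous M) (hψ : Integrable ψ) (x u v : ℝ) :
    IntervalIntegrable (fun t => ψ t * M (t, x)) volume u v :=
  hψ.intervalIntegrable.mul_continuousOn (hM.comp (Continuous.prodMk_left x)).continuousOn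

theorem continuous_skew (hM : Continuous M) (hψ : Integrable ψ) : Continuous (skew b M ψ) :=
  (continuous_intervalIntegral_mul hψ.locallyIntegrable (g := fun x t => M (t, x)) (by fun_prop)
    continuous_id continuous_const).sub
  (continuous_intervalIntegral_mul hψ.locallyIntegrable (g := fun x t => M (t, x)) (by fun_prop)
    continuous_const continuous_neg)

theorem skew_congr_ae {φ : ℝ → ℂ} (h : ψ =ᵐ[volume] φ) (x : ℝ) : skew b M ψ x = skew b M φ x := by
  unfold skew
  congr 1 <;> refine intervalIntegral.integral_congr_ae ?_ <;>
    filter_upwards [h] with t ht _ <;> rw [ht]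

theorem skew_sub {φ : ℝ → ℂ} (hM : Continuous M) (hψ : Integrable ψ) (hφ : Integrable φ) (x : ℝ) :
    skew b M (ψ - φ) x = skew b M ψ x - skew b M φ x := by
  have h1 : ∀ u v, (∫ t in u..v, (ψ - φ) t * M (t, x)) =
      (∫ t in u..v, ψ t * M (t, x)) - ∫ t in u..v, φ t * M (t, x) := by
    intro u v
    rw [← intervalIntegral.integral_sub (intervalIntegrable_mul_kernel hM hψ _ _ _)
      (intervalIntegrable_mul_kernel hM hφ _ _ _)]
    simp only [Pi.sub_apply, sub_mul]
  unfold skew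
  rw [h1, h1]
  ring

theorem skew_add {φ : ℝ → ℂ} (hM : Continuous M) (hψ : Integrable ψ) (hφ : Integrable φ) (x : ℝ) :
    skew b M (ψ + φ) x = skew b M ψ x + skew b M φ x := by
  have := skew_sub (b := b) hM (hψ.add hφ) hφ x
  rw [add_sub_cancel_right] at this
  rw [this, sub_add_cancel]

theorem skew_sub_kernel {L : ℝ × ℝ → ℂ} (hM : Continuous M) (hL : Continuous L)
    (hψ : Integrable ψ) (x : ℝ) :
    skew b (M - L) ψ x = skew b M ψ x - skew b L ψ x := by
  have h1 : ∀ u v, (∫ t in u..v, ψ t * (M - L) (t, x)) =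
      (∫ t in u..v, ψ t * M (t, x)) - ∫ t in u..v, ψ t * L (t, x) := by
    intro u v
    rw [← intervalIntegral.integral_sub (intervalIntegrable_mul_kernel hM hψ _ _ _)
      (intervalIntegrable_mul_kernel hL hψ _ _ _)]
    simp only [Pi.sub_apply, mul_sub]
  unfold skew
  rw [h1, h1]
  ring

/-- For `x < 0` both integrals in `skew` contain the piece from `x` to `-x`, and it cancels. The
form without absolute values can be differentiated; the form with them shows that only `|t| ≥ |x|`
contributes. -/
theorem skew_eq_abs (hM : Continuous M) (hψ : Integrable ψ) (x : ℝ) :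
    skew b M ψ x = (∫ t in |x|..b, ψ t * M (t, x)) - ∫ t in (-b)..(-|x|), ψ t * M (t, x) := by
  have hi := fun u v => intervalIntegrable_mul_kernel hM hψ x u v
  rcases le_total 0 x with h | h
  · rw [abs_of_nonneg h]; rfl
  · rw [abs_of_nonpos h, neg_neg, skew,
      ← intervalIntegral.integral_add_adjacent_intervals (hi x (-x)) (hi (-x) b),
      ← intervalIntegral.integral_add_adjacent_intervals (hi (-b) x) (hi x (-x))]
    ring

/-- For `|x| > b` the integrals run, up to an endpoint, over points outside `[-b, b]`. Hence `𝐓□`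
does not enlarge supports. -/
theorem vanishesOff_skew (hM : Continuous M) (hψ : Integrable ψ) (hs : VanishesOff b ψ) :
    VanishesOff b (skew b M ψ) := by
  intro x hx
  have hx' : b < |x| := by
    by_contra! h
    exact hx (abs_le.1 h)
  rw [skew_eq_abs hM hψ, intervalIntegral.integral_zero_ae, intervalIntegral.integral_zero_ae,
    sub_zero]
  · filter_upwards [Measure.ae_ne volume (-b)] with t ht htm
    rw [uIoc_of_ge (by linarith)] at htm
    rw [hs t fun h => ht (le_antisymm htm.2 h.1), zero_mul]
  · filter_upwards with t htm
    rw [uIoc_of_ge hx'.le] at htm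
    rw [hs t fun h => absurd h.2 (not_le.2 htm.1), zero_mul]

theorem norm_skew_le {A : ℝ} (hψ : Integrable ψ)
    (hA : ∀ t ∈ Icc (-b) b, ∀ x ∈ Icc (-b) b, ‖M (t, x)‖ ≤ A) {x : ℝ} (hx : x ∈ Icc (-b) b) :
    ‖skew b M ψ x‖ ≤ 2 * A * ∫ t, ‖ψ t‖ := by
  have hb : -b ≤ b := hx.1.trans hx.2
  have h1 : ∀ u v, u ∈ Icc (-b) b → v ∈ Icc (-b) b →
      ‖∫ t in u..v, ψ t * M (t, x)‖ ≤ (∫ t, ‖ψ t‖) * A := fun u v hu hv =>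
    norm_integral_mul_le hψ fun t ht => hA t (ordConnected_Icc.uIcc_subset hu hv ht) x hx
  refine (norm_sub_le _ _).trans ((add_le_add (h1 _ _ hx ⟨hb, le_rfl⟩)
    (h1 _ _ ⟨le_rfl, hb⟩ ⟨by linarith [hx.2], by linarith [hx.1]⟩)).trans_eq ?_)
  ring

theorem integral_exp_neg_mul_le {l : ℝ} (hl : 0 < l) (x y : ℝ) :
    ∫ t in x..y, Real.exp (-(l * t)) ≤ Real.exp (-(l * x)) / l := by
  have : ∫ t in x..y, Real.exp (-(l * t)) =
      Real.exp (-(l * x)) / l - Real.exp (-(l * y)) / l := by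
    rw [intervalIntegral.integral_eq_sub_of_hasDerivAt
      (f := fun t => -(Real.exp (-(l * t)) / l))]
    · ring
    · intro t _
      have h1 : HasDerivAt (fun t => -(l * t)) (-l) t := by
        simpa using ((hasDerivAt_id' t).const_mul l).fun_neg
      have h2 : HasDerivAt (fun t => -(Real.exp (-(l * t)) / l))
          (-(Real.exp (-(l * t)) * -l / l)) t := (h1.exp.div_const l).fun_neg
      rwa [show -(Real.exp (-(l * t)) * -l / l) = Real.exp (-(l * t)) by field_simp] at h2
    · apply Continuous.intervalIntegrable; fun_prop
  rw [this]
  linarith [div_nonneg (Real.exp_pos (-(l * y))).le hl.le]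

/-- The integrals run outwards from `|x|`, so integrating a weight that decays in `|t|` gains `1 /
l` on each of the two sides. -/
theorem norm_skew_le_exp {A B l : ℝ} (hl : 0 < l) (hM : Continuous M) (hψ : Integrable ψ)
    (hA : ∀ t ∈ Icc (-b) b, ∀ x ∈ Icc (-b) b, ‖M (t, x)‖ ≤ A)
    (hB : ∀ t ∈ Icc (-b) b, ‖ψ t‖ ≤ B * Real.exp (-(l * |t|))) {x : ℝ} (hx : x ∈ Icc (-b) b) :
    ‖skew b M ψ x‖ ≤ 2 * A / l * B * Real.exp (-(l * |x|)) := by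
  have hxb : |x| ≤ b := abs_le.2 hx
  have hA0 : 0 ≤ A := (norm_nonneg _).trans (hA x hx x hx)
  have hB0 : 0 ≤ B := nonneg_of_mul_nonneg_left ((norm_nonneg _).trans (hB x hx)) (Real.exp_pos _)
  have hpt : ∀ t ∈ Icc (-b) b, ‖ψ t * M (t, x)‖ ≤ A * B * Real.exp (-(l * |t|)) := by
    intro t ht
    rw [norm_mul]
    refine (mul_le_mul (hB t ht) (hA t ht x hx) (norm_nonneg _)
      (mul_nonneg hB0 (Real.exp_pos _).le)).trans_eq ?_
    ring
  have hint : ∀ u v, IntervalIntegrable (fun t => A * B * Real.exp (-(l * |t|))) volume u v := by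
    intro u v; apply Continuous.intervalIntegrable; fun_prop
  have e1 : ∫ t in |x|..b, A * B * Real.exp (-(l * |t|)) ≤
      A * B * (Real.exp (-(l * |x|)) / l) := by
    rw [intervalIntegral.integral_const_mul]
    refine mul_le_mul_of_nonneg_left ((intervalIntegral.integral_congr fun t ht => ?_).trans_le
      (integral_exp_neg_mul_le hl |x| b)) (mul_nonneg hA0 hB0)
    rw [uIcc_of_le hxb] at ht
    simp only [abs_of_nonneg ((abs_nonneg x).trans ht.1)]
  have e2 : ∫ t in (-b)..(-|x|), A * B * Real.exp (-(l * |t|)) =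
      ∫ t in |x|..b, A * B * Real.exp (-(l * |t|)) := by
    rw [← intervalIntegral.integral_comp_neg]
    simp only [abs_neg]
  have f1 : ‖∫ t in |x|..b, ψ t * M (t, x)‖ ≤ ∫ t in |x|..b, A * B * Real.exp (-(l * |t|)) :=
    intervalIntegral.norm_integral_le_of_norm_le hxb
      (Filter.Eventually.of_forall fun t ht =>
        hpt t ⟨by linarith [ht.1, abs_nonneg x], ht.2⟩) (hint _ _)
  have f2 : ‖∫ t in (-b)..(-|x|), ψ t * M (t, x)‖ ≤
      ∫ t in (-b)..(-|x|), A * B * Real.exp (-(l * |t|)) :=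
    intervalIntegral.norm_integral_le_of_norm_le (by linarith)
      (Filter.Eventually.of_forall fun t ht =>
        hpt t ⟨ht.1.le, by linarith [ht.2, abs_nonneg x]⟩) (hint _ _)
  rw [skew_eq_abs hM hψ]
  rw [e2] at f2
  refine (norm_sub_le _ _).trans ((add_le_add (f1.trans e1) (f2.trans e1)).trans_eq ?_)
  ring

/-- The constant in the bounds for solutions of `ψ + skew b M ψ = f`. -/
def volterraConst (b A : ℝ) : ℝ := 2 * Real.exp ((4 * A + 1) * b)

theorem norm_le_of_add_skew {A ε : ℝ} {g : ℝ → ℂ} (hM : Continuous M) (hψ : Integrable ψ)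
    (hA : ∀ t ∈ Icc (-b) b, ∀ x ∈ Icc (-b) b, ‖M (t, x)‖ ≤ A)
    (hg : ∀ x ∈ Icc (-b) b, ‖g x‖ ≤ ε)
    (h : ∀ x ∈ Icc (-b) b, ψ x + skew b M ψ x = g x) {x : ℝ} (hx : x ∈ Icc (-b) b) :
    ‖ψ x‖ ≤ volterraConst b A * ε := by
  have hb : 0 ≤ b := by linarith [hx.1, hx.2]
  have hA0 : 0 ≤ A := (norm_nonneg _).trans (hA x hx x hx)
  have hε : 0 ≤ ε := (norm_nonneg _).trans (hg x hx)
  -- Chosen so that `2 * A / l ≤ 1 / 2`.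
  set l : ℝ := 4 * A + 1 with hl
  have hl0 : 0 < l := by positivity
  have hψe : ∀ y ∈ Icc (-b) b, ψ y = g y - skew b M ψ y := fun y hy =>
    eq_sub_of_add_eq (h y hy)
  have hE : ∀ y ∈ Icc (-b) b, 1 ≤ Real.exp (l * b) * Real.exp (-(l * |y|)) := by
    intro y hy
    rw [← Real.exp_add]
    refine Real.one_le_exp ?_
    have : l * |y| ≤ l * b := mul_le_mul_of_nonneg_left (abs_le.2 hy) hl0.le
    linarith
  have hn : 0 ≤ ∫ t, ‖ψ t‖ := integral_nonneg fun s => norm_nonneg _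
  -- `ψ` is only integrable, but the equation itself bounds it on `[-b, b]` by `ε + 2 * A * ∫ ‖ψ‖`.
  -- This starting bound drops out of the final constant.
  have h1 := norm_le_of_improvement (s := Icc (-b) b) (D := ψ)
    (w := fun x => Real.exp (-(l * |x|))) (A := (ε + 2 * A * ∫ t, ‖ψ t‖) * Real.exp (l * b))
    (B := ε * Real.exp (l * b)) (by positivity) (by positivity) (fun y hy => ?_)
    (fun A' hA' hb' y hy => ?_) x hx
  · refine h1.trans ?_
    rw [volterraConst, ← hl]
    have : Real.exp (-(l * |x|)) ≤ 1 := Real.exp_le_one_iff.2 (by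
      have := mul_nonneg hl0.le (abs_nonneg x)
      linarith)
    calc 2 * (ε * Real.exp (l * b)) * Real.exp (-(l * |x|))
        ≤ 2 * (ε * Real.exp (l * b)) * 1 := by gcongr
      _ = _ := by ring
  · rw [hψe y hy, mul_assoc]
    exact ((norm_sub_le _ _).trans (add_le_add (hg y hy) (norm_skew_le hψ hA hy))).trans
      (le_mul_of_one_le_right (by positivity) (hE y hy))
  · have e1 := norm_skew_le_exp hl0 hM hψ hA hb' hy
    have e2 : 2 * A / l ≤ 1 / 2 := by
      rw [div_le_div_iff₀ hl0 two_pos, hl]; linarith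
    have e3 : ‖g y‖ ≤ ε * Real.exp (l * b) * Real.exp (-(l * |y|)) := by
      rw [mul_assoc]
      exact (hg y hy).trans (le_mul_of_one_le_right hε (hE y hy))
    rw [hψe y hy]
    have e4 : ‖skew b M ψ y‖ ≤ 1 / 2 * A' * Real.exp (-(l * |y|)) := e1.trans (by gcongr)
    refine (norm_sub_le _ _).trans ((add_le_add e3 e4).trans_eq ?_)
    ring

/-- The function `f` need not be continuous, so the iteration solves for the correction `h = -S f -
S h`, which is. To run on all continuous functions it applies `S` after cutting off to `[-b, b]`;
the solution turns out to vanish there anyway. -/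
theorem exists_add_skew_eq {A : ℝ} {f : ℝ → ℂ} (hb : 0 ≤ b) (hM : Continuous M)
    (hA : ∀ t ∈ Icc (-b) b, ∀ x ∈ Icc (-b) b, ‖M (t, x)‖ ≤ A)
    (hf : Integrable f) (hfs : VanishesOff b f) :
    ∃ h : ℝ → ℂ, Continuous h ∧ VanishesOff b h ∧
      (∀ x, ‖h x‖ ≤ volterraConst b A * (2 * A * ∫ t, ‖f t‖)) ∧
      ∀ x, (f + h) x + skew b M (f + h) x = f x := by
  have h0 : (0 : ℝ) ∈ Icc (-b) b := ⟨by linarith, hb⟩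
  have hA0 : 0 ≤ A := (norm_nonneg _).trans (hA 0 h0 0 h0)
  set l : ℝ := 4 * A + 1 with hl
  have hl0 : 0 < l := by positivity
  have hind : ∀ h : ℝ → ℂ, Continuous h → Integrable ((Icc (-b) b).indicator h) := fun h hh =>
    integrable_indicator_Icc hh.integrableOn_Icc
  have hindv : ∀ h : ℝ → ℂ, VanishesOff b ((Icc (-b) b).indicator h) := fun h x hx =>
    indicator_of_notMem hx h
  have hn : 0 ≤ ∫ t, ‖f t‖ := integral_nonneg fun s => norm_nonneg _
  have hE : ∀ y ∈ Icc (-b) b, 1 ≤ Real.exp (l * b) * Real.exp (-(l * |y|)) := by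
    intro y hy
    rw [← Real.exp_add]
    refine Real.one_le_exp ?_
    have : l * |y| ≤ l * b := mul_le_mul_of_nonneg_left (abs_le.2 hy) hl0.le
    linarith
  have hhalf : ∀ h : ℝ → ℂ, Continuous h → ∀ B : ℝ, 0 ≤ B →
      (∀ x, ‖h x‖ ≤ B * Real.exp (-(l * |x|))) →
      ∀ x, ‖-skew b M ((Icc (-b) b).indicator h) x‖ ≤ B / 2 * Real.exp (-(l * |x|)) := by
    intro h hh B hB hhB x
    rw [norm_neg]
    by_cases hx : x ∈ Icc (-b) b
    · refine (norm_skew_le_exp (B := B) hl0 hM (hind h hh) hA (fun t ht => ?_) hx).trans ?_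
      · rw [indicator_of_mem ht]; exact hhB t
      · gcongr
        rw [div_mul_eq_mul_div, div_le_div_iff₀ hl0 two_pos, hl]
        nlinarith
    · rw [vanishesOff_skew hM (hind h hh) (hindv h) x hx, norm_zero]
      positivity
  have hfb : ∀ x, ‖-skew b M f x‖ ≤
      (2 * A * (∫ t, ‖f t‖) * Real.exp (l * b)) * Real.exp (-(l * |x|)) := by
    intro x
    rw [norm_neg]
    by_cases hx : x ∈ Icc (-b) b
    · rw [mul_assoc _ (Real.exp _)]
      exact (norm_skew_le hf hA hx).trans (le_mul_of_one_le_right (by positivity) (hE x hx))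
    · rw [vanishesOff_skew hM hf hfs x hx, norm_zero]
      positivity
  obtain ⟨h, h1, -, h3⟩ := exists_eq_add_of_halving
    (fun h x => -skew b M ((Icc (-b) b).indicator h) x)
    (w := fun x => Real.exp (-(l * |x|))) (by fun_prop) (fun _ => Real.exp_pos _)
    (fun h hh => (continuous_skew hM (hind h hh)).neg)
    (fun h g hh hg x => by
      have : (Icc (-b) b).indicator (h - g) =
        (Icc (-b) b).indicator h - (Icc (-b) b).indicator g := indicator_sub' _ _ _
      simp only [this, skew_sub hM (hind h hh) (hind g hg)]
      ring) hhalf (f := fun x => -skew b M f x) (continuous_skew hM hf).neg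
    (B := 2 * A * (∫ t, ‖f t‖) * Real.exp (l * b)) (by positivity) hfb
  have hv : VanishesOff b h := by
    intro x hx
    rw [h3, vanishesOff_skew hM hf hfs x hx, vanishesOff_skew hM (hind h h1) (hindv h) x hx]
    simp
  have hhi : (Icc (-b) b).indicator h = h :=
    indicator_eq_self.2 fun x hx => by_contra fun hn => hx (hv x hn)
  have hint : Integrable h := hhi ▸ hind h h1
  rw [hhi] at h3
  refine ⟨h, h1, hv, fun x => ?_, fun x => ?_⟩
  · by_cases hx : x ∈ Icc (-b) b
    · refine norm_le_of_add_skew hM hint hA (g := fun x => -skew b M f x) (fun y hy => ?_)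
        (fun y _ => ?_) hx
      · rw [norm_neg]; exact norm_skew_le hf hA hy
      · rw [h3 y]; ring
    · rw [hv x hx, norm_zero, volterraConst]; positivity
  · rw [skew_add hM hf hint, Pi.add_apply, h3 x]; ring

end Skew

/-! ### Differentiation of parametric integrals -/

/-- Induction with `F` generalised: the derivative in the parameter is an integral of the same kind
with values in `E →L[ℝ] F`. -/
theorem contDiff_parametric_integral {E F : Type} [NormedAddCommGroup E] [NormedSpace ℝ E]
    [LocallyCompactSpace E] [NormedAddCommGroup F] [NormedSpace ℝ F] [CompleteSpace F] (n : ℕ)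
    {g : E × ℝ → F} (hg : ContDiff ℝ n g) (u v : ℝ) :
    ContDiff ℝ n fun e => ∫ t in u..v, g (e, t) := by
  induction n generalizing F with
  | zero =>
    rw [Nat.cast_zero, contDiff_zero] at hg ⊢
    exact intervalIntegral.continuous_parametric_intervalIntegral_of_continuous'
      (f := fun e t => g (e, t)) hg u v
  | succ n ih =>
    rw [Nat.cast_succ] at hg ⊢
    obtain ⟨g', hg', hd⟩ := contDiff_succ_iff_hasFDerivAt.1 hg
    set k : E × ℝ → E →L[ℝ] F := fun p => (g' p).comp (ContinuousLinearMap.inl ℝ E ℝ) with hk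
    have hkc : ContDiff ℝ n k := hg'.clm_comp contDiff_const
    refine contDiff_succ_iff_hasFDerivAt.2 ⟨_, ih hkc, fun e => ?_⟩
    obtain ⟨K, hK, hKe⟩ := exists_compact_mem_nhds e
    obtain ⟨A, hA⟩ := (hK.prod (isCompact_uIcc (a := u) (b := v))).exists_bound_of_continuousOn
      hkc.continuous.continuousOn
    refine intervalIntegral.hasFDerivAt_integral_of_dominated_of_fderiv_le (s := K)
      (F' := fun e t => k (e, t)) (bound := fun _ => A) hKe ?_ ?_ ?_ ?_ ?_ ?_
    · exact Filter.Eventually.of_forall fun x =>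
        (hg.continuous.comp (Continuous.prodMk_right x)).aestronglyMeasurable
    · exact (hg.continuous.comp (Continuous.prodMk_right e)).intervalIntegrable _ _
    · exact (hkc.continuous.comp (Continuous.prodMk_right e)).aestronglyMeasurable
    · exact Filter.Eventually.of_forall fun t ht x hx => hA (x, t) ⟨hx, uIoc_subset_uIcc ht⟩
    · exact intervalIntegrable_const
    · exact Filter.Eventually.of_forall fun t _ x _ =>
        (hd (x, t)).comp x (hasFDerivAt_prodMk_left x t)

theorem contDiff_primitive_fst {n : ℕ} {g : ℝ × ℝ → ℂ} (hg : ContDiff ℝ n g) :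
    ContDiff ℝ n fun z : ℝ × ℝ => ∫ t in (0 : ℝ)..z.1, g (t, z.2) := by
  -- Rescaling to `[0, 1]` turns the variable endpoint into a parameter of the integrand.
  have e : (fun z : ℝ × ℝ => ∫ t in (0 : ℝ)..z.1, g (t, z.2)) = fun z : ℝ × ℝ =>
      z.1 • ∫ t in (0 : ℝ)..1, g (z.1 * t, z.2) := by
    funext z
    rw [intervalIntegral.smul_integral_comp_mul_left (fun t => g (t, z.2)), mul_zero, mul_one]
  rw [e]
  refine contDiff_fst.smul (contDiff_parametric_integral n
    (g := fun p : (ℝ × ℝ) × ℝ => g (p.1.1 * p.2, p.1.2)) ?_ 0 1)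
  exact hg.comp (by fun_prop)

theorem contDiff_primitive_snd {n : ℕ} {g : ℝ × ℝ → ℂ} (hg : ContDiff ℝ n g) :
    ContDiff ℝ n fun z : ℝ × ℝ => ∫ t in (0 : ℝ)..z.2, g (z.1, t) :=
  (contDiff_primitive_fst (g := fun p : ℝ × ℝ => g (p.2, p.1))
    (hg.comp (by fun_prop))).comp (f := fun z : ℝ × ℝ => (z.2, z.1)) (by fun_prop)

/-- The linear map with matrix `(c, d)`. -/
def partialMap (c d : ℂ) : ℝ × ℝ →L[ℝ] ℂ :=
  (ContinuousLinearMap.fst ℝ ℝ ℝ).smulRight c + (ContinuousLinearMap.snd ℝ ℝ ℝ).smulRight d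

theorem partialMap_apply (c d : ℂ) (z : ℝ × ℝ) : partialMap c d z = z.1 * c + z.2 * d := by
  simp [partialMap]

theorem contDiff_partialMap {n : ℕ} {c d : ℝ × ℝ → ℂ} (hc : ContDiff ℝ n c)
    (hd : ContDiff ℝ n d) : ContDiff ℝ n fun z => partialMap (c z) (d z) :=
  (contDiff_const.smulRight hc).add (contDiff_const.smulRight hd)

theorem hasDerivAt_parametric_integral {g g₂ : ℝ × ℝ → ℂ} (hg : Continuous g)
    (hg₂ : Continuous g₂) (hd : ∀ t y, HasDerivAt (fun y => g (t, y)) (g₂ (t, y)) y)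
    (u v y : ℝ) :
    HasDerivAt (fun y => ∫ t in u..v, g (t, y)) (∫ t in u..v, g₂ (t, y)) y := by
  obtain ⟨K, hK, hKe⟩ := exists_compact_mem_nhds y
  obtain ⟨A, hA⟩ := ((isCompact_uIcc (a := u) (b := v)).prod hK).exists_bound_of_continuousOn
    hg₂.continuousOn
  refine (intervalIntegral.hasDerivAt_integral_of_dominated_loc_of_deriv_le (s := K)
    (F := fun y t => g (t, y)) (F' := fun y t => g₂ (t, y)) (bound := fun _ => A)
    hKe ?_ ?_ ?_ ?_ ?_ ?_).2
  · exact Filter.Eventually.of_forall fun x =>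
      (hg.comp (Continuous.prodMk_left x)).aestronglyMeasurable
  · exact (hg.comp (Continuous.prodMk_left y)).intervalIntegrable _ _
  · exact (hg₂.comp (Continuous.prodMk_left y)).aestronglyMeasurable
  · exact Filter.Eventually.of_forall fun t ht x hx => hA (t, x) ⟨uIoc_subset_uIcc ht, hx⟩
  · exact intervalIntegrable_const
  · exact Filter.Eventually.of_forall fun t _ x _ => hd t x

/-- Both partial derivatives exist and are jointly continuous. -/
theorem hasFDerivAt_primitive_fst {g g₂ : ℝ × ℝ → ℂ} (hg : Continuous g)
    (hg₂ : Continuous g₂) (hd : ∀ t y, HasDerivAt (fun y => g (t, y)) (g₂ (t, y)) y) (c : ℝ)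
    (z : ℝ × ℝ) :
    HasFDerivAt (fun z : ℝ × ℝ => ∫ t in c..z.1, g (t, z.2))
      (partialMap (g z) (∫ t in c..z.1, g₂ (t, z.2))) z := by
  have hc : Continuous fun z : ℝ × ℝ => ∫ t in c..z.1, g₂ (t, z.2) :=
    intervalIntegral.continuous_parametric_intervalIntegral_of_continuous
      (f := fun (z : ℝ × ℝ) t => g₂ (t, z.2)) (by fun_prop) continuous_fst
  have h := hasStrictFDerivAt_uncurry_coprod (𝕜 := ℝ) (u := z)
    (f := fun x y => ∫ t in c..x, g (t, y))
    (f₁ := fun x y => ContinuousLinearMap.toSpanSingleton ℝ (g (x, y)))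
    (f₂ := fun x y => ContinuousLinearMap.toSpanSingleton ℝ (∫ t in c..x, g₂ (t, y)))
    (Filter.Eventually.of_forall fun v => ?_) (Filter.Eventually.of_forall fun v => ?_) ?_ ?_
  · refine h.hasFDerivAt.congr_fderiv ?_
    ext <;> simp [partialMap_apply, Function.HasUncurry.uncurry]
  · exact (intervalIntegral.integral_hasDerivAt_right
      ((hg.comp (Continuous.prodMk_left v.2)).intervalIntegrable _ _)
      ((hg.comp (Continuous.prodMk_left v.2)).stronglyMeasurableAtFilter _ _)
      (hg.comp (Continuous.prodMk_left v.2)).continuousAt).hasFDerivAt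
  · exact (hasDerivAt_parametric_integral hg hg₂ hd c v.1 v.2).hasFDerivAt
  · exact ((ContinuousLinearMap.toSpanSingletonCLE (𝕜 := ℝ) (E := ℂ)).continuous.comp
      hg).continuousAt
  · exact ((ContinuousLinearMap.toSpanSingletonCLE (𝕜 := ℝ) (E := ℂ)).continuous.comp
      hc).continuousAt

theorem hasFDerivAt_primitive_snd {g g₁ : ℝ × ℝ → ℂ} (hg : Continuous g)
    (hg₁ : Continuous g₁) (hd : ∀ x t, HasDerivAt (fun x => g (x, t)) (g₁ (x, t)) x) (c : ℝ)
    (z : ℝ × ℝ) :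
    HasFDerivAt (fun z : ℝ × ℝ => ∫ t in c..z.2, g (z.1, t))
      (partialMap (∫ t in c..z.2, g₁ (z.1, t)) (g z)) z := by
  have h := hasFDerivAt_primitive_fst (g := fun p => g (p.2, p.1)) (g₂ := fun p => g₁ (p.2, p.1))
    (by fun_prop) (by fun_prop) (fun t y => hd y t) c (z.2, z.1)
  have h2 : HasFDerivAt (fun z : ℝ × ℝ => (z.2, z.1))
    ((ContinuousLinearMap.snd ℝ ℝ ℝ).prod (ContinuousLinearMap.fst ℝ ℝ ℝ)) z :=
    hasFDerivAt_snd.prodMk hasFDerivAt_fst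
  refine (h.comp z h2).congr_fderiv ?_
  ext <;> simp [partialMap_apply]

/-! ### Regularity of the solution of the Goursat problem -/

section GoursatRegularity

variable {q : ℝ → ℂ} {H : ℝ × ℝ → ℂ}

/-- `∂H/∂u` for the solution of the Goursat problem. -/
def goursatDerivU (q : ℝ → ℂ) (H : ℝ × ℝ → ℂ) (z : ℝ × ℝ) : ℂ :=
  (1 / 2) * q z.1 + ∫ β in (0 : ℝ)..z.2, q (z.1 + β) * H (z.1, β)

/-- `∂H/∂v` for the solution of the Goursat problem. -/
def goursatDerivV (q : ℝ → ℂ) (H : ℝ × ℝ → ℂ) (z : ℝ × ℝ) : ℂ :=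
  ∫ α in (0 : ℝ)..z.1, q (α + z.2) * H (α, z.2)

theorem hasFDerivAt_goursat (hq : Continuous q) (hH : Continuous H)
    (hHe : ∀ z, H z = goursatInit q z + goursatOp q H z) (z : ℝ × ℝ) :
    HasFDerivAt H (partialMap (goursatDerivU q H z) (goursatDerivV q H z)) z := by
  have hr : Continuous fun p : ℝ × ℝ => q (p.1 + p.2) * H (p.1, p.2) := by fun_prop
  have h1 : ∀ α y, HasDerivAt (fun y => ∫ β in (0 : ℝ)..y, q (α + β) * H (α, β))
      (q (α + y) * H (α, y)) y := fun α y =>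
    intervalIntegral.integral_hasDerivAt_right
      ((hr.comp (Continuous.prodMk_right α)).intervalIntegrable _ _)
      ((hr.comp (Continuous.prodMk_right α)).stronglyMeasurableAtFilter _ _)
      (hr.comp (Continuous.prodMk_right α)).continuousAt
  have h2 : HasFDerivAt (goursatOp q H) _ z :=
    hasFDerivAt_primitive_fst
      (g := fun p => ∫ β in (0 : ℝ)..p.2, q (p.1 + β) * H (p.1, β))
      (intervalIntegral.continuous_parametric_intervalIntegral_of_continuous
        (f := fun (p : ℝ × ℝ) β => q (p.1 + β) * H (p.1, β)) (by fun_prop) continuous_snd)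
      hr h1 0 z
  have h3 : HasFDerivAt (goursatInit q) (partialMap ((1 / 2) * q z.1) 0) z := by
    have := ((intervalIntegral.integral_hasDerivAt_right (hq.intervalIntegrable 0 z.1)
      (hq.stronglyMeasurableAtFilter _ _) hq.continuousAt).const_mul (1 / 2 : ℂ)).hasFDerivAt.comp z
      (hasFDerivAt_fst (𝕜 := ℝ) (E := ℝ) (F := ℝ) (p := z))
    refine this.congr_fderiv ?_
    ext <;> simp [partialMap_apply]
  have e : H = goursatInit q + goursatOp q H := funext hHe
  have h4 := h3.add h2
  rw [← e] at h4
  refine h4.congr_fderiv ?_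
  ext <;> simp [partialMap_apply, goursatDerivU, goursatDerivV]

/-- Bootstrap: the first derivatives of `H` consist of `q` and primitives of `q (α + β) * H (α, β)`,
so they are of class `C^m` as soon as `q` and `H` are. -/
theorem contDiff_goursat {n : ℕ} (hq : ContDiff ℝ n q) (hH : Continuous H)
    (hHe : ∀ z, H z = goursatInit q z + goursatOp q H z) : ContDiff ℝ n H := by
  have key : ∀ m : ℕ, m ≤ n → ContDiff ℝ m H := by
    intro m
    induction m with
    | zero => intro _; exact contDiff_zero.2 hH
    | succ m ih =>
      intro hm
      have hHm : ContDiff ℝ m H := ih (by omega)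
      have hqm : ContDiff ℝ m q := hq.of_le (by exact_mod_cast (by omega : m ≤ n))
      have hr : ContDiff ℝ m fun p : ℝ × ℝ => q (p.1 + p.2) * H (p.1, p.2) :=
        (hqm.comp (by fun_prop)).mul (hHm.comp (by fun_prop))
      rw [Nat.cast_succ]
      refine contDiff_succ_iff_hasFDerivAt.2 ⟨_, contDiff_partialMap ?_ ?_,
        hasFDerivAt_goursat hq.continuous hH hHe⟩
      · exact (contDiff_const.mul (hqm.comp contDiff_fst)).add (contDiff_primitive_snd hr)
      · exact contDiff_primitive_fst hr
  exact key n le_rfl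

/-- Kernels `M(t, x)` on the plane with continuous derivatives up to second order in each variable
that solve the wave equation `M_tt - M_xx = q(t) M` with the data of the transmutation kernel on
the diagonals. -/
structure IsWaveKernel (q : ℝ → ℂ) (M M₁ M₂ M₁₁ M₂₂ : ℝ × ℝ → ℂ) : Prop where
  cont : Continuous M
  cont₁ : Continuous M₁
  cont₂ : Continuous M₂
  cont₁₁ : Continuous M₁₁
  cont₂₂ : Continuous M₂₂
  deriv₁ : ∀ t x, HasDerivAt (fun t => M (t, x)) (M₁ (t, x)) t
  deriv₂ : ∀ t x, HasDerivAt (fun x => M (t, x)) (M₂ (t, x)) x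
  deriv₁₁ : ∀ t x, HasDerivAt (fun t => M₁ (t, x)) (M₁₁ (t, x)) t
  deriv₂₂ : ∀ t x, HasDerivAt (fun x => M₂ (t, x)) (M₂₂ (t, x)) x
  wave : ∀ t x, M₂₂ (t, x) = M₁₁ (t, x) - q t * M (t, x)
  diag : ∀ x, M₁ (x, x) + M₂ (x, x) = (1 / 2) * q x
  antidiag : ∀ x, M (-x, x) = 0
  antidiag' : ∀ x, M₁ (-x, x) = M₂ (-x, x)
  derivDiag : ∀ x, HasDerivAt (fun x => M (x, x)) ((1 / 2) * q x) x

/-- The kernel `K(t, x) = H((t + x) / 2, (t - x) / 2)` as a function on the plane. -/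
def planeKernel (H : ℝ × ℝ → ℂ) (p : ℝ × ℝ) : ℂ := H ((p.1 + p.2) / 2, (p.1 - p.2) / 2)

theorem continuous_planeKernel (hH : Continuous H) : Continuous (planeKernel H) :=
  hH.comp (by fun_prop)

theorem hasDerivAt_planeKernel_fst {c d : ℂ} {t x : ℝ}
    (h : HasFDerivAt H (partialMap c d) ((t + x) / 2, (t - x) / 2)) :
    HasDerivAt (fun t => planeKernel H (t, x)) ((1 / 2) * (c + d)) t := by
  have h1 : HasDerivAt (fun t : ℝ => ((t + x) / 2, (t - x) / 2)) ((1 / 2 : ℝ), (1 / 2 : ℝ)) t :=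
    (((hasDerivAt_id' t).add_const x).div_const 2).prodMk
      (((hasDerivAt_id' t).sub_const x).div_const 2)
  refine (h.comp_hasDerivAt t h1).congr_deriv ?_
  rw [partialMap_apply]; push_cast; ring

theorem hasDerivAt_planeKernel_snd {c d : ℂ} {t x : ℝ}
    (h : HasFDerivAt H (partialMap c d) ((t + x) / 2, (t - x) / 2)) :
    HasDerivAt (fun x => planeKernel H (t, x)) ((1 / 2) * (c - d)) x := by
  have h1 : HasDerivAt (fun x : ℝ => ((t + x) / 2, (t - x) / 2)) ((1 / 2 : ℝ), (-1 / 2 : ℝ)) x :=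
    (((hasDerivAt_id' x).const_add t).div_const 2).prodMk
      (((hasDerivAt_id' x).const_sub t).div_const 2)
  refine (h.comp_hasDerivAt x h1).congr_deriv ?_
  rw [partialMap_apply]; push_cast; ring

/-- The mixed derivative `H_uv = q(u + v) H` is explicit. Of the pure derivative `P = H_uu` only
continuity is needed, since it cancels in the wave equation. -/
theorem hasFDerivAt_goursatDerivU (hq : ContDiff ℝ 1 q) (hH : Continuous H)
    (hHe : ∀ z, H z = goursatInit q z + goursatOp q H z) :
    ∃ P : ℝ × ℝ → ℂ, Continuous P ∧ ∀ z, HasFDerivAt (goursatDerivU q H)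
      (partialMap (P z) (q (z.1 + z.2) * H z)) z := by
  have hq' : Continuous (deriv q) := hq.continuous_deriv le_rfl
  have hH1 : ContDiff ℝ 1 H := contDiff_goursat (n := 1) hq hH hHe
  have hU : Continuous (goursatDerivU q H) := by
    have : ContDiff ℝ (0 : ℕ) fun p : ℝ × ℝ => q (p.1 + p.2) * H (p.1, p.2) :=
      contDiff_zero.2 ((hq.continuous.comp (by fun_prop)).mul (hH.comp (by fun_prop)))
    exact (continuous_const.mul (hq.continuous.comp continuous_fst)).add
      (contDiff_primitive_snd this).continuous
  have hqc := hq.continuous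
  have hd : ∀ x t, HasDerivAt (fun x => q (x + t) * H (x, t))
      (deriv q (x + t) * H (x, t) + q (x + t) * goursatDerivU q H (x, t)) x := by
    intro x t
    have h1 : HasDerivAt (fun x => q (x + t)) (deriv q (x + t)) x :=
      ((hq.differentiable one_ne_zero).differentiableAt.hasDerivAt).comp_add_const x t
    have h2 : HasDerivAt (fun x => H (x, t)) (goursatDerivU q H (x, t)) x := by
      refine ((hasFDerivAt_goursat hqc hH hHe (x, t)).comp_hasDerivAt x
        ((hasDerivAt_id' x).prodMk (hasDerivAt_const x t))).congr_deriv ?_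
      simp [partialMap_apply]
    exact h1.mul h2
  have h3 := hasFDerivAt_primitive_snd (g := fun p => q (p.1 + p.2) * H p)
    (g₁ := fun p => deriv q (p.1 + p.2) * H p + q (p.1 + p.2) * goursatDerivU q H p)
    (by fun_prop) (by fun_prop) hd 0
  have h4 : ∀ z : ℝ × ℝ, HasFDerivAt (fun z : ℝ × ℝ => (1 / 2) * q z.1)
      (partialMap ((1 / 2) * deriv q z.1) 0) z := by
    intro z
    have := (((hq.differentiable one_ne_zero).differentiableAt (x := z.1)).hasDerivAt.const_mul
      (1 / 2 : ℂ)).hasFDerivAt.comp z (hasFDerivAt_fst (𝕜 := ℝ) (E := ℝ) (F := ℝ) (p := z))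
    refine this.congr_fderiv ?_
    ext <;> simp [partialMap_apply]
  refine ⟨fun z => (1 / 2) * deriv q z.1 + ∫ t in (0 : ℝ)..z.2,
    (deriv q (z.1 + t) * H (z.1, t) + q (z.1 + t) * goursatDerivU q H (z.1, t)), ?_, fun z => ?_⟩
  · exact (by fun_prop : Continuous fun z : ℝ × ℝ => (1 / 2 : ℂ) * deriv q z.1).add
      (intervalIntegral.continuous_parametric_intervalIntegral_of_continuous
        (f := fun (z : ℝ × ℝ) t => deriv q (z.1 + t) * H (z.1, t) +
          q (z.1 + t) * goursatDerivU q H (z.1, t)) (by fun_prop) continuous_snd)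
  · refine ((h4 z).add (h3 z)).congr_fderiv ?_
    ext <;> simp [partialMap_apply]

theorem hasFDerivAt_goursatDerivV (hq : ContDiff ℝ 1 q) (hH : Continuous H)
    (hHe : ∀ z, H z = goursatInit q z + goursatOp q H z) :
    ∃ R : ℝ × ℝ → ℂ, Continuous R ∧ ∀ z, HasFDerivAt (goursatDerivV q H)
      (partialMap (q (z.1 + z.2) * H z) (R z)) z := by
  have hq' : Continuous (deriv q) := hq.continuous_deriv le_rfl
  have hH1 : ContDiff ℝ 1 H := contDiff_goursat (n := 1) hq hH hHe
  have hqc := hq.continuous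
  have hV : Continuous (goursatDerivV q H) := by
    have : ContDiff ℝ (0 : ℕ) fun p : ℝ × ℝ => q (p.1 + p.2) * H (p.1, p.2) :=
      contDiff_zero.2 ((hq.continuous.comp (by fun_prop)).mul (hH.comp (by fun_prop)))
    exact (contDiff_primitive_fst this).continuous
  have hd : ∀ t y, HasDerivAt (fun y => q (t + y) * H (t, y))
      (deriv q (t + y) * H (t, y) + q (t + y) * goursatDerivV q H (t, y)) y := by
    intro t y
    have h1 : HasDerivAt (fun y => q (t + y)) (deriv q (t + y)) y :=
      ((hq.differentiable one_ne_zero).differentiableAt.hasDerivAt).comp_const_add t y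
    have h2 : HasDerivAt (fun y => H (t, y)) (goursatDerivV q H (t, y)) y := by
      refine ((hasFDerivAt_goursat hqc hH hHe (t, y)).comp_hasDerivAt y
        ((hasDerivAt_const y t).prodMk (hasDerivAt_id' y))).congr_deriv ?_
      simp [partialMap_apply]
    exact h1.mul h2
  have h3 := hasFDerivAt_primitive_fst (g := fun p => q (p.1 + p.2) * H p)
    (g₂ := fun p => deriv q (p.1 + p.2) * H p + q (p.1 + p.2) * goursatDerivV q H p)
    (by fun_prop) (by fun_prop) hd 0
  exact ⟨_, intervalIntegral.continuous_parametric_intervalIntegral_of_continuous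
    (f := fun (z : ℝ × ℝ) t => deriv q (t + z.2) * H (t, z.2) +
      q (t + z.2) * goursatDerivV q H (t, z.2)) (by fun_prop) continuous_fst, h3⟩

/-- With `u = (t + x) / 2` and `v = (t - x) / 2` one has `u + v = t` and `M_tt - M_xx = H_uv = q(t)
M`. The diagonal is `v = 0`, where `H` is half the primitive of `q`; the antidiagonal is `u = 0`,
where `H` and `H_v` vanish. -/
theorem exists_isWaveKernel (hq : ContDiff ℝ 1 q) (hH : Continuous H)
    (hHe : ∀ z, H z = goursatInit q z + goursatOp q H z) :
    ∃ M₁ M₂ M₁₁ M₂₂, IsWaveKernel q (planeKernel H) M₁ M₂ M₁₁ M₂₂ := by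
  obtain ⟨P, hP, hPd⟩ := hasFDerivAt_goursatDerivU hq hH hHe
  obtain ⟨R, hR, hRd⟩ := hasFDerivAt_goursatDerivV hq hH hHe
  have hHd := hasFDerivAt_goursat hq.continuous hH hHe
  have hqc := hq.continuous
  have hU : Continuous (goursatDerivU q H) := continuous_iff_continuousAt.2 fun z =>
    (hPd z).continuousAt
  have hV : Continuous (goursatDerivV q H) := continuous_iff_continuousAt.2 fun z =>
    (hRd z).continuousAt
  refine ⟨fun p => (1 / 2) * (planeKernel (goursatDerivU q H) p + planeKernel (goursatDerivV q H) p),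
    fun p => (1 / 2) * (planeKernel (goursatDerivU q H) p - planeKernel (goursatDerivV q H) p),
    fun p => (1 / 2) * ((1 / 2) * (planeKernel P p + q p.1 * planeKernel H p) +
      (1 / 2) * (q p.1 * planeKernel H p + planeKernel R p)),
    fun p => (1 / 2) * ((1 / 2) * (planeKernel P p - q p.1 * planeKernel H p) -
      (1 / 2) * (q p.1 * planeKernel H p - planeKernel R p)), ?_⟩
  have cH := continuous_planeKernel hH
  have cU := continuous_planeKernel hU
  have cV := continuous_planeKernel hV
  have cP := continuous_planeKernel hP
  have cR := continuous_planeKernel hR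
  have hsum : ∀ t x : ℝ, (t + x) / 2 + (t - x) / 2 = t := fun t x => by ring
  have hPd' : ∀ t x : ℝ, HasFDerivAt (goursatDerivU q H)
      (partialMap (planeKernel P (t, x)) (q t * planeKernel H (t, x)))
      ((t + x) / 2, (t - x) / 2) := fun t x => by
    have := hPd ((t + x) / 2, (t - x) / 2)
    rwa [hsum] at this
  have hRd' : ∀ t x : ℝ, HasFDerivAt (goursatDerivV q H)
      (partialMap (q t * planeKernel H (t, x)) (planeKernel R (t, x)))
      ((t + x) / 2, (t - x) / 2) := fun t x => by
    have := hRd ((t + x) / 2, (t - x) / 2)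
    rwa [hsum] at this
  have hH0 : ∀ u, H (u, 0) = (1 / 2) * ∫ s in (0 : ℝ)..u, q s := fun u => by
    rw [hHe]; simp [goursatInit, goursatOp]
  refine ⟨cH, by fun_prop, by fun_prop, by fun_prop, by fun_prop,
    fun t x => hasDerivAt_planeKernel_fst (hHd _), fun t x => hasDerivAt_planeKernel_snd (hHd _),
    fun t x => ((hasDerivAt_planeKernel_fst (hPd' t x)).fun_add
      (hasDerivAt_planeKernel_fst (hRd' t x))).const_mul _,
    fun t x => ((hasDerivAt_planeKernel_snd (hPd' t x)).fun_sub
      (hasDerivAt_planeKernel_snd (hRd' t x))).const_mul _,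
    fun t x => by ring, fun x => ?_, fun x => ?_, fun x => ?_, fun x => ?_⟩
  · simp [planeKernel, goursatDerivU]
    ring
  · simp only [planeKernel]
    rw [hHe]
    simp [goursatInit, goursatOp]
  · simp [planeKernel, goursatDerivV]
  · have h1 : (fun x => planeKernel H (x, x)) = fun x => (1 / 2) * ∫ s in (0 : ℝ)..x, q s := by
      funext x
      rw [← hH0]
      simp [planeKernel]
    rw [h1]
    exact (intervalIntegral.integral_hasDerivAt_right (hqc.intervalIntegrable 0 x)
      (hqc.stronglyMeasurableAtFilter _ _) hqc.continuousAt).const_mul (1 / 2 : ℂ)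

end GoursatRegularity

/-! ### Differentiating `skew`, and functions that vanish off an interval -/

theorem hasDerivAt_skew {b : ℝ} {M M₂ : ℝ × ℝ → ℂ} {ψ : ℝ → ℂ} (hM : Continuous M)
    (hM₂ : Continuous M₂) (hd : ∀ t x, HasDerivAt (fun x => M (t, x)) (M₂ (t, x)) x)
    (hψ : Continuous ψ) (x : ℝ) :
    HasDerivAt (skew b M ψ) (-(M (x, x) * ψ x) + M (-x, x) * ψ (-x) + skew b M₂ ψ x) x := by
  have hF := fun c z => hasFDerivAt_primitive_fst (g := fun p => ψ p.1 * M p)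
    (g₂ := fun p => ψ p.1 * M₂ p) (by fun_prop) (by fun_prop)
    (fun t y => (hd t y).const_mul (ψ t)) c z
  have h1 : HasDerivAt (fun x => ∫ t in x..b, ψ t * M (t, x))
      (-(ψ x * M (x, x)) + ∫ t in x..b, ψ t * M₂ (t, x)) x := by
    have := ((hF b (x, x)).comp_hasDerivAt (f := fun x => (x, x)) x
      ((hasDerivAt_id' x).prodMk (hasDerivAt_id' x))).fun_neg
    simp only [partialMap_apply, Complex.ofReal_one, one_mul, neg_add,
      ← intervalIntegral.integral_symm] at this
    refine (this.congr_of_eventuallyEq (Filter.Eventually.of_forall fun y => ?_))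
    exact intervalIntegral.integral_symm _ _
  have h2 : HasDerivAt (fun x => ∫ t in (-b)..(-x), ψ t * M (t, x))
      (-(ψ (-x) * M (-x, x)) + ∫ t in (-b)..(-x), ψ t * M₂ (t, x)) x := by
    have := (hF (-b) (-x, x)).comp_hasDerivAt (f := fun x => (-x, x)) x
      ((hasDerivAt_id' x).fun_neg.prodMk (hasDerivAt_id' x))
    refine this.congr_deriv ?_
    simp [partialMap_apply]
  refine (h1.sub h2).congr_deriv ?_
  unfold skew
  ring

theorem integral_norm_le {b B : ℝ} {ψ : ℝ → ℂ} (hs : VanishesOff b ψ) (hb : 0 ≤ b)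
    (hB : ∀ x, ‖ψ x‖ ≤ B) : ∫ t, ‖ψ t‖ ≤ 2 * b * B := by
  have e : ∫ t, ‖ψ t‖ = ∫ t in Icc (-b) b, ‖ψ t‖ :=
    (setIntegral_eq_integral_of_forall_compl_eq_zero fun x hx => by rw [hs x hx, norm_zero]).symm
  have := norm_setIntegral_le_of_norm_le_const (μ := volume) (s := Icc (-b) b)
    (f := fun t => ‖ψ t‖) (C := B) (by simp) (fun x _ => by rw [norm_norm]; exact hB x)
  rw [e]
  refine (le_abs_self _).trans (this.trans_eq ?_)
  rw [Real.volume_real_Icc_of_le (by linarith)]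
  ring

theorem VanishesOff.integrable {b : ℝ} {ψ : ℝ → ℂ} (hs : VanishesOff b ψ)
    (hc : Continuous ψ) : Integrable ψ :=
  hc.integrable_of_hasCompactSupport (HasCompactSupport.intro isCompact_Icc hs)

theorem VanishesOff.deriv {b : ℝ} {ψ : ℝ → ℂ} (hs : VanishesOff b ψ) :
    VanishesOff b (deriv ψ) := by
  intro x hx
  have : ψ =ᶠ[𝓝 x] fun _ => 0 := by
    filter_upwards [isClosed_Icc.isOpen_compl.mem_nhds hx] with y hy using hs y hy
  rw [this.deriv_eq, deriv_const]

/-! ### Bounds in `C^k` -/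

/-- `f` is of class `C^k` on the line and all its derivatives up to order `k` are bounded
by `B`. -/
def CkBound (k : ℕ) (f : ℝ → ℂ) (B : ℝ) : Prop :=
  ContDiff ℝ k f ∧ ∀ j ≤ k, ∀ x, ‖iteratedDeriv j f x‖ ≤ B

namespace CkBound

variable {k : ℕ} {f g : ℝ → ℂ} {B B' b : ℝ}

theorem zero_iff : CkBound 0 f B ↔ Continuous f ∧ ∀ x, ‖f x‖ ≤ B := by
  simp [CkBound, contDiff_zero]

theorem succ_iff : CkBound (k + 1) f B ↔
    Differentiable ℝ f ∧ (∀ x, ‖f x‖ ≤ B) ∧ CkBound k (deriv f) B := by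
  constructor
  · rintro ⟨h1, h2⟩
    rw [Nat.cast_succ] at h1
    have h3 := contDiff_succ_iff_deriv.1 h1
    refine ⟨h3.1, fun x => by simpa using h2 0 (by omega) x, h3.2.2, fun j hj x => ?_⟩
    rw [← iteratedDeriv_succ']
    exact h2 (j + 1) (by omega) x
  · rintro ⟨h1, h2, h3⟩
    refine ⟨?_, fun j hj x => ?_⟩
    · rw [Nat.cast_succ]
      exact contDiff_succ_iff_deriv.2 ⟨h1, fun h => by simp at h, h3.1⟩
    · cases j with
      | zero => simpa using h2 x
      | succ j =>
        rw [iteratedDeriv_succ']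
        exact h3.2 j (by omega) x

theorem norm_le (h : CkBound k f B) (x : ℝ) : ‖f x‖ ≤ B := by
  simpa using h.2 0 (by omega) x

theorem nonneg (h : CkBound k f B) : 0 ≤ B := (norm_nonneg _).trans (h.norm_le 0)

theorem continuous (h : CkBound k f B) : Continuous f := h.1.continuous

theorem of_le {m : ℕ} (h : CkBound k f B) (hm : m ≤ k) : CkBound m f B :=
  ⟨h.1.of_le (by exact_mod_cast hm), fun j hj => h.2 j (hj.trans hm)⟩

theorem mono (h : CkBound k f B) (hB : B ≤ B') : CkBound k f B' :=
  ⟨h.1, fun j hj x => (h.2 j hj x).trans hB⟩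

theorem add (h : CkBound k f B) (h' : CkBound k g B') : CkBound k (f + g) (B + B') := by
  refine ⟨h.1.add h'.1, fun j hj x => ?_⟩
  have hj' : (j : ℕ∞ω) ≤ k := by exact_mod_cast hj
  rw [iteratedDeriv_add (h.1.of_le hj').contDiffAt (h'.1.of_le hj').contDiffAt]
  exact (norm_add_le _ _).trans (add_le_add (h.2 j hj x) (h'.2 j hj x))

theorem neg (h : CkBound k f B) : CkBound k (-f) B := by
  refine ⟨h.1.neg, fun j hj x => ?_⟩
  rw [iteratedDeriv_neg, norm_neg]
  exact h.2 j hj x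

theorem sub (h : CkBound k f B) (h' : CkBound k g B') : CkBound k (f - g) (B + B') := by
  rw [sub_eq_add_neg]; exact h.add h'.neg

theorem comp_neg (h : CkBound k f B) : CkBound k (fun x => f (-x)) B := by
  refine ⟨h.1.comp contDiff_neg, fun j hj x => ?_⟩
  rw [iteratedDeriv_comp_neg, norm_smul]
  simpa using h.2 j hj (-x)

/-- Leibniz rule by induction. The multiplier need not be bounded on the line, so the constant
depends on `b`. -/
theorem exists_mul {m : ℝ → ℂ} (b : ℝ) (hm : ContDiff ℝ k m) :
    ∃ C : ℝ, 0 ≤ C ∧ ∀ f B, VanishesOff b f → CkBound k f B → CkBound k (m * f) (C * B) := by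
  induction k generalizing m with
  | zero =>
    obtain ⟨C, hC⟩ := (isCompact_Icc (a := -b) (b := b)).exists_bound_of_continuousOn
      hm.continuous.continuousOn
    refine ⟨max C 0, le_max_right _ _, fun f B hs h => zero_iff.2
      ⟨hm.continuous.mul h.continuous, fun x => ?_⟩⟩
    have hB := h.nonneg
    by_cases hx : x ∈ Icc (-b) b
    · rw [Pi.mul_apply, norm_mul]
      exact mul_le_mul ((hC x hx).trans (le_max_left _ _)) (h.norm_le x) (norm_nonneg _)
        (le_max_right _ _)
    · rw [Pi.mul_apply, hs x hx, mul_zero, norm_zero]; positivity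
  | succ k ih =>
    rw [Nat.cast_succ] at hm
    obtain ⟨hmd, -, hm'⟩ := contDiff_succ_iff_deriv.1 hm
    obtain ⟨C₁, h1, hC₁⟩ := ih hm'
    obtain ⟨C₂, h2, hC₂⟩ := ih (hm.of_le le_self_add)
    refine ⟨C₁ + C₂, by positivity, fun f B hs h => ?_⟩
    obtain ⟨hd, hb, hf'⟩ := succ_iff.1 h
    have e1 := hC₁ f B hs (h.of_le (Nat.le_succ k))
    have e2 := hC₂ _ B hs.deriv hf'
    have e3 := hC₂ f B hs (h.of_le (Nat.le_succ k))
    have hB := h.nonneg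
    refine succ_iff.2 ⟨hmd.mul hd, fun x => (e3.norm_le x).trans ?_, ?_⟩
    · rw [add_mul]; linarith [mul_nonneg h1 hB]
    · have : deriv (m * f) = deriv m * f + m * deriv f := by
        funext x
        exact deriv_mul hmd.differentiableAt hd.differentiableAt
      rw [this, add_mul]
      exact e1.add e2

theorem skew_zero {M : ℝ × ℝ → ℂ} (hb : 0 ≤ b) (hM : Continuous M) :
    ∃ C : ℝ, 0 ≤ C ∧ ∀ f B, VanishesOff b f → Integrable f → ∫ t, ‖f t‖ ≤ B →
      CkBound 0 (skew b M f) (C * B) := by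
  obtain ⟨A, hA⟩ := ((isCompact_Icc (a := -b) (b := b)).prod
    (isCompact_Icc (a := -b) (b := b))).exists_bound_of_continuousOn hM.continuousOn
  have h0 : (0 : ℝ) ∈ Icc (-b) b := ⟨by linarith, hb⟩
  have hA0 : 0 ≤ A := (norm_nonneg _).trans (hA (0, 0) ⟨h0, h0⟩)
  refine ⟨2 * A, by positivity, fun f B hs hf hB => zero_iff.2 ⟨continuous_skew hM hf,
    fun x => ?_⟩⟩
  have hB0 : 0 ≤ B := (integral_nonneg fun _ => norm_nonneg _).trans hB
  by_cases hx : x ∈ Icc (-b) b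
  · exact (norm_skew_le hf (fun t ht x hx => hA (t, x) ⟨ht, hx⟩) hx).trans (by gcongr)
  · rw [vanishesOff_skew hM hf hs x hx, norm_zero]; positivity

/-- The operator gains a derivative: differentiation leaves multiplications by `M(x, x)` and `M(-x,
x)` and the operator with kernel `∂M/∂x`, each of which is bounded on `C^k`. -/
theorem skew_succ {M : ℝ × ℝ → ℂ} (hb : 0 ≤ b) (hM : ContDiff ℝ (k + 1) M) :
    ∃ C : ℝ, 0 ≤ C ∧ ∀ f B, VanishesOff b f → CkBound k f B →
      CkBound (k + 1) (skew b M f) (C * B) := by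
  have hstep : ∀ (k : ℕ) (M : ℝ × ℝ → ℂ), ContDiff ℝ (k + 1) M →
      (∀ L : ℝ × ℝ → ℂ, ContDiff ℝ k L → ∃ C : ℝ, 0 ≤ C ∧ ∀ f B, VanishesOff b f →
        CkBound k f B → CkBound k (skew b L f) (C * B)) →
      ∃ C : ℝ, 0 ≤ C ∧ ∀ f B, VanishesOff b f → CkBound k f B →
        CkBound (k + 1) (skew b M f) (C * B) := by
    intro k M hM hL
    set M₂ : ℝ × ℝ → ℂ := fun p => fderiv ℝ M p (0, 1) with hM₂
    have hM₂k : ContDiff ℝ k M₂ := (hM.fderiv_right le_rfl).clm_apply contDiff_const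
    have hd : ∀ t x, HasDerivAt (fun x => M (t, x)) (M₂ (t, x)) x := fun t x =>
      ((hM.differentiable (by simp)).differentiableAt.hasFDerivAt).comp_hasDerivAt x
        ((hasDerivAt_const x t).prodMk (hasDerivAt_id' x))
    have hMk : ContDiff ℝ k M := hM.of_le le_self_add
    obtain ⟨C₀, p0, hC₀⟩ := skew_zero hb hM.continuous
    obtain ⟨C₁, p1, hC₁⟩ := exists_mul (m := fun x => M (x, x)) b
      (hMk.comp (contDiff_id.prodMk contDiff_id))
    obtain ⟨C₂, p2, hC₂⟩ := exists_mul (m := fun x => M (-x, x)) b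
      (hMk.comp (contDiff_neg.prodMk contDiff_id))
    obtain ⟨C₃, p3, hC₃⟩ := hL M₂ hM₂k
    refine ⟨C₀ * (2 * b) + (C₁ + C₂ + C₃), by positivity, fun f B hs h => ?_⟩
    have hB := h.nonneg
    have hsn : VanishesOff b fun x => f (-x) := fun x hx =>
      hs (-x) fun hx' => hx ⟨by linarith [hx'.2], by linarith [hx'.1]⟩
    have hder := hasDerivAt_skew (b := b) hM.continuous hM₂k.continuous hd h.continuous
    refine succ_iff.2 ⟨fun x => (hder x).differentiableAt, fun x => ?_, ?_⟩
    · refine ((hC₀ f _ hs (hs.integrable h.continuous)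
        (integral_norm_le hs hb h.norm_le)).norm_le x).trans ?_
      rw [add_mul, mul_assoc C₀]
      exact le_add_of_nonneg_right (by positivity)
    · have e : deriv (skew b M f) = -((fun x => M (x, x)) * f) +
          (fun x => M (-x, x)) * (fun x => f (-x)) + skew b M₂ f := funext fun x => (hder x).deriv
      rw [e]
      refine (((hC₁ f B hs h).neg.add (hC₂ _ B hsn h.comp_neg)).add (hC₃ f B hs h)).mono ?_
      have : 0 ≤ C₀ * (2 * b) * B := by positivity
      linarith
  induction k generalizing M with
  | zero =>
    refine hstep 0 M hM fun L hL => ?_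
    obtain ⟨C, hC0, hC⟩ := skew_zero hb hL.continuous
    refine ⟨C * (2 * b), by positivity, fun f B hs h => ?_⟩
    rw [mul_assoc]
    exact hC f _ hs (hs.integrable h.continuous) (integral_norm_le hs hb h.norm_le)
  | succ k ih =>
    refine hstep (k + 1) M hM fun L hL => ?_
    rw [Nat.cast_succ] at hL
    obtain ⟨C, hC0, hC⟩ := ih hL
    exact ⟨C, hC0, fun f B hs h => hC f B hs (h.of_le (Nat.le_succ k))⟩

/-- For `k > 0` a `C^k` kernel already maps `C^(k-1)` to `C^k`. -/
theorem skew_self {M : ℝ × ℝ → ℂ} (hb : 0 ≤ b) (hM : ContDiff ℝ k M) :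
    ∃ C : ℝ, 0 ≤ C ∧ ∀ f B, VanishesOff b f → CkBound k f B →
      CkBound k (skew b M f) (C * B) := by
  cases k with
  | zero =>
    obtain ⟨C, hC0, hC⟩ := skew_zero hb hM.continuous
    refine ⟨C * (2 * b), by positivity, fun f B hs h => ?_⟩
    rw [mul_assoc]
    exact hC f _ hs (hs.integrable h.continuous) (integral_norm_le hs hb h.norm_le)
  | succ k =>
    rw [Nat.cast_succ] at hM
    obtain ⟨C, hC0, hC⟩ := skew_succ hb hM
    exact ⟨C, hC0, fun f B hs h => hC f B hs (h.of_le (Nat.le_succ k))⟩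

/-- Solutions of `f + skew b M f = g` inherit `C^k` bounds from `g`. -/
theorem exists_of_add_skew {M : ℝ × ℝ → ℂ} (hb : 0 ≤ b) (hM : ContDiff ℝ k M) :
    ∃ C : ℝ, 0 ≤ C ∧ ∀ f g B, VanishesOff b f → Integrable f → CkBound k g B →
      (∀ x, f x + skew b M f x = g x) → CkBound k f (C * B) := by
  have key : ∀ j ≤ k, ∃ C : ℝ, 0 ≤ C ∧ ∀ f g B, VanishesOff b f → Integrable f →
      CkBound k g B → (∀ x, f x + skew b M f x = g x) → CkBound j f (C * B) := by
    intro j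
    induction j with
    | zero =>
      intro _
      obtain ⟨A, hA⟩ := ((isCompact_Icc (a := -b) (b := b)).prod
        (isCompact_Icc (a := -b) (b := b))).exists_bound_of_continuousOn hM.continuous.continuousOn
      refine ⟨volterraConst b A, by unfold volterraConst; positivity,
        fun f g B hs hf hg h => zero_iff.2 ⟨?_, fun x => ?_⟩⟩
      · have : f = fun x => g x - skew b M f x := funext fun x => eq_sub_of_add_eq (h x)
        rw [this]
        exact hg.continuous.sub (continuous_skew hM.continuous hf)
      · by_cases hx : x ∈ Icc (-b) b
        · exact norm_le_of_add_skew hM.continuous hf (fun t ht x hx => hA (t, x) ⟨ht, hx⟩)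
            (fun x _ => hg.norm_le x) (fun x _ => h x) hx
        · rw [hs x hx, norm_zero]
          exact mul_nonneg (by unfold volterraConst; positivity) hg.nonneg
    | succ j ih =>
      intro hj
      obtain ⟨C, hC0, hC⟩ := ih (by omega)
      obtain ⟨C', hC0', hC'⟩ := skew_succ (k := j) hb
        (hM.of_le (by exact_mod_cast hj) : ContDiff ℝ ((j : ℕ∞ω) + 1) M)
      refine ⟨1 + C' * C, by positivity, fun f g B hs hf hg h => ?_⟩
      -- Bootstrap: a `C^j` bound for `f` gives a `C^(j+1)` bound for `skew b M f`, hence for `f`.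
      have : f = g - skew b M f := funext fun x => eq_sub_of_add_eq (h x)
      rw [this, add_mul, one_mul, mul_assoc]
      exact (hg.of_le hj).sub (hC' f _ hs (hC f g B hs hf hg h))
  exact key k le_rfl

end CkBound

/-! ### Primitives -/

/-- The primitive of `f` that vanishes at `-b`. -/
def prim (b : ℝ) (f : ℝ → ℂ) (x : ℝ) : ℂ := ∫ t in (-b)..x, f t

section Prim

variable {b : ℝ} {f g φ χ ψ : ℝ → ℂ}

theorem prim_sub (hf : ∀ u v, IntervalIntegrable f volume u v)
    (hg : ∀ u v, IntervalIntegrable g volume u v) : prim b (f - g) = prim b f - prim b g :=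
  funext fun _ => intervalIntegral.integral_sub (hf _ _) (hg _ _)

theorem continuous_prim (hf : Integrable f) : Continuous (prim b f) := hf.continuous_primitive _

theorem hasDerivAt_prim (hf : Continuous f) (x : ℝ) : HasDerivAt (prim b f) (f x) x :=
  intervalIntegral.integral_hasDerivAt_right (hf.intervalIntegrable _ _)
    (hf.stronglyMeasurableAtFilter _ _) hf.continuousAt

theorem prim_congr_ae (h : f =ᵐ[volume] g) : prim b f = prim b g :=
  funext fun _ => intervalIntegral.integral_congr_ae <| by filter_upwards [h] with t ht _ using ht

theorem norm_prim_le (hf : Integrable f) (x : ℝ) : ‖prim b f x‖ ≤ ∫ t, ‖f t‖ := by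
  have := norm_integral_mul_le (f := fun _ => (1 : ℂ)) (A := 1) (u := -b) (v := x) hf
    (fun _ _ => by simp)
  simpa [prim] using this

theorem norm_prim_prim_le (hf : Integrable f) (x : ℝ) :
    ‖prim b (prim b f) x‖ ≤ (∫ t, ‖f t‖) * |x + b| := by
  have := intervalIntegral.norm_integral_le_of_norm_le_const (a := -b) (b := x) (f := prim b f)
    (C := ∫ t, ‖f t‖) fun t _ => norm_prim_le hf t
  rwa [sub_neg_eq_add] at this

theorem VanishesOff.apply_left (hs : VanishesOff b f) (hf : Continuous f) : f (-b) = 0 := by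
  have h : closure (Iio (-b)) ⊆ {x | f x = 0} :=
    closure_minimal (fun x hx => hs x fun h => absurd h.1 (not_le.2 hx))
      (isClosed_eq hf continuous_const)
  rw [closure_Iio] at h
  exact h (mem_Iic.2 le_rfl)

theorem VanishesOff.apply_right (hs : VanishesOff b f) (hf : Continuous f) : f b = 0 := by
  have h : closure (Ioi b) ⊆ {x | f x = 0} :=
    closure_minimal (fun x hx => hs x fun h => absurd h.2 (not_le.2 hx))
      (isClosed_eq hf continuous_const)
  rw [closure_Ioi] at h
  exact h (mem_Ici.2 le_rfl)

theorem VanishesOff.of_hasDerivAt (hs : VanishesOff b f) (hf : ∀ x, HasDerivAt f (g x) x) :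
    VanishesOff b g := by
  have : g = _root_.deriv f := funext fun x => (hf x).deriv.symm
  rw [this]
  exact hs.deriv

theorem eq_prim_of_hasDerivAt (hs : VanishesOff b f) (hf : ∀ x, HasDerivAt f (g x) x)
    (hg : Continuous g) : f = prim b g := by
  funext x
  have hc : Continuous f := continuous_iff_continuousAt.2 fun x => (hf x).continuousAt
  rw [prim, intervalIntegral.integral_eq_sub_of_hasDerivAt (fun t _ => hf t)
    (hg.intervalIntegrable _ _), hs.apply_left hc, sub_zero]

/-- Integration by parts for a primitive of an integrable function. -/
theorem integral_prim_mul_deriv {g g' : ℝ → ℂ} (hψ : Integrable ψ)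
    (hg : ∀ t, HasDerivAt g (g' t) t) (hg' : Continuous g') (u v : ℝ) :
    ∫ t in u..v, prim b ψ t * g' t =
      prim b ψ v * g v - prim b ψ u * g u - ∫ t in u..v, ψ t * g t := by
  have hgc : Continuous g := continuous_iff_continuousAt.2 fun x => (hg x).continuousAt
  -- `E` is the defect of the formula. It is bounded by the `L¹` norm and vanishes on continuous
  -- functions, and the integrable ones among these are dense in `L¹`.
  let E : (ℝ → ℂ) → ℂ := fun ψ => (∫ t in u..v, prim b ψ t * g' t) -
    (prim b ψ v * g v - prim b ψ u * g u - ∫ t in u..v, ψ t * g t)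
  obtain ⟨A, hA⟩ := (isCompact_uIcc (a := u) (b := v)).exists_bound_of_continuousOn
    hgc.continuousOn
  obtain ⟨A', hA'⟩ := (isCompact_uIcc (a := u) (b := v)).exists_bound_of_continuousOn
    hg'.continuousOn
  have hA0 : 0 ≤ A := (norm_nonneg _).trans (hA u left_mem_uIcc)
  have hA0' : 0 ≤ A' := (norm_nonneg _).trans (hA' u left_mem_uIcc)
  have hE : ∀ θ, Integrable θ → ‖E θ‖ ≤ (A' * |v - u| + 3 * A) * ∫ t, ‖θ t‖ := by
    intro θ hθ
    have hn : 0 ≤ ∫ t, ‖θ t‖ := integral_nonneg fun _ => norm_nonneg _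
    have h1 : ‖∫ t in u..v, prim b θ t * g' t‖ ≤ (∫ t, ‖θ t‖) * A' * |v - u| :=
      intervalIntegral.norm_integral_le_of_norm_le_const fun t ht => by
        rw [norm_mul]
        exact mul_le_mul (norm_prim_le hθ t) (hA' t (uIoc_subset_uIcc ht)) (norm_nonneg _) hn
    have h2 : ‖∫ t in u..v, θ t * g t‖ ≤ (∫ t, ‖θ t‖) * A := norm_integral_mul_le hθ hA
    have h3 : ∀ w ∈ uIcc u v, ‖prim b θ w * g w‖ ≤ (∫ t, ‖θ t‖) * A := fun w hw => by
      rw [norm_mul]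
      exact mul_le_mul (norm_prim_le hθ w) (hA w hw) (norm_nonneg _) hn
    have h4 := norm_sub_le_of_le (norm_sub_le_of_le (h3 v right_mem_uIcc) (h3 u left_mem_uIcc)) h2
    refine (norm_sub_le_of_le h1 h4).trans_eq ?_
    ring
  have hsub : ∀ θ η, Integrable θ → Integrable η → E (θ - η) = E θ - E η := by
    intro θ η hθ hη
    have e1 : ∫ t in u..v, prim b (θ - η) t * g' t =
        (∫ t in u..v, prim b θ t * g' t) - ∫ t in u..v, prim b η t * g' t := by
      rw [← intervalIntegral.integral_sub (((continuous_prim hθ).fun_mul hg').intervalIntegrable _ _)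
        (((continuous_prim hη).fun_mul hg').intervalIntegrable _ _),
        prim_sub (fun _ _ => hθ.intervalIntegrable) (fun _ _ => hη.intervalIntegrable)]
      simp only [Pi.sub_apply, sub_mul]
    have e2 : ∫ t in u..v, (θ - η) t * g t =
        (∫ t in u..v, θ t * g t) - ∫ t in u..v, η t * g t := by
      rw [← intervalIntegral.integral_sub (hθ.intervalIntegrable.mul_continuousOn hgc.continuousOn)
        (hη.intervalIntegrable.mul_continuousOn hgc.continuousOn)]
      simp only [Pi.sub_apply, sub_mul]
    simp only [E, e1, e2]
    rw [prim_sub (fun _ _ => hθ.intervalIntegrable) (fun _ _ => hη.intervalIntegrable)]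
    simp only [Pi.sub_apply]
    ring
  have hcont : ∀ θ, Continuous θ → E θ = 0 := by
    intro θ hθ
    have := intervalIntegral.integral_mul_deriv_eq_deriv_mul (a := u) (b := v)
      (u := prim b θ) (v := g) (u' := θ) (v' := g') (fun t _ => hasDerivAt_prim hθ t)
      (fun t _ => hg t) (hθ.intervalIntegrable _ _) (hg'.intervalIntegrable _ _)
    simp only [E, this, sub_self]
  have hzero : E ψ = 0 := by
    set C := A' * |v - u| + 3 * A with hC
    have hC0 : 0 ≤ C := by positivity
    rw [← norm_le_zero_iff]
    refine le_of_forall_pos_le_add fun ε hε => ?_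
    obtain ⟨θ, -, h1, h2, h3⟩ := hψ.exists_hasCompactSupport_integral_sub_le
      (ε := ε / (C + 1)) (by positivity)
    have h4 := hE (ψ - θ) (hψ.sub h3)
    rw [hsub _ _ hψ h3, hcont θ h2, sub_zero] at h4
    refine h4.trans ((mul_le_mul_of_nonneg_left h1 hC0).trans ?_)
    rw [zero_add, mul_div_assoc', div_le_iff₀ (by positivity)]
    nlinarith
  exact sub_eq_zero.1 hzero

end Prim

/-! ### The transmutation identity for regular potentials -/

section WaveKernel

variable {b : ℝ} {q : ℝ → ℂ} {M M₁ M₂ M₁₁ M₂₂ : ℝ × ℝ → ℂ} {f g φ χ ψ : ℝ → ℂ}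

namespace IsWaveKernel

theorem hasDerivAt_skew (hM : IsWaveKernel q M M₁ M₂ M₁₁ M₂₂) (hφ : Continuous φ) (x : ℝ) :
    HasDerivAt (skew b M φ) (-(M (x, x) * φ x) + skew b M₂ φ x) x := by
  refine (Transmutation.hasDerivAt_skew hM.cont hM.cont₂ hM.deriv₂ hφ x).congr_deriv ?_
  rw [hM.antidiag, zero_mul, add_zero]

theorem hasDerivAt_deriv_skew (hM : IsWaveKernel q M M₁ M₂ M₁₁ M₂₂)
    (hφ : ∀ x, HasDerivAt φ (χ x) x) (x : ℝ) :
    HasDerivAt (fun x => -(M (x, x) * φ x) + skew b M₂ φ x)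
      (-((1 / 2) * q x * φ x + M (x, x) * χ x) +
        (-(M₂ (x, x) * φ x) + M₂ (-x, x) * φ (-x) + skew b M₂₂ φ x)) x := by
  have hc : Continuous φ := continuous_iff_continuousAt.2 fun x => (hφ x).continuousAt
  exact ((hM.derivDiag x).fun_mul (hφ x)).fun_neg.fun_add
    (Transmutation.hasDerivAt_skew hM.cont₂ hM.cont₂₂ hM.deriv₂₂ hc x)

/-- Replace `M_xx` by `M_tt - q M` and integrate by parts twice; the second time one factor is
merely the primitive of an integrable function. -/
theorem integral_mul_wave (hM : IsWaveKernel q M M₁ M₂ M₁₁ M₂₂) (hq : Continuous q)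
    (hφ : ∀ x, HasDerivAt φ (prim b ψ x) x) (hψ : Integrable ψ) (x u v : ℝ) :
    ∫ t in u..v, φ t * M₂₂ (t, x) = φ v * M₁ (v, x) - φ u * M₁ (u, x) -
      (prim b ψ v * M (v, x) - prim b ψ u * M (u, x)) +
      ∫ t in u..v, (ψ - q * φ) t * M (t, x) := by
  have hc : Continuous φ := continuous_iff_continuousAt.2 fun x => (hφ x).continuousAt
  have hχ : Continuous (prim b ψ) := continuous_prim hψ
  have c1 : Continuous fun t => M₁ (t, x) := hM.cont₁.comp (Continuous.prodMk_left x)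
  have c0 : Continuous fun t => M (t, x) := hM.cont.comp (Continuous.prodMk_left x)
  have c11 : Continuous fun t => M₁₁ (t, x) := hM.cont₁₁.comp (Continuous.prodMk_left x)
  have e1 := intervalIntegral.integral_mul_deriv_eq_deriv_mul (a := u) (b := v)
    (fun t _ => hφ t) (fun t _ => hM.deriv₁₁ t x) (hχ.intervalIntegrable _ _)
    (c11.intervalIntegrable _ _)
  have e2 := integral_prim_mul_deriv (b := b) hψ (fun t => hM.deriv₁ t x) c1 u v
  have e3 : ∫ t in u..v, φ t * M₂₂ (t, x) = (∫ t in u..v, φ t * M₁₁ (t, x)) -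
      ∫ t in u..v, q t * φ t * M (t, x) := by
    rw [← intervalIntegral.integral_sub ((hc.fun_mul c11).intervalIntegrable _ _)
      (((hq.fun_mul hc).fun_mul c0).intervalIntegrable _ _)]
    refine intervalIntegral.integral_congr fun t _ => ?_
    simp only [hM.wave]
    ring
  have e4 : ∫ t in u..v, (ψ - q * φ) t * M (t, x) = (∫ t in u..v, ψ t * M (t, x)) -
      ∫ t in u..v, q t * φ t * M (t, x) := by
    rw [← intervalIntegral.integral_sub (hψ.intervalIntegrable.mul_continuousOn c0.continuousOn)
      (((hq.fun_mul hc).fun_mul c0).intervalIntegrable _ _)]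
    refine intervalIntegral.integral_congr fun t _ => ?_
    simp only [Pi.sub_apply, Pi.mul_apply, sub_mul]
  rw [e3, e1, e2, e4]
  ring

/-- The second derivative of `skew b M φ`. -/
theorem second_deriv_eq (hM : IsWaveKernel q M M₁ M₂ M₁₁ M₂₂) (hq : Continuous q)
    (hφ : ∀ x, HasDerivAt φ (prim b ψ x) x) (hψ : Integrable ψ) (hφs : VanishesOff b φ) (x : ℝ) :
    -((1 / 2) * q x * φ x + M (x, x) * prim b ψ x) +
        (-(M₂ (x, x) * φ x) + M₂ (-x, x) * φ (-x) + skew b M₂₂ φ x) =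
      skew b M (ψ - q * φ) x - q x * φ x := by
  have hc : Continuous φ := continuous_iff_continuousAt.2 fun x => (hφ x).continuousAt
  have hχ : Continuous (prim b ψ) := continuous_prim hψ
  have hχs : VanishesOff b (prim b ψ) := hφs.of_hasDerivAt hφ
  have e1 := hM.integral_mul_wave hq hφ hψ x x b
  have e2 := hM.integral_mul_wave hq hφ hψ x (-b) (-x)
  rw [hφs.apply_right hc, hχs.apply_right hχ] at e1
  rw [hφs.apply_left hc, hχs.apply_left hχ, hM.antidiag] at e2
  unfold skew
  rw [e1, e2]
  -- The terms with `M(x, x)` have cancelled. What remains is `-φ(x) (M_t + M_x)(x, x)` and `φ(-x)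
  -- (M_x - M_t)(-x, x)`, both known from the data on the diagonals.
  linear_combination (-φ x) * hM.diag x - φ (-x) * hM.antidiag' x

/-- `Sφ` and its derivative vanish at `-b`, so integrating `(Sφ)'' = S(ψ - qφ) - qφ` twice from `-b`
leaves no constants. -/
theorem skew_eq_prim_prim (hM : IsWaveKernel q M M₁ M₂ M₁₁ M₂₂) (hq : Continuous q)
    (hψ : Integrable ψ) (hφ : φ = prim b (prim b ψ)) (hφs : VanishesOff b φ) :
    skew b M φ = prim b (prim b (skew b M (ψ - q * φ) - q * φ)) := by
  have hφd : ∀ x, HasDerivAt φ (prim b ψ x) x := fun x => by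
    rw [hφ]; exact hasDerivAt_prim (continuous_prim hψ) x
  have hc : Continuous φ := continuous_iff_continuousAt.2 fun x => (hφd x).continuousAt
  have h1 := fun x => hM.hasDerivAt_skew (b := b) hc x
  have h2 := fun x => hM.hasDerivAt_deriv_skew (b := b) hφd x
  simp only [hM.second_deriv_eq hq hφd hψ hφs] at h2
  have hs := vanishesOff_skew hM.cont (hφs.integrable hc) hφs
  have hqφ : Integrable (q * φ) := (hφs.mul_left q).integrable (hq.mul hc)
  have h3 := eq_prim_of_hasDerivAt hs h1 (continuous_iff_continuousAt.2 fun x =>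
    (h2 x).continuousAt)
  have h4 := eq_prim_of_hasDerivAt (hs.of_hasDerivAt h1) h2
    ((continuous_skew hM.cont (hψ.sub hqφ)).sub (hq.mul hc))
  rw [h3, h4]
  rfl

/-- Differentiability of `φ` is part of the conclusion: it comes from `φ = f - Sφ`, because `S`
gains derivatives. This yields `φ'' = g - D2` with `D2 = (Sφ)''`. Only then does `second_deriv_eq`
apply to `φ`, and it shows that `w = φ'' - qφ` solves `w + Sw = g`. -/
theorem eq_prim_prim_of_add_skew (hM : IsWaveKernel q M M₁ M₂ M₁₁ M₂₂) (hq : Continuous q)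
    (hg : Integrable g) (hgs : VanishesOff b g) (hf : f = prim b (prim b g))
    (hφi : Integrable φ) (hφs : VanishesOff b φ) (hφe : ∀ x, φ x + skew b M φ x = f x) :
    ∃ w : ℝ → ℂ, Integrable w ∧ VanishesOff b w ∧ (∀ x, w x + skew b M w x = g x) ∧
      φ = prim b (prim b (w + q * φ)) := by
  have hfd : ∀ x, HasDerivAt f (prim b g x) x := fun x => by
    rw [hf]; exact hasDerivAt_prim (continuous_prim hg) x
  have hfc : Continuous f := continuous_iff_continuousAt.2 fun x => (hfd x).continuousAt
  have hφ' : φ = f - skew b M φ := funext fun x => eq_sub_of_add_eq (hφe x)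
  have hc : Continuous φ := by rw [hφ']; exact hfc.sub (continuous_skew hM.cont hφi)
  have h1 := fun x => hM.hasDerivAt_skew (b := b) hc x
  have hd1c : Continuous fun x => -(M (x, x) * φ x) + skew b M₂ φ x :=
    (hM.cont.comp (by fun_prop) |>.mul hc).neg.add (continuous_skew hM.cont₂ hφi)
  have hs := vanishesOff_skew hM.cont hφi hφs
  have hd1s := hs.of_hasDerivAt h1
  have hφd : ∀ x, HasDerivAt φ (prim b g x - (-(M (x, x) * φ x) + skew b M₂ φ x)) x := by
    intro x
    have := (hfd x).sub (h1 x)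
    rwa [← hφ'] at this
  have h2 := fun x => hM.hasDerivAt_deriv_skew (b := b) hφd x
  set D2 : ℝ → ℂ := fun x => -((1 / 2) * q x * φ x + M (x, x) *
    (prim b g x - (-(M (x, x) * φ x) + skew b M₂ φ x))) +
        (-(M₂ (x, x) * φ x) + M₂ (-x, x) * φ (-x) + skew b M₂₂ φ x) with hD2
  have hD2c : Continuous D2 := by
    have i1 := continuous_prim (b := b) hg
    have i2 := continuous_skew (b := b) hM.cont₂ hφi
    have i3 := continuous_skew (b := b) hM.cont₂₂ hφi
    have i4 := hM.cont
    have i5 := hM.cont₂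
    simp only [hD2]
    fun_prop
  have hD2s : VanishesOff b D2 := hd1s.of_hasDerivAt h2
  have hD2i : Integrable D2 := hD2s.integrable hD2c
  have h3 := eq_prim_of_hasDerivAt hd1s h2 hD2c
  have hχ : ∀ x, prim b g x - (-(M (x, x) * φ x) + skew b M₂ φ x) = prim b (g - D2) x := by
    intro x
    rw [prim_sub (fun _ _ => hg.intervalIntegrable) (fun _ _ => hD2i.intervalIntegrable),
      Pi.sub_apply, ← congrFun h3 x]
  have hφd' : ∀ x, HasDerivAt φ (prim b (g - D2) x) x := fun x => by
    rw [← hχ]; exact hφd x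
  have hψ : Integrable (g - D2) := hg.sub hD2i
  have hqφ : Integrable (q * φ) := (hφs.mul_left q).integrable (hq.mul hc)
  have h5 : ∀ x, D2 x = skew b M (g - D2 - q * φ) x - q x * φ x := by
    intro x
    rw [← hM.second_deriv_eq hq hφd' hψ hφs x, ← hχ]
  refine ⟨g - D2 - q * φ, hψ.sub hqφ, (hgs.sub hD2s).sub (hφs.mul_left q), fun x => ?_, ?_⟩
  · have := h5 x
    simp only [Pi.sub_apply, Pi.mul_apply]
    linear_combination -this
  · rw [sub_add_cancel]
    exact eq_prim_of_hasDerivAt hφs hφd' (continuous_prim hψ)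

end IsWaveKernel

end WaveKernel

/-! ### The transmutation identity for integrable potentials -/

theorem eq_zero_of_norm_le_mul {E : ℂ} {K : ℝ} (h : ∀ δ : ℝ, 0 < δ → δ ≤ 1 → ‖E‖ ≤ K * δ) :
    E = 0 := by
  rw [← norm_le_zero_iff]
  refine le_of_forall_pos_le_add fun ε hε => ?_
  have hK : 0 < |K| + 1 := by positivity
  have h1 := h (min 1 (ε / (|K| + 1))) (lt_min one_pos (by positivity)) (min_le_left _ _)
  rw [zero_add]
  calc ‖E‖ ≤ K * min 1 (ε / (|K| + 1)) := h1
    _ ≤ (|K| + 1) * (ε / (|K| + 1)) :=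
        mul_le_mul ((le_abs_self K).trans (by linarith)) (min_le_right _ _) (by positivity) hK.le
    _ = ε := by field_simp

theorem exists_contDiff_integral_norm_sub_le {q : ℝ → ℂ} (hq : Integrable q) {δ : ℝ}
    (hδ : 0 < δ) :
    ∃ p : ℝ → ℂ, ContDiff ℝ 1 p ∧ Integrable p ∧ ∫ t, ‖p t - q t‖ ≤ δ := by
  obtain ⟨f, hfs, hfq, hfc, hfi⟩ := hq.exists_hasCompactSupport_integral_sub_le (half_pos hδ)
  -- Since `(1 + x²)⁻¹` has integral `π`, this pointwise tolerance has integral `δ / 2`.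
  obtain ⟨g, hg, hgf, hgs⟩ := hfc.exists_contDiff_approx 1
    (ε := fun x => δ / 2 / Real.pi * (1 + x ^ 2)⁻¹)
    (continuous_const.mul ((by fun_prop : Continuous fun x : ℝ => 1 + x ^ 2).inv₀
      fun x => by positivity)) (fun x => by have := Real.pi_pos; positivity)
  have hgi : Integrable g := hg.continuous.integrable_of_hasCompactSupport (hfs.mono hgs)
  refine ⟨g, hg, hgi, ?_⟩
  have h1 : ∫ t, ‖g t - f t‖ ≤ δ / 2 := by
    refine (integral_mono (hgi.sub hfi).norm (integrable_inv_one_add_sq.const_mul (δ / 2 / Real.pi))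
      fun x => ?_).trans_eq (by
        rw [integral_const_mul, integral_univ_inv_one_add_sq]
        have := Real.pi_pos
        field_simp)
    simpa [dist_eq_norm] using (hgf x).le
  calc ∫ t, ‖g t - q t‖ ≤ ∫ t, (‖g t - f t‖ + ‖q t - f t‖) :=
        integral_mono (hgi.sub hq).norm ((hgi.sub hfi).norm.add (hq.sub hfi).norm) fun x => by
          simp only
          rw [norm_sub_rev (q x)]
          exact norm_sub_le_norm_sub_add_norm_sub _ _ _
    _ = (∫ t, ‖g t - f t‖) + ∫ t, ‖q t - f t‖ :=
        integral_add (hgi.sub hfi).norm (hq.sub hfi).norm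
    _ ≤ δ := by linarith

section

variable {b : ℝ} {q : ℝ → ℂ} {H : ℝ × ℝ → ℂ} {f g φ ψ w : ℝ → ℂ}

theorem mem_diamond_planeKernel {t x : ℝ} (ht : t ∈ Icc (-b) b) (hx : x ∈ Icc (-b) b) :
    ((t + x) / 2, (t - x) / 2) ∈ diamond b := by
  have h1 := abs_le.2 ht
  have h2 := abs_le.2 hx
  change |(t + x) / 2| + |(t - x) / 2| ≤ b
  rw [abs_div, abs_div, abs_two]
  rcases abs_cases (t + x) with h | h <;> rcases abs_cases (t - x) with h' | h' <;>
    rcases abs_le.1 h1 with ⟨_, _⟩ <;> rcases abs_le.1 h2 with ⟨_, _⟩ <;> linarith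

/-- This is `goursat_stability` in the coordinates `(t, x)`. The restriction `δ ≤ 1` keeps `∫ ‖p‖ ≤
∫ ‖q‖ + 1`, so `C` does not depend on `δ`. -/
theorem exists_isWaveKernel_approx (hq : Integrable q) (hH : Continuous H)
    (hHe : ∀ z, H z = goursatInit q z + goursatOp q H z) (b : ℝ) :
    ∃ C : ℝ, 0 ≤ C ∧ ∀ δ : ℝ, 0 < δ → δ ≤ 1 → ∃ p L L₁ L₂ L₁₁ L₂₂, Continuous p ∧
      Integrable p ∧ ∫ t, ‖p t - q t‖ ≤ δ ∧ IsWaveKernel p L L₁ L₂ L₁₁ L₂₂ ∧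
      ∀ t ∈ Icc (-b) b, ∀ x ∈ Icc (-b) b, ‖(L - planeKernel H) (t, x)‖ ≤ C * δ := by
  obtain ⟨A, hA⟩ := (isCompact_diamond b).exists_bound_of_continuousOn hH.continuousOn
  refine ⟨2 * (1 + |A|) * Real.exp ((2 * ((∫ s, ‖q s‖) + 1) + 1) * b), by positivity,
    fun δ hδ hδ1 => ?_⟩
  obtain ⟨p, hp, hpi, hpq⟩ := exists_contDiff_integral_norm_sub_le hq hδ
  obtain ⟨G, hG, hGe⟩ := exists_global_goursat hpi
  obtain ⟨L₁, L₂, L₁₁, L₂₂, hL⟩ := exists_isWaveKernel hp hG hGe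
  refine ⟨p, planeKernel G, L₁, L₂, L₁₁, L₂₂, hp.continuous, hpi, hpq, hL, fun t ht x hx => ?_⟩
  have hp1 : ∫ s, ‖p s‖ ≤ (∫ s, ‖q s‖) + 1 := by
    calc ∫ s, ‖p s‖ ≤ ∫ s, (‖p s - q s‖ + ‖q s‖) :=
          integral_mono hpi.norm ((hpi.sub hq).norm.add hq.norm) fun s => by
            simpa using norm_add_le (p s - q s) (q s)
      _ = (∫ s, ‖p s - q s‖) + ∫ s, ‖q s‖ := integral_add (hpi.sub hq).norm hq.norm
      _ ≤ _ := by linarith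
  have h1 := goursat_stability hq hpi hH hG (r := b) (A := |A|) (fun z _ => hHe z)
    (fun z _ => hGe z) (fun z hz => (hA z hz).trans (le_abs_self A)) hp1
    (mem_diamond_planeKernel ht hx)
  refine h1.trans ?_
  calc 2 * ((1 + |A|) * ∫ s, ‖p s - q s‖) * Real.exp ((2 * ((∫ s, ‖q s‖) + 1) + 1) * b)
      ≤ 2 * ((1 + |A|) * δ) * Real.exp ((2 * ((∫ s, ‖q s‖) + 1) + 1) * b) := by gcongr
    _ = _ := by ring

theorem norm_skew_le_of_vanishesOff {M : ℝ × ℝ → ℂ} {A : ℝ} (hb : 0 ≤ b) (hM : Continuous M)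
    (hψ : Integrable ψ) (hs : VanishesOff b ψ)
    (hA : ∀ t ∈ Icc (-b) b, ∀ x ∈ Icc (-b) b, ‖M (t, x)‖ ≤ A) (x : ℝ) :
    ‖skew b M ψ x‖ ≤ 2 * A * ∫ t, ‖ψ t‖ := by
  have h0 : (0 : ℝ) ∈ Icc (-b) b := ⟨by linarith, hb⟩
  have hA0 : 0 ≤ A := (norm_nonneg _).trans (hA 0 h0 0 h0)
  have hn : 0 ≤ ∫ t, ‖ψ t‖ := integral_nonneg fun _ => norm_nonneg _
  by_cases hx : x ∈ Icc (-b) b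
  · exact norm_skew_le hψ hA hx
  · rw [vanishesOff_skew hM hψ hs x hx, norm_zero]; positivity

theorem integral_norm_skew_le {M : ℝ × ℝ → ℂ} {A : ℝ} (hb : 0 ≤ b) (hM : Continuous M)
    (hψ : Integrable ψ) (hs : VanishesOff b ψ)
    (hA : ∀ t ∈ Icc (-b) b, ∀ x ∈ Icc (-b) b, ‖M (t, x)‖ ≤ A) :
    ∫ x, ‖skew b M ψ x‖ ≤ 2 * b * (2 * A * ∫ t, ‖ψ t‖) :=
  integral_norm_le (vanishesOff_skew hM hψ hs) hb (norm_skew_le_of_vanishesOff hb hM hψ hs hA)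

theorem integral_norm_mul_le {B : ℝ} (hq : Integrable q) (hφ : ∀ x, ‖φ x‖ ≤ B) :
    ∫ x, ‖q x * φ x‖ ≤ (∫ x, ‖q x‖) * B := by
  rw [← integral_mul_const]
  refine integral_mono_of_nonneg (Filter.Eventually.of_forall fun _ => norm_nonneg _)
    (hq.norm.mul_const B) (Filter.Eventually.of_forall fun x => ?_)
  simp only [norm_mul]
  exact mul_le_mul_of_nonneg_left (hφ x) (norm_nonneg _)

theorem integral_norm_add_le (hf : Integrable f) (hg : Integrable g) :
    ∫ x, ‖f x + g x‖ ≤ (∫ x, ‖f x‖) + ∫ x, ‖g x‖ := by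
  rw [← integral_add hf.norm hg.norm]
  exact integral_mono (hf.add hg).norm (hf.norm.add hg.norm) fun x => norm_add_le _ _

theorem integral_norm_sub_le (hf : Integrable f) (hg : Integrable g) :
    ∫ x, ‖f x - g x‖ ≤ (∫ x, ‖f x‖) + ∫ x, ‖g x‖ := by
  simpa [sub_eq_add_neg] using integral_norm_add_le hf hg.neg

theorem exists_norm_le_of_vanishesOff (hφ : Continuous φ) (hs : VanishesOff b φ) :
    ∃ B : ℝ, 0 ≤ B ∧ ∀ x, ‖φ x‖ ≤ B := by
  obtain ⟨B, hB⟩ := (isCompact_Icc (a := -b) (b := b)).exists_bound_of_continuousOn hφ.continuousOn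
  refine ⟨max B 0, le_max_right _ _, fun x => ?_⟩
  by_cases hx : x ∈ Icc (-b) b
  · exact (hB x hx).trans (le_max_left _ _)
  · rw [hs x hx, norm_zero]; exact le_max_right _ _

theorem continuous_prim_prim (hψ : Integrable ψ) : Continuous (prim b (prim b ψ)) :=
  continuous_iff_continuousAt.2 fun x => (hasDerivAt_prim (continuous_prim hψ) x).continuousAt

theorem integrable_mul_of_vanishesOff (hq : Integrable q) (hφ : Continuous φ)
    (hs : VanishesOff b φ) : Integrable (q * φ) := by
  obtain ⟨B, -, hB⟩ := exists_norm_le_of_vanishesOff hφ hs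
  exact hq.mul_bdd (c := B) hφ.aestronglyMeasurable (Filter.Eventually.of_forall hB)

theorem prim_prim_sub (hf : Integrable f) (hg : Integrable g) (x : ℝ) :
    prim b (prim b f) x - prim b (prim b g) x = prim b (prim b (f - g)) x := by
  rw [prim_sub (fun _ _ => hf.intervalIntegrable) (fun _ _ => hg.intervalIntegrable),
    prim_sub (fun _ _ => (continuous_prim hf).intervalIntegrable _ _)
      (fun _ _ => (continuous_prim hg).intervalIntegrable _ _), Pi.sub_apply]

/-- The transmutation identity `(𝐓□ φ)'' = 𝐓□ (φ'' - q φ)` in integrated form. -/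
theorem skew_eq_prim_prim (hb : 0 ≤ b) (hq : Integrable q) (hH : Continuous H)
    (hHe : ∀ z, H z = goursatInit q z + goursatOp q H z)
    (hψ : Integrable ψ) (hψs : VanishesOff b ψ) (hφ : φ = prim b (prim b ψ))
    (hφs : VanishesOff b φ) :
    skew b (planeKernel H) φ =
      prim b (prim b (skew b (planeKernel H) (ψ - q * φ) - q * φ)) := by
  have hc : Continuous φ := by rw [hφ]; exact continuous_prim_prim hψ
  have hφi := hφs.integrable hc
  obtain ⟨B, hB0, hB⟩ := exists_norm_le_of_vanishesOff hc hφs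
  obtain ⟨C, hC0, hC⟩ := exists_isWaveKernel_approx hq hH hHe b
  have hM := continuous_planeKernel hH
  obtain ⟨A, hA⟩ := ((isCompact_Icc (a := -b) (b := b)).prod
    (isCompact_Icc (a := -b) (b := b))).exists_bound_of_continuousOn hM.continuousOn
  have hqφ := integrable_mul_of_vanishesOff hq hc hφs
  have hθ : Integrable (ψ - q * φ) := hψ.sub hqφ
  have hθs : VanishesOff b (ψ - q * φ) := hψs.sub (hφs.mul_left q)
  have hw : Integrable (skew b (planeKernel H) (ψ - q * φ) - q * φ) :=
    ((vanishesOff_skew hM hθ hθs).integrable (continuous_skew hM hθ)).sub hqφ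
  funext x
  -- Comparison with the identity for a `C¹` potential `p`. `K` collects the change of kernel in
  -- `Sφ` and in `S(ψ - qφ)`, and the terms `S((p - q)φ)` and `(p - q)φ`; each is of order `δ`.
  refine sub_eq_zero.1 (eq_zero_of_norm_le_mul
    (K := 2 * C * (∫ t, ‖φ t‖) + (2 * b * (2 * C * ∫ t, ‖(ψ - q * φ) t‖) +
      2 * b * (2 * (|A| + C) * B) + B) * |x + b|) fun δ hδ hδ1 => ?_)
  obtain ⟨p, L, L₁, L₂, L₁₁, L₂₂, hp, hpi, hpq, hL, hLM⟩ := hC δ hδ hδ1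
  have hpφ := integrable_mul_of_vanishesOff hpi hc hφs
  have hη : Integrable (ψ - p * φ) := hψ.sub hpφ
  have hηs : VanishesOff b (ψ - p * φ) := hψs.sub (hφs.mul_left p)
  have hwL : Integrable (skew b L (ψ - p * φ) - p * φ) :=
    ((vanishesOff_skew hL.cont hη hηs).integrable (continuous_skew hL.cont hη)).sub hpφ
  have hpq' : Integrable ((p - q) * φ) := integrable_mul_of_vanishesOff (hpi.sub hq) hc hφs
  have hpqs : VanishesOff b ((p - q) * φ) := hφs.mul_left _
  have hLA : ∀ t ∈ Icc (-b) b, ∀ x ∈ Icc (-b) b, ‖L (t, x)‖ ≤ |A| + C := by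
    intro t ht x hx
    have h1 := hLM t ht x hx
    have h2 := hA (t, x) ⟨ht, hx⟩
    calc ‖L (t, x)‖ = ‖planeKernel H (t, x) + (L - planeKernel H) (t, x)‖ := by
          rw [Pi.sub_apply, add_sub_cancel]
      _ ≤ |A| + C := (norm_add_le _ _).trans (add_le_add (h2.trans (le_abs_self A))
          (h1.trans (mul_le_of_le_one_right hC0 hδ1)))
  have e1 := congrFun (hL.skew_eq_prim_prim hp hψ hφ hφs) x
  have e2 : skew b L φ x = skew b (L - planeKernel H) φ x + skew b (planeKernel H) φ x := by
    rw [skew_sub_kernel hL.cont hM hφi, sub_add_cancel]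
  have e3 : (skew b L (ψ - p * φ) - p * φ) - (skew b (planeKernel H) (ψ - q * φ) - q * φ) =
      fun x => skew b (L - planeKernel H) (ψ - q * φ) x - skew b L ((p - q) * φ) x
        - ((p - q) * φ) x := by
    funext y
    have i1 : (ψ - p * φ) = (ψ - q * φ) - (p - q) * φ := by ring
    simp only [Pi.sub_apply, Pi.mul_apply]
    rw [skew_sub_kernel hL.cont hM hθ, i1, skew_sub hL.cont hθ hpq']
    ring
  have e4 : skew b (planeKernel H) φ x -
      prim b (prim b (skew b (planeKernel H) (ψ - q * φ) - q * φ)) x =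
      -skew b (L - planeKernel H) φ x + prim b (prim b ((skew b L (ψ - p * φ) - p * φ) -
        (skew b (planeKernel H) (ψ - q * φ) - q * φ))) x := by
    rw [← prim_prim_sub hwL hw, ← e1, e2]
    ring
  have f0 : ∫ t, ‖((p - q) * φ) t‖ ≤ δ * B :=
    (integral_norm_mul_le (hpi.sub hq) hB).trans (mul_le_mul_of_nonneg_right hpq hB0)
  have hLMc := hL.cont.sub hM
  have f1 : ‖skew b (L - planeKernel H) φ x‖ ≤ 2 * (C * δ) * ∫ t, ‖φ t‖ :=
    norm_skew_le_of_vanishesOff hb hLMc hφi hφs hLM x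
  have f2 : ∫ x, ‖skew b (L - planeKernel H) (ψ - q * φ) x‖ ≤
      2 * b * (2 * (C * δ) * ∫ t, ‖(ψ - q * φ) t‖) :=
    integral_norm_skew_le hb hLMc hθ hθs hLM
  have f3 : ∫ x, ‖skew b L ((p - q) * φ) x‖ ≤ 2 * b * (2 * (|A| + C) * (δ * B)) :=
    (integral_norm_skew_le hb hL.cont hpq' hpqs hLA).trans (by gcongr)
  have i2 : Integrable (skew b (L - planeKernel H) (ψ - q * φ)) :=
    (vanishesOff_skew hLMc hθ hθs).integrable (continuous_skew hLMc hθ)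
  have i3 : Integrable (skew b L ((p - q) * φ)) :=
    (vanishesOff_skew hL.cont hpq' hpqs).integrable (continuous_skew hL.cont hpq')
  have f4 := integral_norm_sub_le (i2.sub i3) hpq'
  have f5 := integral_norm_sub_le i2 i3
  simp only [Pi.sub_apply] at f4 f5
  have f6 := norm_prim_prim_le (b := b) (hwL.sub hw) x
  rw [e3] at f6
  have f7 : (∫ t, ‖skew b (L - planeKernel H) (ψ - q * φ) t - skew b L ((p - q) * φ) t
      - ((p - q) * φ) t‖) ≤ 2 * b * (2 * (C * δ) * ∫ t, ‖(ψ - q * φ) t‖) +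
        2 * b * (2 * (|A| + C) * (δ * B)) + δ * B := by linarith
  have f8 := f6.trans (mul_le_mul_of_nonneg_right f7 (abs_nonneg (x + b)))
  rw [e4, e3]
  refine (norm_add_le_of_le ((norm_neg _).trans_le f1) f8).trans_eq ?_
  ring

end

/-! ### The inverse of `𝐓□` under approximation of the potential -/

section

variable {b : ℝ} {q : ℝ → ℂ} {H : ℝ × ℝ → ℂ} {f g φ ψ w : ℝ → ℂ}

theorem norm_le_of_add_skew_of_vanishesOff {M : ℝ × ℝ → ℂ} {A ε : ℝ} (hb : 0 ≤ b)
    (hM : Continuous M) (hψ : Integrable ψ) (hs : VanishesOff b ψ)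
    (hA : ∀ t ∈ Icc (-b) b, ∀ x ∈ Icc (-b) b, ‖M (t, x)‖ ≤ A)
    (hg : ∀ x ∈ Icc (-b) b, ‖g x‖ ≤ ε)
    (h : ∀ x ∈ Icc (-b) b, ψ x + skew b M ψ x = g x) (x : ℝ) :
    ‖ψ x‖ ≤ volterraConst b A * ε := by
  by_cases hx : x ∈ Icc (-b) b
  · exact norm_le_of_add_skew hM hψ hA hg h hx
  · have h0 : (0 : ℝ) ∈ Icc (-b) b := ⟨by linarith, hb⟩
    rw [hs x hx, norm_zero]
    exact mul_nonneg (by unfold volterraConst; positivity) ((norm_nonneg _).trans (hg 0 h0))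

/-- The difference solves the equation with kernel `L` and right-hand side `-skew b (L - M) ψ`, so
the a priori bound applies to it. -/
theorem norm_sub_le_of_add_skew {M L : ℝ × ℝ → ℂ} {A ε : ℝ} {ψ' : ℝ → ℂ} (hb : 0 ≤ b)
    (hM : Continuous M) (hL : Continuous L)
    (hA : ∀ t ∈ Icc (-b) b, ∀ x ∈ Icc (-b) b, ‖L (t, x)‖ ≤ A)
    (hε : ∀ t ∈ Icc (-b) b, ∀ x ∈ Icc (-b) b, ‖(L - M) (t, x)‖ ≤ ε)
    (hψ : Integrable ψ) (hs : VanishesOff b ψ) (hψ' : Integrable ψ') (hs' : VanishesOff b ψ')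
    (h : ∀ x, ψ x + skew b M ψ x = g x) (h' : ∀ x, ψ' x + skew b L ψ' x = g x) (x : ℝ) :
    ‖(ψ' - ψ) x‖ ≤ volterraConst b A * (2 * ε * ∫ t, ‖ψ t‖) := by
  refine norm_le_of_add_skew_of_vanishesOff hb hL (hψ'.sub hψ) (hs'.sub hs) hA
    (g := fun x => -skew b (L - M) ψ x) (fun y _ => ?_) (fun y _ => ?_) x
  · rw [norm_neg]
    exact norm_skew_le_of_vanishesOff hb (hL.sub hM) hψ hs hε y
  · rw [skew_sub hL hψ' hψ, skew_sub_kernel hL hM hψ, Pi.sub_apply]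
    linear_combination h' y - h y

/-- The transmutation identity for the inverse of `𝐓□`, in integrated form. -/
theorem eq_prim_prim_of_add_skew (hb : 0 ≤ b) (hq : Integrable q) (hH : Continuous H)
    (hHe : ∀ z, H z = goursatInit q z + goursatOp q H z)
    (hg : Integrable g) (hgs : VanishesOff b g) (hf : f = prim b (prim b g))
    (hfs : VanishesOff b f) (hφ : Integrable φ) (hφs : VanishesOff b φ)
    (hφe : ∀ x, φ x + skew b (planeKernel H) φ x = f x) (hw : Integrable w)
    (hws : VanishesOff b w) (hwe : ∀ x, w x + skew b (planeKernel H) w x = g x) :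
    φ = prim b (prim b (w + q * φ)) := by
  have hM := continuous_planeKernel hH
  have hfc : Continuous f := by rw [hf]; exact continuous_prim_prim hg
  have hc : Continuous φ := by
    have : φ = f - skew b (planeKernel H) φ := funext fun x => eq_sub_of_add_eq (hφe x)
    rw [this]
    exact hfc.sub (continuous_skew hM hφ)
  obtain ⟨B, hB0, hB⟩ := exists_norm_le_of_vanishesOff hc hφs
  obtain ⟨C, hC0, hC⟩ := exists_isWaveKernel_approx hq hH hHe b
  obtain ⟨A, hA⟩ := ((isCompact_Icc (a := -b) (b := b)).prod
    (isCompact_Icc (a := -b) (b := b))).exists_bound_of_continuousOn hM.continuousOn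
  have hqφ := integrable_mul_of_vanishesOff hq hc hφs
  funext x
  set V := volterraConst b (|A| + C) with hV
  have hV0 : 0 ≤ V := by rw [hV, volterraConst]; positivity
  have nφ : 0 ≤ ∫ t, ‖φ t‖ := integral_nonneg fun _ => norm_nonneg _
  refine sub_eq_zero.1 (eq_zero_of_norm_le_mul
    (K := V * (2 * C * ∫ t, ‖φ t‖) + (2 * b * (V * (2 * C * ∫ t, ‖w t‖)) + B +
      ((∫ t, ‖q t‖) + 1) * (V * (2 * C * ∫ t, ‖φ t‖))) * |x + b|) fun δ hδ hδ1 => ?_)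
  obtain ⟨p, L, L₁, L₂, L₁₁, L₂₂, hp, hpi, hpq, hL, hLM⟩ := hC δ hδ hδ1
  have hLA : ∀ t ∈ Icc (-b) b, ∀ x ∈ Icc (-b) b, ‖L (t, x)‖ ≤ |A| + C := by
    intro t ht x hx
    have h1 := hLM t ht x hx
    have h2 := hA (t, x) ⟨ht, hx⟩
    calc ‖L (t, x)‖ = ‖planeKernel H (t, x) + (L - planeKernel H) (t, x)‖ := by
          rw [Pi.sub_apply, add_sub_cancel]
      _ ≤ |A| + C := (norm_add_le _ _).trans (add_le_add (h2.trans (le_abs_self A))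
          (h1.trans (mul_le_of_le_one_right hC0 hδ1)))
  have hp1 : ∫ s, ‖p s‖ ≤ (∫ s, ‖q s‖) + 1 := by
    have h1 := integral_norm_add_le (hpi.sub hq) hq
    simp only [Pi.sub_apply, sub_add_cancel] at h1
    linarith
  -- `φ'` and `w'` solve the approximate equations with the same right-hand sides `f` and `g`, so
  -- `φ' - φ` and `w' - w` are of order `δ`.
  obtain ⟨h, hhc, hhs, -, hhe⟩ := exists_add_skew_eq hb hL.cont hLA (hfs.integrable hfc) hfs
  set φ' := f + h with hφ'
  have hφ'c : Continuous φ' := hfc.add hhc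
  have hφ's : VanishesOff b φ' := hfs.add hhs
  have hφ'i : Integrable φ' := hφ's.integrable hφ'c
  obtain ⟨w', hw', hws', hwe', hφw⟩ :=
    hL.eq_prim_prim_of_add_skew hp hg hgs hf hφ'i hφ's hhe
  have d1 := norm_sub_le_of_add_skew hb hM hL.cont hLA hLM hφ hφs hφ'i hφ's hφe hhe
  have d2 := norm_sub_le_of_add_skew hb hM hL.cont hLA hLM hw hws hw' hws' hwe hwe'
  rw [← hV] at d1 d2
  have hpφ' := integrable_mul_of_vanishesOff hpi hφ'c hφ's
  have e1 := congrFun hφw x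
  have e2 : (w' + p * φ') - (w + q * φ) =
      fun x => (w' - w) x + ((p - q) * φ) x + (p * (φ' - φ)) x := by
    funext y
    simp only [Pi.sub_apply, Pi.add_apply, Pi.mul_apply]
    ring
  have e3 : φ x - prim b (prim b (w + q * φ)) x = -(φ' - φ) x +
      prim b (prim b ((w' + p * φ') - (w + q * φ))) x := by
    rw [← prim_prim_sub (hw'.add hpφ') (hw.add hqφ), ← e1, Pi.sub_apply]
    ring
  have i1 : Integrable (w' - w) := hw'.sub hw
  have i2 : Integrable ((p - q) * φ) := integrable_mul_of_vanishesOff (hpi.sub hq) hc hφs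
  have i3 : Integrable (p * (φ' - φ)) :=
    integrable_mul_of_vanishesOff hpi (hφ'c.sub hc) (hφ's.sub hφs)
  have f1 : ∫ t, ‖(w' - w) t‖ ≤ 2 * b * (V * (2 * (C * δ) * ∫ t, ‖w t‖)) :=
    integral_norm_le (hws'.sub hws) hb d2
  have f2 : ∫ t, ‖((p - q) * φ) t‖ ≤ δ * B :=
    (integral_norm_mul_le (hpi.sub hq) hB).trans (mul_le_mul_of_nonneg_right hpq hB0)
  have f3 : ∫ t, ‖(p * (φ' - φ)) t‖ ≤
      ((∫ t, ‖q t‖) + 1) * (V * (2 * (C * δ) * ∫ t, ‖φ t‖)) :=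
    (integral_norm_mul_le hpi d1).trans (mul_le_mul_of_nonneg_right hp1 (by positivity))
  have f4 := integral_norm_add_le (i1.add i2) i3
  have f5 := integral_norm_add_le i1 i2
  simp only [Pi.add_apply] at f4 f5
  have f6 := norm_prim_prim_le (b := b) ((hw'.add hpφ').sub (hw.add hqφ)) x
  rw [e2] at f6
  have f7 : (∫ t, ‖(w' - w) t + ((p - q) * φ) t + (p * (φ' - φ)) t‖) ≤
      2 * b * (V * (2 * (C * δ) * ∫ t, ‖w t‖)) + δ * B +
        ((∫ t, ‖q t‖) + 1) * (V * (2 * (C * δ) * ∫ t, ‖φ t‖)) := by linarith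
  have f8 := f6.trans (mul_le_mul_of_nonneg_right f7 (abs_nonneg (x + b)))
  rw [e3, e2]
  refine (norm_add_le_of_le ((norm_neg _).trans_le (d1 x)) f8).trans_eq ?_
  ring

end

/-! ### Weak derivatives -/

section WeakDeriv

variable {a b : ℝ} {f g : AEFun a} {ψ : ℝ → ℂ}

theorem ae_eq_zero_of_forall_test {U : Set ℝ} (hU : IsOpen U) {k : ℝ → ℂ}
    (hk : LocallyIntegrableOn k U)
    (h : ∀ η : ℝ → ℂ, ContDiff ℝ ∞ η → HasCompactSupport η → tsupport η ⊆ U →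
      ∫ x, k x * η x = 0) : ∀ᵐ x, x ∈ U → k x = 0 := by
  refine hU.ae_eq_zero_of_integral_contDiff_smul_eq_zero hk fun θ hθ hc hs => ?_
  have hsupp : Function.support (fun x => (θ x : ℂ)) = Function.support θ := by
    ext x; simp
  rw [← h (fun x => (θ x : ℂ)) (Complex.ofRealCLM.contDiff.comp hθ)
    (by unfold HasCompactSupport tsupport; rw [hsupp]; exact hc)
    (by unfold tsupport; rw [hsupp]; exact hs)]
  refine integral_congr_ae (Filter.Eventually.of_forall fun x => ?_)
  simp only [Complex.real_smul]
  ring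

theorem setIntegral_Ioo_mul_test {k η : ℝ → ℂ} (hs : tsupport η ⊆ Ioo (-a) a) :
    ∫ x in Ioo (-a) a, k x * η x = ∫ x, k x * η x :=
  setIntegral_eq_integral_of_forall_compl_eq_zero fun x hx => by
    rw [image_eq_zero_of_notMem_tsupport fun h => hx (hs h), mul_zero]

theorem eq_of_forall_test {k l : ℝ → ℂ} (hk : LocallyIntegrableOn k (Ioo (-a) a))
    (hl : LocallyIntegrableOn l (Ioo (-a) a))
    (h : ∀ η : ℝ → ℂ, ContDiff ℝ ∞ η → HasCompactSupport η → tsupport η ⊆ Ioo (-a) a →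
      ∫ x in Ioo (-a) a, k x * η x = ∫ x in Ioo (-a) a, l x * η x) :
    k =ᵐ[volume.restrict (Ioo (-a) a)] l := by
  have h1 := ae_eq_zero_of_forall_test isOpen_Ioo (hk.sub hl) fun η hη hc hs => by
    have e := h η hη hc hs
    have i1 := integrableOn_mul_test hk hη.continuous hc hs
    have i2 := integrableOn_mul_test hl hη.continuous hc hs
    rw [← setIntegral_Ioo_mul_test hs]
    simp only [Pi.sub_apply, sub_mul]
    rw [integral_sub i1 i2, e, sub_self]
  filter_upwards [(ae_restrict_iff' measurableSet_Ioo).2 h1] with x hx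
  exact sub_eq_zero.1 hx

theorem HasWeakDeriv.unique {g' : AEFun a} (h : HasWeakDeriv f g) (h' : HasWeakDeriv f g') :
    g = g' := by
  refine AEEqFun.ext (eq_of_forall_test h.right h'.right fun η hη hc hs => ?_)
  have := (h.eq η hη hc hs).symm.trans (h'.eq η hη hc hs)
  exact neg_injective this

theorem HasWeakDeriv2.unique {g' : AEFun a} (h : HasWeakDeriv2 f g) (h' : HasWeakDeriv2 f g') :
    g = g' := by
  obtain ⟨χ, h1, h2⟩ := h
  obtain ⟨χ', h1', h2'⟩ := h'
  obtain rfl := h1.unique h1'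
  exact h2.unique h2'

theorem locallyIntegrableOn_of_ae_eq {k l : ℝ → ℂ} (hl : LocallyIntegrable l)
    (h : k =ᵐ[volume.restrict (Ioo (-a) a)] l) : LocallyIntegrableOn k (Ioo (-a) a) :=
  locallyIntegrableOn_congr h.symm (hl.locallyIntegrableOn _)

theorem hasWeakDeriv_prim (ha : 0 < a) (hψ : Integrable ψ)
    (hf : f =ᵐ[volume.restrict (Ioo (-a) a)] prim b ψ)
    (hg : g =ᵐ[volume.restrict (Ioo (-a) a)] ψ) : HasWeakDeriv f g where
  left := locallyIntegrableOn_of_ae_eq (continuous_prim hψ).locallyIntegrable hf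
  right := locallyIntegrableOn_of_ae_eq hψ.locallyIntegrable hg
  eq := by
    intro η hη hc hs
    have haa : -a ≤ a := by linarith
    have hd : Continuous (deriv η) := hη.continuous_deriv (by simp)
    have h1 := integral_prim_mul_deriv (b := b) hψ (g := η) (g' := deriv η)
      (fun t => ((hη.differentiable (by simp)).differentiableAt).hasDerivAt) hd (-a) a
    rw [image_eq_zero_of_notMem_tsupport fun h => lt_irrefl a (hs h).2,
      image_eq_zero_of_notMem_tsupport fun h => lt_irrefl (-a) (hs h).1, mul_zero, mul_zero,
      sub_zero, zero_sub, intervalIntegral.integral_of_le haa,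
      intervalIntegral.integral_of_le haa, integral_Ioc_eq_integral_Ioo,
      integral_Ioc_eq_integral_Ioo] at h1
    have e1 : ∫ x in Ioo (-a) a, f x * deriv η x = ∫ x in Ioo (-a) a, prim b ψ x * deriv η x :=
      integral_congr_ae (by filter_upwards [hf] with x hx; rw [hx])
    have e2 : ∫ x in Ioo (-a) a, g x * η x = ∫ x in Ioo (-a) a, ψ x * η x :=
      integral_congr_ae (by filter_upwards [hg] with x hx; rw [hx])
    rw [e1, e2, h1]

/-- Test functions supported off `[-b, b]` do not see `f`, so `g` annihilates them. -/
theorem HasWeakDeriv.suppIn (h : HasWeakDeriv f g) (hs : SuppIn f (Icc (-b) b)) :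
    SuppIn g (Icc (-b) b) := by
  have hU : IsOpen (Ioo (-a) a \ Icc (-b) b) := isOpen_Ioo.sdiff isClosed_Icc
  have h1 := ae_eq_zero_of_forall_test hU (h.right.mono_set sdiff_subset) fun η hη hc hηs => by
    have h2 := h.eq η hη hc (hηs.trans sdiff_subset)
    have h3 : ∫ x in Ioo (-a) a, f x * deriv η x = 0 := by
      refine integral_eq_zero_of_ae ?_
      filter_upwards [hs] with x hx
      by_cases hxb : x ∈ Icc (-b) b
      · have : deriv η x = 0 := image_eq_zero_of_notMem_tsupport fun h =>
          (hηs (tsupport_deriv_subset h)).2 hxb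
        rw [this, mul_zero]; rfl
      · rw [hx hxb, zero_mul]; rfl
    rw [h3, setIntegral_Ioo_mul_test (hηs.trans sdiff_subset)] at h2
    exact neg_eq_zero.1 h2.symm
  unfold SuppIn
  rw [ae_restrict_iff' measurableSet_Ioo]
  filter_upwards [h1] with x hx hxa hxb using hx ⟨hxa, hxb⟩

/-- The representative of `f` that vanishes outside `[-b, b]`. -/
def cut (b : ℝ) (f : ℝ → ℂ) : ℝ → ℂ := (Icc (-b) b).indicator f

theorem vanishesOff_cut (b : ℝ) (f : ℝ → ℂ) : VanishesOff b (cut b f) := fun _ hx =>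
  indicator_of_notMem hx f

theorem SuppIn.ae_eq_cut (hs : SuppIn f (Icc (-b) b)) :
    f =ᵐ[volume.restrict (Ioo (-a) a)] cut b f := by
  filter_upwards [hs] with x hx
  by_cases hxb : x ∈ Icc (-b) b
  · exact (indicator_of_mem hxb f).symm
  · rw [hx hxb]; exact (indicator_of_notMem hxb f).symm

theorem integrable_cut {f : ℝ → ℂ} (hb : b < a) (hf : LocallyIntegrableOn f (Ioo (-a) a)) :
    Integrable (cut b f) :=
  (integrable_indicator_iff measurableSet_Icc).2
    (hf.integrableOn_compact_subset (Icc_subset_Ioo_of_lt hb) isCompact_Icc)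

theorem ae_eq_of_vanishesOff {φ φ' : ℝ → ℂ} (hb : b < a) (hφ : VanishesOff b φ)
    (hφ' : VanishesOff b φ') (h : φ =ᵐ[volume.restrict (Ioo (-a) a)] φ') : φ =ᵐ[volume] φ' := by
  have := (ae_restrict_iff' measurableSet_Ioo).1 h
  filter_upwards [this] with x hx
  by_cases hxb : x ∈ Icc (-b) b
  · exact hx (Icc_subset_Ioo_of_lt hb hxb)
  · rw [hφ x hxb, hφ' x hxb]

theorem prim_apply_of_vanishesOff {x : ℝ} (hψ : Integrable ψ) (hs : VanishesOff b ψ)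
    (hx : b ≤ x) : prim b ψ x = prim b ψ b := by
  have : ∫ t in b..x, ψ t = 0 := by
    refine intervalIntegral.integral_zero_ae (Filter.Eventually.of_forall fun t ht => ?_)
    rw [uIoc_of_le hx] at ht
    exact hs t fun h => absurd h.2 (not_le.2 ht.1)
  rw [prim, ← intervalIntegral.integral_add_adjacent_intervals
    (hψ.intervalIntegrable (a := -b) (b := b)) hψ.intervalIntegrable, this, add_zero]
  rfl

theorem prim_apply_of_lt {x : ℝ} (hs : VanishesOff b ψ) (hx : x < -b) : prim b ψ x = 0 := by
  refine intervalIntegral.integral_zero_ae ?_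
  filter_upwards [Measure.ae_ne volume (-b)] with t hne ht
  rw [uIoc_of_ge hx.le] at ht
  exact hs t fun h => hne (le_antisymm ht.2 h.1)

/-- A compactly supported function with a weak derivative is the primitive of it. -/
theorem HasWeakDeriv.ae_eq_prim (hb0 : 0 < b) (hb : b < a) (h : HasWeakDeriv f g)
    (hs : SuppIn f (Icc (-b) b)) :
    f =ᵐ[volume.restrict (Ioo (-a) a)] prim b (cut b g) ∧
      VanishesOff b (prim b (cut b g)) := by
  have hgs := h.suppIn hs
  have hgi : Integrable (cut b g) := integrable_cut hb h.right
  have hpc := continuous_prim (b := b) hgi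
  have hcs := vanishesOff_cut b g
  have hmain : f =ᵐ[volume.restrict (Ioo (-a) a)] prim b (cut b g) := by
    refine eq_of_forall_test h.left (hpc.locallyIntegrable.locallyIntegrableOn _)
      fun θ hθ hθc hθs => ?_
    -- The test function will be `χ Θ` with `Θ' = θ` and `χ = 1` near `[-b, b]`. Its derivative is
    -- `θ` on `[-b, b]`, and elsewhere `f` vanishes.
    obtain ⟨c, hbc, hca⟩ := exists_between hb
    let χ : ContDiffBump (0 : ℝ) := ⟨c, (c + a) / 2, hb0.trans hbc, by linarith⟩
    have hχs : tsupport (fun x => (χ x : ℂ)) ⊆ Ioo (-a) a := by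
      have e : Function.support (fun x => (χ x : ℂ)) = Function.support χ := by ext x; simp
      have e1 : tsupport (fun x => (χ x : ℂ)) = Metric.closedBall 0 ((c + a) / 2) := by
        unfold tsupport; rw [e]; exact χ.tsupport_eq
      rw [e1, Real.closedBall_eq_Icc]
      intro x hx
      exact ⟨by linarith [hx.1], by linarith [hx.2]⟩
    have hχd : ContDiff ℝ ∞ (fun x => (χ x : ℂ)) := Complex.ofRealCLM.contDiff.comp χ.contDiff
    have hχ1 : ∀ x, x ∈ Ioo (-c) c → (χ x : ℂ) = 1 := fun x hx => by
      rw [χ.one_of_mem_closedBall, Complex.ofReal_one]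
      rw [Real.closedBall_eq_Icc]
      exact ⟨by simpa using hx.1.le, by simpa using hx.2.le⟩
    let Θ : ℝ → ℂ := fun x => ∫ t in a..x, θ t
    have hΘ : ∀ x, HasDerivAt Θ (θ x) x := fun x =>
      intervalIntegral.integral_hasDerivAt_right (hθ.continuous.intervalIntegrable _ _)
        hθ.continuous.stronglyMeasurable.stronglyMeasurableAtFilter hθ.continuous.continuousAt
    have hΘd : ContDiff ℝ ∞ Θ := contDiff_infty_iff_deriv.2
      ⟨fun x => (hΘ x).differentiableAt, by
        rw [show _root_.deriv Θ = θ from funext fun x => (hΘ x).deriv]; exact hθ⟩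
    have hηs : tsupport (fun x => (χ x : ℂ) * Θ x) ⊆ Ioo (-a) a :=
      (tsupport_mul_subset_left (f := fun x => (χ x : ℂ))).trans hχs
    have hηc : HasCompactSupport (fun x => (χ x : ℂ) * Θ x) :=
      (isCompact_Icc (a := -a) (b := a)).of_isClosed_subset (isClosed_tsupport _)
        (hηs.trans Ioo_subset_Icc_self)
    have hbc' : Icc (-b) b ⊆ Ioo (-c) c := Icc_subset_Ioo_of_lt hbc
    have h1 := h.eq _ (hχd.mul hΘd) hηc hηs
    have e1 : ∫ x in Ioo (-a) a, f x * _root_.deriv (fun x => (χ x : ℂ) * Θ x) x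
        = ∫ x in Ioo (-a) a, f x * θ x := by
      refine integral_congr_ae ?_
      filter_upwards [hs] with x hx
      by_cases hxb : x ∈ Icc (-b) b
      · have : (fun x => (χ x : ℂ) * Θ x) =ᶠ[𝓝 x] Θ := by
          filter_upwards [isOpen_Ioo.mem_nhds (hbc' hxb)] with y hy
          rw [hχ1 y hy, one_mul]
        rw [this.deriv_eq, (hΘ x).deriv]
      · rw [hx hxb, zero_mul, zero_mul]
    have e2 : ∫ x in Ioo (-a) a, g x * ((χ x : ℂ) * Θ x)
        = ∫ x in Ioo (-a) a, cut b g x * Θ x := by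
      refine integral_congr_ae ?_
      filter_upwards [hgs.ae_eq_cut] with x hx
      rw [hx]
      by_cases hxb : x ∈ Icc (-b) b
      · rw [hχ1 x (hbc' hxb), one_mul]
      · rw [hcs x hxb, zero_mul, zero_mul]
    have haa : -a ≤ a := by linarith
    have h2 := integral_prim_mul_deriv (b := b) hgi hΘ hθ.continuous (-a) a
    have hΘa : Θ a = 0 := intervalIntegral.integral_same
    rw [hΘa, prim_apply_of_lt hcs (neg_lt_neg hb), mul_zero, zero_mul, sub_zero, zero_sub,
      intervalIntegral.integral_of_le haa, intervalIntegral.integral_of_le haa,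
      integral_Ioc_eq_integral_Ioo, integral_Ioc_eq_integral_Ioo] at h2
    rw [e1, e2] at h1
    rw [h1, h2]
  refine ⟨hmain, ?_⟩
  -- Beyond `b` the primitive is constant and equals `f = 0` almost everywhere, so the total
  -- integral of `g` is zero.
  have h0 : prim b (cut b g) b = 0 := by
    have hae : ∀ᵐ x ∂(volume.restrict (Ioo b a)), prim b (cut b g) b = 0 := by
      have hsub : Ioo b a ⊆ Ioo (-a) a := Ioo_subset_Ioo_left (by linarith)
      filter_upwards [ae_restrict_of_ae_restrict_of_subset hsub hmain,
        ae_restrict_of_ae_restrict_of_subset hsub hs,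
        ae_restrict_mem measurableSet_Ioo] with x hx hx0 hxm
      rw [← prim_apply_of_vanishesOff hgi hcs hxm.1.le, ← hx,
        hx0 fun h => absurd h.2 (not_le.2 hxm.1)]
    have : (ae (volume.restrict (Ioo b a))).NeBot := ae_restrict_neBot.2 (by simp [hb])
    exact hae.exists.choose_spec
  intro x hx
  rcases lt_or_ge x (-b) with hx1 | hx1
  · exact prim_apply_of_lt hcs hx1
  · rw [prim_apply_of_vanishesOff hgi hcs (not_le.1 fun h => hx ⟨hx1, h⟩).le, h0]

end WeakDeriv

/-! ### Globally defined representatives of the elements of `F_c(I)` -/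

section Bounds

variable {F : FunctionClass} {b B B' : ℝ} {f g p ψ φ : ℝ → ℂ} {H : ℝ × ℝ → ℂ}

/-- The `F`-norm of the function `ψ` on the line is at most `B`. -/
def BoundedBy : FunctionClass → (ℝ → ℂ) → ℝ → Prop
  | .Lp p _, ψ, B => AEStronglyMeasurable ψ ∧ eLpNorm ψ p ≤ ENNReal.ofReal B
  | .Ck k, ψ, B => CkBound k ψ B

/-- `ψ` vanishes outside `[-b, b]` and its `F`-norm is at most `B`. -/
structure FBound (F : FunctionClass) (b : ℝ) (ψ : ℝ → ℂ) (B : ℝ) : Prop where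
  nonneg : 0 ≤ B
  vanishesOff : VanishesOff b ψ
  bound : BoundedBy F ψ B

/-- `p` is globally of class `F`. -/
def GlobalMem : FunctionClass → (ℝ → ℂ) → Prop
  | .Lp r _, p => MemLp p r
  | .Ck k, p => ContDiff ℝ k p

theorem FBound.add (h : FBound F b f B) (h' : FBound F b g B') : FBound F b (f + g) (B + B') := by
  refine ⟨add_nonneg h.nonneg h'.nonneg, h.vanishesOff.add h'.vanishesOff, ?_⟩
  cases F with
  | Lp r hr =>
    refine ⟨h.bound.1.add h'.bound.1, (eLpNorm_add_le h.bound.1 h'.bound.1 hr).trans ?_⟩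
    rw [ENNReal.ofReal_add h.nonneg h'.nonneg]
    exact add_le_add h.bound.2 h'.bound.2
  | Ck k => exact CkBound.add h.bound h'.bound

theorem FBound.neg (h : FBound F b f B) : FBound F b (-f) B := by
  refine ⟨h.nonneg, fun x hx => by rw [Pi.neg_apply, h.vanishesOff x hx, neg_zero], ?_⟩
  cases F with
  | Lp r hr => exact ⟨h.bound.1.neg, (eLpNorm_neg f r volume).trans_le h.bound.2⟩
  | Ck k => exact CkBound.neg h.bound

theorem FBound.sub (h : FBound F b f B) (h' : FBound F b g B') : FBound F b (f - g) (B + B') := by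
  rw [sub_eq_add_neg]
  exact h.add h'.neg

theorem FBound.mono (h : FBound F b f B) (hB : B ≤ B') : FBound F b f B' := by
  refine ⟨h.nonneg.trans hB, h.vanishesOff, ?_⟩
  cases F with
  | Lp r hr => exact ⟨h.bound.1, h.bound.2.trans (ENNReal.ofReal_le_ofReal hB)⟩
  | Ck k => exact CkBound.mono h.bound hB

theorem VanishesOff.eLpNorm_eq (hf : VanishesOff b f) (r : ℝ≥0∞) :
    eLpNorm f r (volume.restrict (Icc (-b) b)) = eLpNorm f r :=
  eLpNorm_restrict_eq_of_support_subset fun x hx => by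
    by_contra h
    exact hx (hf x h)

theorem integral_norm_le_of_eLpNorm_one (hf : AEStronglyMeasurable f)
    (hB : 0 ≤ B) (h : eLpNorm f 1 ≤ ENNReal.ofReal B) : Integrable f ∧ ∫ t, ‖f t‖ ≤ B := by
  refine ⟨memLp_one_iff_integrable.1 ⟨hf, h.trans_lt ENNReal.ofReal_lt_top⟩, ?_⟩
  rw [integral_norm_eq_lintegral_enorm hf, ← eLpNorm_one_eq_lintegral_enorm]
  exact ENNReal.toReal_le_of_le_ofReal hB h

/-- Hölder on `[-b, b]` for `L^p`, with `V = (2b)^(1 - 1/p)`; a supremum bound for `C^k`. -/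
theorem exists_integral_norm_le (F : FunctionClass) (hb : 0 ≤ b) :
    ∃ C : ℝ, 0 ≤ C ∧ ∀ f B, FBound F b f B → Integrable f ∧ ∫ t, ‖f t‖ ≤ C * B := by
  cases F with
  | Lp r hr =>
    set V := (volume.restrict (Icc (-b) b)) univ ^ (1 / (1 : ℝ≥0∞).toReal - 1 / r.toReal)
    have hV : V ≠ ⊤ := by
      refine ENNReal.rpow_ne_top_of_nonneg ?_ (by simp)
      rcases eq_or_ne r ⊤ with rfl | hrt
      · simp
      · have : 1 ≤ r.toReal := by
          rw [← ENNReal.toReal_one]; exact ENNReal.toReal_mono hrt hr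
        simp only [ENNReal.toReal_one, div_one, sub_nonneg, one_div]
        exact inv_le_one_of_one_le₀ this
    refine ⟨V.toReal, ENNReal.toReal_nonneg, fun f B h => ?_⟩
    refine integral_norm_le_of_eLpNorm_one h.bound.1
      (mul_nonneg ENNReal.toReal_nonneg h.nonneg) ?_
    rw [← h.vanishesOff.eLpNorm_eq]
    refine (eLpNorm_le_eLpNorm_mul_rpow_measure_univ hr h.bound.1.restrict).trans ?_
    rw [h.vanishesOff.eLpNorm_eq, mul_comm, ENNReal.ofReal_mul ENNReal.toReal_nonneg,
      ENNReal.ofReal_toReal hV]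
    exact mul_le_mul_right h.bound.2 V
  | Ck k =>
    refine ⟨2 * b, by positivity, fun f B h => ?_⟩
    exact ⟨h.vanishesOff.integrable (CkBound.continuous h.bound),
      integral_norm_le h.vanishesOff hb (CkBound.norm_le h.bound)⟩

theorem FBound.integrable (h : FBound F b f B) (hb : 0 ≤ b) : Integrable f :=
  let ⟨_, _, hC⟩ := exists_integral_norm_le F hb
  (hC f B h).1

theorem exists_fBound_Lp (b : ℝ) (r : ℝ≥0∞) (hr : 1 ≤ r) :
    ∃ C : ℝ, 0 ≤ C ∧ ∀ f B, 0 ≤ B → VanishesOff b f → Continuous f → (∀ x, ‖f x‖ ≤ B) →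
      FBound (.Lp r hr) b f (C * B) := by
  set V := (volume.restrict (Icc (-b) b)) univ ^ r.toReal⁻¹
  have hV : V ≠ ⊤ := ENNReal.rpow_ne_top_of_nonneg (by positivity) (by simp)
  refine ⟨V.toReal, ENNReal.toReal_nonneg, fun f B hB hs hf h =>
    ⟨mul_nonneg ENNReal.toReal_nonneg hB, hs, hf.aestronglyMeasurable, ?_⟩⟩
  rw [← hs.eLpNorm_eq, ENNReal.ofReal_mul ENNReal.toReal_nonneg, ENNReal.ofReal_toReal hV]
  exact eLpNorm_le_of_ae_bound (Filter.Eventually.of_forall h)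

theorem exists_kernel_bound {M : ℝ × ℝ → ℂ} (hM : Continuous M) (b : ℝ) :
    ∃ A : ℝ, 0 ≤ A ∧ ∀ t ∈ Icc (-b) b, ∀ x ∈ Icc (-b) b, ‖M (t, x)‖ ≤ A := by
  obtain ⟨A, hA⟩ := ((isCompact_Icc (a := -b) (b := b)).prod
    (isCompact_Icc (a := -b) (b := b))).exists_bound_of_continuousOn hM.continuousOn
  exact ⟨max A 0, le_max_right _ _, fun t ht x hx => (hA (t, x) ⟨ht, hx⟩).trans (le_max_left _ _)⟩

theorem contDiff_planeKernel {n : ℕ} (hH : ContDiff ℝ n H) : ContDiff ℝ n (planeKernel H) :=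
  hH.comp (((contDiff_fst.add contDiff_snd).div_const 2).prodMk
    ((contDiff_fst.sub contDiff_snd).div_const 2))

/-- The data attached to a potential of class `F` on the whole line. -/
structure IsGlobalSolution (F : FunctionClass) (p : ℝ → ℂ) (H : ℝ × ℝ → ℂ) : Prop where
  integrable : Integrable p
  mem : GlobalMem F p
  continuous : Continuous H
  eq : ∀ z, H z = goursatInit p z + goursatOp p H z

/-- For `L^p` the operator factors through `L^p → L¹ → L^∞ → L^p` on `[-b, b]`. For `C^k` the
potential is `C^k`, hence so is the kernel. -/
theorem IsGlobalSolution.exists_skew (h : IsGlobalSolution F p H) (hb : 0 ≤ b) :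
    ∃ C : ℝ, 0 ≤ C ∧ ∀ f B, FBound F b f B → FBound F b (skew b (planeKernel H) f) (C * B) := by
  have hM := continuous_planeKernel h.continuous
  obtain ⟨C₁, hC₁, h₁⟩ := exists_integral_norm_le F hb
  cases F with
  | Lp r hr =>
    obtain ⟨A, hA0, hA⟩ := exists_kernel_bound hM b
    obtain ⟨C₂, hC₂, h₂⟩ := exists_fBound_Lp b r hr
    refine ⟨C₂ * (2 * A * C₁), by positivity, fun f B hf => ?_⟩
    obtain ⟨hi, hn⟩ := h₁ f B hf
    have := hf.nonneg
    rw [mul_assoc]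
    refine h₂ _ _ (by positivity) (vanishesOff_skew hM hi hf.vanishesOff)
      (continuous_skew hM hi) fun x => ?_
    refine (norm_skew_le_of_vanishesOff hb hM hi hf.vanishesOff hA x).trans ?_
    rw [mul_assoc (2 * A)]
    gcongr
  | Ck k =>
    obtain ⟨C, hC, hk⟩ := CkBound.skew_self hb
      (contDiff_planeKernel (contDiff_goursat h.mem h.continuous h.eq))
    exact ⟨C, hC, fun f B hf => ⟨mul_nonneg hC hf.nonneg,
      vanishesOff_skew hM (hf.integrable hb) hf.vanishesOff, hk f B hf.vanishesOff hf.bound⟩⟩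

theorem IsGlobalSolution.exists_add_skew (h : IsGlobalSolution F p H) (hb : 0 ≤ b) :
    ∃ C : ℝ, 0 ≤ C ∧ ∀ f B, FBound F b f B →
      FBound F b (f + skew b (planeKernel H) f) (C * B) := by
  obtain ⟨C, hC, hk⟩ := h.exists_skew hb
  refine ⟨1 + C, by positivity, fun f B hf => ?_⟩
  rw [add_mul, one_mul]
  exact hf.add (hk f B hf)

/-- For `L^p` the solution is `f` plus a continuous correction bounded by the `L¹` norm of `f`. For
`C^k` the solution inherits its bounds from `f` by bootstrapping. -/
theorem IsGlobalSolution.exists_solve (h : IsGlobalSolution F p H) (hb : 0 ≤ b) :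
    ∃ C : ℝ, 0 ≤ C ∧ ∀ f B, FBound F b f B → ∃ ψ, FBound F b ψ (C * B) ∧
      ∀ x, ψ x + skew b (planeKernel H) ψ x = f x := by
  have hM := continuous_planeKernel h.continuous
  obtain ⟨A, hA0, hA⟩ := exists_kernel_bound hM b
  obtain ⟨C₁, hC₁, h₁⟩ := exists_integral_norm_le F hb
  have hVC : 0 ≤ volterraConst b A := by unfold volterraConst; positivity
  cases F with
  | Lp r hr =>
    obtain ⟨C₂, hC₂, h₂⟩ := exists_fBound_Lp b r hr
    refine ⟨1 + C₂ * (volterraConst b A * (2 * A * C₁)), by positivity, fun f B hf => ?_⟩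
    obtain ⟨hi, hn⟩ := h₁ f B hf
    obtain ⟨u, hu, hus, hun, hue⟩ := exists_add_skew_eq hb hM hA hi hf.vanishesOff
    refine ⟨f + u, ?_, hue⟩
    have := hf.nonneg
    rw [add_mul, one_mul, mul_assoc C₂]
    refine hf.add (h₂ _ _ (by positivity) hus hu fun x => (hun x).trans ?_)
    rw [mul_assoc (volterraConst b A), mul_assoc (2 * A)]
    gcongr
  | Ck k =>
    obtain ⟨C, hC, hk⟩ := CkBound.exists_of_add_skew hb
      (contDiff_planeKernel (contDiff_goursat h.mem h.continuous h.eq))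
    refine ⟨C, hC, fun f B hf => ?_⟩
    have hi := hf.integrable hb
    obtain ⟨u, hu, hus, -, hue⟩ := exists_add_skew_eq hb hM hA hi hf.vanishesOff
    have hs := hf.vanishesOff.add hus
    exact ⟨f + u, ⟨mul_nonneg hC hf.nonneg, hs,
      hk _ _ _ hs (hi.add (hus.integrable hu)) hf.bound hue⟩, hue⟩

/-- An `L^p` multiplier needs a supremum bound on `φ`, a `C^k` multiplier a `C^k` bound; asking for
both treats the two classes alike. -/
theorem GlobalMem.exists_mul (h : GlobalMem F p) (b : ℝ) :
    ∃ C : ℝ, 0 ≤ C ∧ ∀ φ B, FBound F b φ B → Continuous φ → (∀ x, ‖φ x‖ ≤ B) →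
      FBound F b (p * φ) (C * B) := by
  cases F with
  | Lp r hr =>
    have hp : MemLp p r := h
    refine ⟨(eLpNorm p r).toReal, ENNReal.toReal_nonneg, fun φ B hφ hc hB =>
      ⟨mul_nonneg ENNReal.toReal_nonneg hφ.nonneg, hφ.vanishesOff.mul_left p,
        hp.1.mul hφ.bound.1, ?_⟩⟩
    have h1 := eLpNorm_le_mul_eLpNorm_of_ae_le_mul (μ := volume) (f := p * φ) (g := p) (c := B)
      (Filter.Eventually.of_forall fun x => by
        rw [Pi.mul_apply, norm_mul, mul_comm]
        exact mul_le_mul_of_nonneg_right (hB x) (norm_nonneg _)) r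
    rw [mul_comm _ B, ENNReal.ofReal_mul hφ.nonneg, ENNReal.ofReal_toReal hp.2.ne]
    exact h1
  | Ck k =>
    obtain ⟨C, hC, hk⟩ := CkBound.exists_mul b (show ContDiff ℝ k p from h)
    exact ⟨C, hC, fun φ B hφ _ _ => ⟨mul_nonneg hC hφ.nonneg, hφ.vanishesOff.mul_left p,
      hk φ B hφ.vanishesOff hφ.bound⟩⟩

/-- Both primitives are bounded by the `L¹` norm of `ψ`. For `C^k` the derivatives of the twofold
primitive are `prim b ψ` and those of `ψ`, so the bound even holds in `C^(k+2)`. -/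
theorem exists_prim_prim (F : FunctionClass) (hb : 0 ≤ b) :
    ∃ C : ℝ, 0 ≤ C ∧ ∀ ψ B, FBound F b ψ B → VanishesOff b (prim b (prim b ψ)) →
      FBound F b (prim b (prim b ψ)) (C * B) ∧ (∀ x, ‖prim b (prim b ψ) x‖ ≤ C * B) ∧
      ∀ x, ‖prim b ψ x‖ ≤ C * B := by
  obtain ⟨C₁, hC₁, h₁⟩ := exists_integral_norm_le F hb
  have key : ∀ ψ B, FBound F b ψ B → VanishesOff b (prim b (prim b ψ)) →
      ∀ x, ‖prim b (prim b ψ) x‖ ≤ C₁ * (2 * b) * B := fun ψ B hψ hs x => by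
    obtain ⟨hi, hn⟩ := h₁ ψ B hψ
    have := hψ.nonneg
    by_cases hx : x ∈ Icc (-b) b
    · refine (norm_prim_prim_le hi x).trans ?_
      have : |x + b| ≤ 2 * b := abs_le.2 ⟨by linarith [hx.1], by linarith [hx.2]⟩
      calc _ ≤ (C₁ * B) * (2 * b) := by gcongr
        _ = _ := by ring
    · rw [hs x hx, norm_zero]; positivity
  have key' : ∀ ψ B, FBound F b ψ B → ∀ x, ‖prim b ψ x‖ ≤ C₁ * B := fun ψ B hψ x =>
    (norm_prim_le (h₁ ψ B hψ).1 x).trans (h₁ ψ B hψ).2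
  cases F with
  | Lp r hr =>
    obtain ⟨C₂, hC₂, h₂⟩ := exists_fBound_Lp b r hr
    refine ⟨C₂ * (C₁ * (2 * b)) + C₁ * (2 * b) + C₁, by positivity, fun ψ B hψ hs => ?_⟩
    have hB := hψ.nonneg
    have i1 : 0 ≤ C₂ * (C₁ * (2 * b)) * B := by positivity
    have i2 : 0 ≤ C₁ * (2 * b) * B := by positivity
    have i3 : 0 ≤ C₁ * B := by positivity
    refine ⟨(h₂ _ _ (by positivity) hs (continuous_prim_prim (hψ.integrable hb))
      (key ψ B hψ hs)).mono ?_, fun x => (key ψ B hψ hs x).trans ?_,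
      fun x => (key' ψ B hψ x).trans ?_⟩ <;> nlinarith
  | Ck k =>
    refine ⟨1 + C₁ * (2 * b) + C₁, by positivity, fun ψ B hψ hs => ?_⟩
    have hB := hψ.nonneg
    have i2 : 0 ≤ C₁ * (2 * b) * B := by positivity
    have i3 : 0 ≤ C₁ * B := by positivity
    have hi := hψ.integrable hb
    have hψc : Continuous ψ := CkBound.continuous hψ.bound
    have hd := hasDerivAt_prim (b := b) (continuous_prim (b := b) hi)
    have hd' := hasDerivAt_prim (b := b) hψc
    have k1 : ∀ x, ‖prim b (prim b ψ) x‖ ≤ (1 + C₁ * (2 * b) + C₁) * B := fun x =>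
      (key ψ B hψ hs x).trans (by nlinarith)
    have k2 : ∀ x, ‖prim b ψ x‖ ≤ (1 + C₁ * (2 * b) + C₁) * B := fun x =>
      (key' ψ B hψ x).trans (by nlinarith)
    refine ⟨⟨by positivity, hs, ?_⟩, k1, k2⟩
    have : CkBound (k + 2) (prim b (prim b ψ)) ((1 + C₁ * (2 * b) + C₁) * B) := by
      refine CkBound.succ_iff.2 ⟨fun x => (hd x).differentiableAt, k1, ?_⟩
      rw [show _root_.deriv (prim b (prim b ψ)) = prim b ψ from funext fun x => (hd x).deriv]
      refine CkBound.succ_iff.2 ⟨fun x => (hd' x).differentiableAt, k2, ?_⟩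
      rw [show _root_.deriv (prim b ψ) = ψ from funext fun x => (hd' x).deriv]
      exact CkBound.mono hψ.bound (by nlinarith)
    exact this.of_le (by omega)

end Bounds

section Representatives

variable {F : FunctionClass} {a b B : ℝ} {f : AEFun a} {q ψ φ : ℝ → ℂ}

theorem IsCkRep.eqOn {k : ℕ} {g g' : ℝ → ℂ} (h : IsCkRep k f g) (h' : IsCkRep k f g') :
    EqOn g g' (Ioo (-a) a) :=
  Measure.eqOn_open_of_ae_eq (h.2.symm.trans h'.2) isOpen_Ioo h.1.continuousOn
    h'.1.continuousOn

theorem IsCkRep.normF_eq {k : ℕ} {g : ℝ → ℂ} (h : IsCkRep k f g) :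
    normF a (.Ck k) f = ∑ j ∈ Finset.range (k + 1),
      ⨆ x ∈ Ioo (-a) a, ‖iteratedDerivWithin j g (Ioo (-a) a) x‖ₑ := by
  refine le_antisymm (iInf₂_le g h) (le_iInf₂ fun g' h' => le_of_eq ?_)
  refine Finset.sum_congr rfl fun j _ => iSup_congr fun x => iSup_congr fun hx => ?_
  rw [iteratedDerivWithin_congr (h.eqOn h') hx]

/-- A function bounded in `F` on the line defines an element of `F(I)`. -/
theorem exists_normF_le (a : ℝ) (F : FunctionClass) : ∃ C : ℝ, 0 ≤ C ∧
    ∀ (b : ℝ) (f : AEFun a) (ψ : ℝ → ℂ) (B : ℝ), f =ᵐ[volume.restrict (Ioo (-a) a)] ψ →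
      FBound F b ψ B → f ∈ FI a F ∧ normF a F f ≤ ENNReal.ofReal (C * B) := by
  cases F with
  | Lp r hr =>
    refine ⟨1, zero_le_one, fun b f ψ B h hψ => ?_⟩
    have h1 : eLpNorm f r (volume.restrict (Ioo (-a) a)) ≤ ENNReal.ofReal (1 * B) := by
      rw [eLpNorm_congr_ae h, one_mul]
      exact (eLpNorm_mono_measure ψ Measure.restrict_le_self).trans hψ.bound.2
    exact ⟨⟨f.aestronglyMeasurable, h1.trans_lt ENNReal.ofReal_lt_top⟩, h1⟩
  | Ck k =>
    refine ⟨k + 1, by positivity, fun b f ψ B h hψ => ?_⟩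
    have hrep : IsCkRep k f ψ := ⟨hψ.bound.1.contDiffOn, h⟩
    refine ⟨⟨ψ, hrep⟩, ?_⟩
    rw [hrep.normF_eq]
    refine (Finset.sum_le_card_nsmul _ _ (ENNReal.ofReal B) fun j hj => iSup₂_le fun x hx => ?_).trans
      (le_of_eq ?_)
    · rw [iteratedDerivWithin_of_isOpen isOpen_Ioo hx, ← ofReal_norm]
      exact ENNReal.ofReal_le_ofReal (hψ.bound.2 j (by simpa [Nat.lt_succ_iff] using hj) x)
    · rw [Finset.card_range, nsmul_eq_mul, ENNReal.ofReal_mul (by positivity)]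
      congr 1
      rw [show ((k : ℝ) + 1) = ((k + 1 : ℕ) : ℝ) by push_cast; rfl, ENNReal.ofReal_natCast]

theorem contDiff_of_contDiffOn_of_vanishesOff {n : ℕ} (hb : b < a) (h : ContDiffOn ℝ n ψ (Ioo (-a) a))
    (hs : VanishesOff b ψ) : ContDiff ℝ n ψ := by
  rw [contDiff_iff_contDiffAt]
  intro x
  by_cases hx : x ∈ Icc (-b) b
  · exact h.contDiffAt (isOpen_Ioo.mem_nhds (Icc_subset_Ioo_of_lt hb hx))
  · refine (contDiffAt_const (c := (0 : ℂ))).congr_of_eventuallyEq ?_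
    filter_upwards [isClosed_Icc.isOpen_compl.mem_nhds hx] with y hy using hs y hy

/-- An element of `F(I)` supported in `[-b, b]` has a representative on the line. -/
theorem exists_fBound (hb : b < a) (hf : f ∈ FI a F) (hs : SuppIn f (Icc (-b) b)) :
    normF a F f < ⊤ ∧ ∃ ψ : ℝ → ℂ, f =ᵐ[volume.restrict (Ioo (-a) a)] ψ ∧
      ∀ B : ℝ, 0 ≤ B → normF a F f ≤ ENNReal.ofReal B → FBound F b ψ B := by
  cases F with
  | Lp r hr =>
    have hf' : MemLp f r (volume.restrict (Ioo (-a) a)) := hf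
    refine ⟨hf'.2, cut b f, hs.ae_eq_cut, fun B hB h => ⟨hB, vanishesOff_cut b f, ?_, ?_⟩⟩
    · exact (aestronglyMeasurable_indicator_iff measurableSet_Icc).2
        (hf'.1.mono_measure (Measure.restrict_mono (Icc_subset_Ioo_of_lt hb) le_rfl))
    · rw [cut, eLpNorm_indicator_eq_eLpNorm_restrict measurableSet_Icc]
      exact (eLpNorm_mono_measure f (Measure.restrict_mono (Icc_subset_Ioo_of_lt hb) le_rfl)).trans h
  | Ck k =>
    obtain ⟨g, hg⟩ := hf
    have hU : IsOpen (Ioo (-a) a \ Icc (-b) b) := isOpen_Ioo.sdiff isClosed_Icc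
    -- By continuity the representative vanishes everywhere off `[-b, b]`, so it extends smoothly by
    -- zero.
    have h0 : EqOn g 0 (Ioo (-a) a \ Icc (-b) b) := by
      refine Measure.eqOn_open_of_ae_eq (μ := volume) ?_ hU
        (hg.1.continuousOn.mono sdiff_subset) continuousOn_const
      filter_upwards [ae_restrict_of_ae_restrict_of_subset sdiff_subset hg.2,
        ae_restrict_of_ae_restrict_of_subset sdiff_subset hs,
        ae_restrict_mem hU.measurableSet] with x h1 h2 h3
      rw [← h1, h2 h3.2]; rfl
    have heq : EqOn g (cut b g) (Ioo (-a) a) := fun x hx => by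
      by_cases hxb : x ∈ Icc (-b) b
      · exact (indicator_of_mem hxb g).symm
      · rw [h0 ⟨hx, hxb⟩, vanishesOff_cut b g x hxb]; rfl
    have hrep : IsCkRep k f (cut b g) :=
      ⟨hg.1.congr heq.symm, hg.2.trans ((ae_restrict_iff' measurableSet_Ioo).2
        (Filter.Eventually.of_forall fun x hx => heq hx))⟩
    have hcd : ContDiff ℝ k (cut b g) :=
      contDiff_of_contDiffOn_of_vanishesOff hb hrep.1 (vanishesOff_cut b g)
    have hvan : ∀ j, VanishesOff b (iteratedDeriv j (cut b g)) := fun j => by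
      induction j with
      | zero => rw [iteratedDeriv_zero]; exact vanishesOff_cut b g
      | succ j ih => rw [iteratedDeriv_succ]; exact ih.deriv
    have hpt : ∀ j ∈ Finset.range (k + 1), ∀ x,
        ‖iteratedDeriv j (cut b g) x‖ₑ ≤ normF a (.Ck k) f := fun j hj x => by
      by_cases hx : x ∈ Icc (-b) b
      · rw [hrep.normF_eq]
        refine le_trans ?_ (Finset.single_le_sum (f := fun j => ⨆ x ∈ Ioo (-a) a,
          ‖iteratedDerivWithin j (cut b g) (Ioo (-a) a) x‖ₑ) (fun _ _ => zero_le) hj)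
        have hxa := Icc_subset_Ioo_of_lt hb hx
        rw [← iteratedDerivWithin_of_isOpen isOpen_Ioo hxa]
        exact le_iSup₂ (f := fun x (_ : x ∈ Ioo (-a) a) =>
          ‖iteratedDerivWithin j (cut b g) (Ioo (-a) a) x‖ₑ) x hxa
      · rw [hvan j x hx, enorm_zero]; exact zero_le
    refine ⟨?_, cut b g, hrep.2, fun B hB h => ⟨hB, vanishesOff_cut b g, hcd, fun j hj x => ?_⟩⟩
    · rw [hrep.normF_eq]
      refine ENNReal.sum_lt_top.2 fun j hj => ?_
      have hj' : j ≤ k := by simpa [Nat.lt_succ_iff] using hj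
      obtain ⟨A, hA0, hA⟩ := exists_norm_le_of_vanishesOff
        (hcd.continuous_iteratedDeriv j (by exact_mod_cast hj')) (hvan j)
      refine lt_of_le_of_lt (iSup₂_le fun x hx => ?_) (ENNReal.ofReal_lt_top (r := A))
      rw [iteratedDerivWithin_of_isOpen isOpen_Ioo hx, ← ofReal_norm]
      exact ENNReal.ofReal_le_ofReal (hA x)
    · have := (hpt j (by simpa [Nat.lt_succ_iff] using hj) x).trans h
      rw [← ofReal_norm] at this
      exact (ENNReal.ofReal_le_ofReal_iff hB).1 this

theorem MemFloc.integrableOn (hq : MemFloc a F q) {r : ℝ} (hr : r < a) :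
    IntegrableOn q (Icc (-r) r) := by
  cases F with
  | Lp p hp =>
    exact memLp_one_iff_integrable.1
      ((hq _ isCompact_Icc (Icc_subset_Ioo_of_lt hr)).mono_exponent hp)
  | Ck k =>
    exact (ContDiffOn.continuousOn hq |>.mono (Icc_subset_Ioo_of_lt hr)).integrableOn_Icc

theorem exists_cutoff (hb0 : 0 < b) (hb : b < a) : ∃ c, c < a ∧ ∃ χ : ℝ → ℂ, ContDiff ℝ ∞ χ ∧
    VanishesOff c χ ∧ ∀ x ∈ Icc (-b) b, χ x = 1 := by
  let χ : ContDiffBump (0 : ℝ) := ⟨b, (b + a) / 2, hb0, by linarith⟩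
  refine ⟨(b + a) / 2, by linarith, fun x => (χ x : ℂ),
    Complex.ofRealCLM.contDiff.comp χ.contDiff, fun x hx => ?_, fun x hx => ?_⟩
  · show (χ x : ℂ) = 0
    rw [χ.zero_of_le_dist, Complex.ofReal_zero]
    rw [Real.dist_0_eq_abs]
    by_contra h
    exact hx (abs_le.1 (not_le.1 h).le)
  · show (χ x : ℂ) = 1
    rw [χ.one_of_mem_closedBall, Complex.ofReal_one]
    rw [mem_closedBall_zero_iff]
    exact abs_le.2 hx

/-- Truncation preserves `L^p`; to stay in `C^k` a smooth cutoff is used instead. -/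
theorem MemFloc.exists_global (hq : MemFloc a F q) (hb0 : 0 < b) (hb : b < a) :
    ∃ p, Integrable p ∧ GlobalMem F p ∧ ∀ s ∈ Icc (-b) b, p s = q s := by
  cases F with
  | Lp r hr =>
    refine ⟨cut b q, (integrable_indicator_iff measurableSet_Icc).2 (hq.integrableOn hb),
      (memLp_indicator_iff_restrict measurableSet_Icc).2
        (hq _ isCompact_Icc (Icc_subset_Ioo_of_lt hb)), fun s hs => indicator_of_mem hs q⟩
  | Ck k =>
    obtain ⟨c, hc, χ, hχ, hχs, hχ1⟩ := exists_cutoff hb0 hb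
    have hs : VanishesOff c (χ * q) := fun x hx => by
      rw [Pi.mul_apply, hχs x hx, zero_mul]
    have hd : ContDiff ℝ k (χ * q) := contDiff_of_contDiffOn_of_vanishesOff hc
      (((hχ.of_le (by exact_mod_cast le_top)).contDiffOn).mul hq) hs
    exact ⟨χ * q, hs.integrable hd.continuous, hd, fun s h => by
      rw [Pi.mul_apply, hχ1 s h, one_mul]⟩

/-- A compactly supported element of `W²(I; F)` is a twofold primitive. -/
theorem exists_fBound_of_mem_W2I (hb0 : 0 < b) (hb : b < a) (hf : f ∈ W2I a F)
    (hs : SuppIn f (Icc (-b) b)) :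
    normW2 a F f < ⊤ ∧ ∃ ψ : ℝ → ℂ, f =ᵐ[volume.restrict (Ioo (-a) a)] prim b (prim b ψ) ∧
      Integrable ψ ∧ VanishesOff b (prim b ψ) ∧ VanishesOff b (prim b (prim b ψ)) ∧
      (∀ g : AEFun a, HasWeakDeriv2 f g → g =ᵐ[volume.restrict (Ioo (-a) a)] ψ) ∧
      ∀ B : ℝ, 0 ≤ B → normW2 a F f ≤ ENNReal.ofReal B → FBound F b ψ B := by
  obtain ⟨χ, g, h1, h2, h3, h4, h5⟩ := hf
  have hχs := h1.suppIn hs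
  have hgs := h2.suppIn hχs
  obtain ⟨hfin, ψ, hψe, hψ⟩ := exists_fBound hb h5 hgs
  have hpair : normW2 a F f = normF a (.Lp 1 le_rfl) f + normF a (.Lp 1 le_rfl) χ + normF a F g := by
    refine le_antisymm (iInf₂_le (χ, g) ⟨h1, h2⟩) (le_iInf₂ fun p hp => le_of_eq ?_)
    obtain ⟨χ', g'⟩ := p
    obtain ⟨h1', h2'⟩ := hp
    dsimp only at h1' h2' ⊢
    obtain rfl := h1.unique h1'
    obtain rfl := h2.unique h2'
    rfl
  have hψF : FBound F b ψ (normF a F g).toReal :=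
    hψ _ ENNReal.toReal_nonneg (ENNReal.ofReal_toReal hfin.ne).ge
  have hψs := hψF.vanishesOff
  have hψi := hψF.integrable hb0.le
  obtain ⟨p1, v1⟩ := h1.ae_eq_prim hb0 hb hs
  obtain ⟨p2, v2⟩ := h2.ae_eq_prim hb0 hb hχs
  have e2 : cut b g =ᵐ[volume] ψ := ae_eq_of_vanishesOff hb (vanishesOff_cut b g) hψs
    (hgs.ae_eq_cut.symm.trans hψe)
  have e2' : prim b (cut b g) = prim b ψ := prim_congr_ae e2
  rw [e2'] at p2 v2
  have e1 : cut b χ =ᵐ[volume] prim b ψ := ae_eq_of_vanishesOff hb (vanishesOff_cut b χ) v2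
    (hχs.ae_eq_cut.symm.trans p2)
  have e1' : prim b (cut b χ) = prim b (prim b ψ) := prim_congr_ae e1
  rw [e1'] at p1 v1
  refine ⟨?_, ψ, p1, hψi, v2, v1, fun g' hg' => ?_, fun B hB h => hψ B hB (le_trans ?_ h)⟩
  · rw [hpair]
    exact ENNReal.add_lt_top.2 ⟨ENNReal.add_lt_top.2
      ⟨(show MemLp f 1 _ from h3).2, (show MemLp χ 1 _ from h4).2⟩, hfin⟩
  · rw [HasWeakDeriv2.unique hg' ⟨χ, h1, h2⟩]
    exact hψe
  · rw [hpair]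
    exact le_add_self

/-- The class on `I` of a function on the line. -/
def mkClass (a : ℝ) (f : ℝ → ℂ) (hf : AEStronglyMeasurable f) : AEFun a :=
  AEEqFun.mk f hf.restrict

theorem mkClass_ae_eq {f : ℝ → ℂ} (hf : AEStronglyMeasurable f) :
    mkClass a f hf =ᵐ[volume.restrict (Ioo (-a) a)] f := AEEqFun.coeFn_mk f _

theorem suppIn_of_ae_eq (h : f =ᵐ[volume.restrict (Ioo (-a) a)] ψ) (hs : VanishesOff b ψ) :
    SuppIn f (Icc (-b) b) := by
  filter_upwards [h] with x hx hxb
  rw [hx, hs x hxb]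

/-- Twofold primitives of functions bounded in `F` belong to `W²(I; F)`. -/
theorem exists_normW2_le (ha : 0 < a) (F : FunctionClass) (hb : 0 ≤ b) : ∃ C : ℝ, 0 ≤ C ∧
    ∀ (f : AEFun a) (ψ : ℝ → ℂ) (B : ℝ),
      f =ᵐ[volume.restrict (Ioo (-a) a)] prim b (prim b ψ) → FBound F b ψ B →
      VanishesOff b (prim b (prim b ψ)) →
      f ∈ W2I a F ∧ normW2 a F f ≤ ENNReal.ofReal (C * B) ∧
        ∀ g : AEFun a, g =ᵐ[volume.restrict (Ioo (-a) a)] ψ → HasWeakDeriv2 f g := by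
  obtain ⟨C₁, hC₁, h₁⟩ := exists_prim_prim F hb
  obtain ⟨C₂, hC₂, h₂⟩ := exists_fBound_Lp b 1 le_rfl
  obtain ⟨C₃, hC₃, h₃⟩ := exists_normF_le a F
  obtain ⟨C₄, hC₄, h₄⟩ := exists_normF_le a (.Lp 1 le_rfl)
  refine ⟨C₄ * (C₂ * C₁) + C₄ * (C₂ * C₁) + C₃, by positivity, fun f ψ B hf hψ hs => ?_⟩
  have hB := hψ.nonneg
  obtain ⟨-, b1, b2⟩ := h₁ ψ B hψ hs
  have hψi := hψ.integrable hb
  have hpc := continuous_prim (b := b) hψi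
  have hps : VanishesOff b (prim b ψ) := hs.of_hasDerivAt (hasDerivAt_prim hpc)
  have hχ := mkClass_ae_eq (a := a) hpc.aestronglyMeasurable
  have hg := mkClass_ae_eq (a := a) hψi.aestronglyMeasurable
  have d1 : HasWeakDeriv f (mkClass a _ hpc.aestronglyMeasurable) :=
    hasWeakDeriv_prim (b := b) ha (hps.integrable hpc) hf hχ
  have d2 := fun (g : AEFun a) (hg : g =ᵐ[volume.restrict (Ioo (-a) a)] ψ) =>
    hasWeakDeriv_prim (b := b) ha hψi hχ hg
  obtain ⟨m1, n1⟩ := h₄ b f _ _ hf (h₂ _ _ (by positivity) hs (continuous_prim_prim hψi) b1)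
  obtain ⟨m2, n2⟩ := h₄ b _ _ _ hχ (h₂ _ _ (by positivity) hps hpc b2)
  obtain ⟨m3, n3⟩ := h₃ b _ _ _ hg hψ
  refine ⟨⟨_, _, d1, d2 _ hg, m1, m2, m3⟩, ?_, fun g hg => ⟨_, d1, d2 g hg⟩⟩
  refine (iInf₂_le (_, _) ⟨d1, d2 _ hg⟩).trans ?_
  rw [add_mul, add_mul, ENNReal.ofReal_add (by positivity) (by positivity),
    ENNReal.ofReal_add (by positivity) (by positivity), mul_assoc C₄, mul_assoc C₂]
  exact add_le_add (add_le_add n1 n2) n3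

end Representatives

/-! ### The transpose of the Volterra operator -/

section Transpose

variable {F : FunctionClass} {a b : ℝ} {f g : AEFun a} {q ψ φ : ℝ → ℂ} {K : ℝ → ℝ → ℂ}
  {M : ℝ × ℝ → ℂ}

/-- On every square `[-b, b]²` inside `I × I` the kernel `K` comes from a potential of class `F`
on the line that agrees with `q` on `[-b, b]`. -/
def IsModelKernel (a : ℝ) (F : FunctionClass) (q : ℝ → ℂ) (K : ℝ → ℝ → ℂ) : Prop :=
  ∀ b, 0 < b → b < a → ∃ p G, IsGlobalSolution F p G ∧ (∀ s ∈ Icc (-b) b, p s = q s) ∧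
    ∀ t ∈ Icc (-b) b, ∀ x ∈ Icc (-b) b, K t x = planeKernel G (t, x)

theorem MemFloc.exists_isModelKernel (hq : MemFloc a F q) :
    ∃ H : ℝ → ℝ → ℂ, IsGoursatSolution a q H ∧
      (∀ H' : ℝ → ℝ → ℂ, IsGoursatSolution a q H' →
        ∀ u v : ℝ, |u| + |v| < a → H' u v = H u v) ∧ IsModelKernel a F q (kernel H) := by
  obtain ⟨H, h1, h2, h3⟩ := exists_goursatSolution fun r hr => hq.integrableOn hr
  refine ⟨H, h1, h2, fun b hb0 hb => ?_⟩
  obtain ⟨p, hpi, hpm, hpq⟩ := hq.exists_global hb0 hb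
  obtain ⟨G, hG, hGe⟩ := exists_global_goursat hpi
  exact ⟨p, G, ⟨hpi, hpm, hG, hGe⟩, hpq, fun t ht x hx =>
    h3 b hb p hpi hpq G hG hGe _ (mem_diamond_planeKernel ht hx)⟩

/-- Beyond `[-b, b]` the function vanishes, so the limits `±a` may be replaced by `±b`. Where the
integrand is not zero, `|x| ≤ |t| ≤ b`, so only the values of `K` on `[-b, b]²` are used. -/
theorem volterraTranspose_apply (hb : b < a) (hM : Continuous M)
    (hK : ∀ t ∈ Icc (-b) b, ∀ x ∈ Icc (-b) b, K t x = M (t, x))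
    (h : f =ᵐ[volume.restrict (Ioo (-a) a)] ψ) (hψ : Integrable ψ) (hs : VanishesOff b ψ)
    {x : ℝ} (hx : x ∈ Ioo (-a) a) :
    volterraTranspose a K f x = f x + skew b M ψ x := by
  have hxa : |x| < a := abs_lt.2 hx
  have h' := (ae_restrict_iff' measurableSet_Ioo).1 h
  have key : ∀ t, (t ∈ Ioo (-a) a → f t = ψ t) → t ∈ Ioo (-a) a → |x| ≤ |t| →
      K t x * f t = ψ t * M (t, x) := fun t h1 h2 h3 => by
    rw [h1 h2]
    by_cases htb : t ∈ Icc (-b) b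
    · rw [hK t htb x (abs_le.1 (h3.trans (abs_le.2 htb))), mul_comm]
    · rw [hs t htb, mul_zero, zero_mul]
  have e1 : ∫ t in |x|..a, K t x * f t = ∫ t in |x|..b, ψ t * M (t, x) := by
    have z : ∫ t in b..a, ψ t * M (t, x) = 0 := by
      refine intervalIntegral.integral_zero_ae (Filter.Eventually.of_forall fun t ht => ?_)
      rw [uIoc_of_le hb.le] at ht
      rw [hs t fun h => absurd h.2 (not_le.2 ht.1), zero_mul]
    rw [← add_zero (∫ t in |x|..b, ψ t * M (t, x)), ← z,
      intervalIntegral.integral_add_adjacent_intervals (intervalIntegrable_mul_kernel hM hψ x _ _)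
        (intervalIntegrable_mul_kernel hM hψ x _ _)]
    refine intervalIntegral.integral_congr_ae ?_
    filter_upwards [h', Measure.ae_ne volume a] with t ht hta htx
    rw [uIoc_of_le hxa.le] at htx
    have ht0 : 0 ≤ t := (abs_nonneg x).trans htx.1.le
    exact key t ht ⟨by linarith [htx.1, abs_nonneg x], lt_of_le_of_ne htx.2 hta⟩
      (htx.1.le.trans (le_abs_self t))
  have e2 : ∫ t in (-a)..(-|x|), K t x * f t = ∫ t in (-b)..(-|x|), ψ t * M (t, x) := by
    have z : ∫ t in (-a)..(-b), ψ t * M (t, x) = 0 := by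
      refine intervalIntegral.integral_zero_ae ?_
      filter_upwards [Measure.ae_ne volume (-b)] with t hne ht
      rw [uIoc_of_le (neg_le_neg hb.le)] at ht
      rw [hs t fun h => hne (le_antisymm ht.2 h.1), zero_mul]
    rw [← zero_add (∫ t in (-b)..(-|x|), ψ t * M (t, x)), ← z,
      intervalIntegral.integral_add_adjacent_intervals (intervalIntegrable_mul_kernel hM hψ x _ _)
        (intervalIntegrable_mul_kernel hM hψ x _ _)]
    refine intervalIntegral.integral_congr_ae ?_
    filter_upwards [h'] with t ht htx
    rw [uIoc_of_le (neg_le_neg hxa.le)] at htx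
    exact key t ht ⟨htx.1, by linarith [htx.2, abs_nonneg x]⟩
      ((le_neg_of_le_neg htx.2).trans (neg_le_abs t))
  rw [volterraTranspose, e1, e2, skew_eq_abs hM hψ]
  ring

theorem volterraTranspose_ae_eq (hb : b < a) (hM : Continuous M)
    (hK : ∀ t ∈ Icc (-b) b, ∀ x ∈ Icc (-b) b, K t x = M (t, x))
    (h : f =ᵐ[volume.restrict (Ioo (-a) a)] ψ) (hψ : Integrable ψ) (hs : VanishesOff b ψ) :
    volterraTranspose a K f =ᵐ[volume.restrict (Ioo (-a) a)] ψ + skew b M ψ := by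
  filter_upwards [h, ae_restrict_mem measurableSet_Ioo] with x hx hxI
  rw [volterraTranspose_apply hb hM hK h hψ hs hxI, hx, Pi.add_apply]

theorem volterraTransposeGraph_unique {f' : AEFun a} (h : VolterraTransposeGraph K g f)
    (h' : VolterraTransposeGraph K g f') : f = f' :=
  AEEqFun.ext (h.trans h'.symm)

/-- Locally integrable classes with support in `[-b, b]` for some `b < a`. -/
structure IsCarried (b : ℝ) (f : AEFun a) : Prop where
  pos : 0 < b
  lt : b < a
  locallyIntegrableOn : LocallyIntegrableOn f (Ioo (-a) a)
  suppIn : SuppIn f (Icc (-b) b)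

theorem IsCarried.mono {b' : ℝ} (h : IsCarried b f) (hb : b ≤ b') (hb' : b' < a) :
    IsCarried b' f :=
  ⟨h.pos.trans_le hb, hb', h.3, h.4.mono (Icc_subset_Icc (neg_le_neg hb) hb)⟩

theorem IsCarried.exists_common {b' : ℝ} (h : IsCarried b f) (h' : IsCarried b' g) :
    ∃ c, IsCarried c f ∧ IsCarried c g :=
  ⟨max b b', h.mono (le_max_left _ _) (max_lt h.lt h'.lt),
    h'.mono (le_max_right _ _) (max_lt h.lt h'.lt)⟩

theorem IsCarried.integrable_cut (h : IsCarried b f) : Integrable (cut b f) :=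
  Transmutation.integrable_cut h.lt h.3

theorem IsCarried.volterraTranspose_ae_eq (h : IsCarried b f) (hM : Continuous M)
    (hK : ∀ t ∈ Icc (-b) b, ∀ x ∈ Icc (-b) b, K t x = M (t, x)) :
    volterraTranspose a K f =ᵐ[volume.restrict (Ioo (-a) a)] cut b f + skew b M (cut b f) :=
  Transmutation.volterraTranspose_ae_eq h.lt hM hK h.suppIn.ae_eq_cut h.integrable_cut
    (vanishesOff_cut b f)

theorem skew_smul (c : ℂ) (ψ : ℝ → ℂ) (x : ℝ) : skew b M (c • ψ) x = c * skew b M ψ x := by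
  simp only [skew, Pi.smul_apply, smul_eq_mul, mul_assoc, intervalIntegral.integral_const_mul,
    mul_sub]

/-- Linearity is checked through `skew` on a common interval, where the integrands are known to be
integrable. -/
theorem IsModelKernel.graph_add (hK : IsModelKernel a F q K) {f' g' : AEFun a} {b b' : ℝ}
    (hf : IsCarried b f) (hf' : IsCarried b' f') (h : VolterraTransposeGraph K f g)
    (h' : VolterraTransposeGraph K f' g') : VolterraTransposeGraph K (f + f') (g + g') := by
  obtain ⟨c, h1, h2⟩ := hf.exists_common hf'
  obtain ⟨p, G, hG, -, hKG⟩ := hK c h1.pos h1.lt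
  have hM := continuous_planeKernel hG.continuous
  have e : ⇑(f + f') =ᵐ[volume.restrict (Ioo (-a) a)] cut c f + cut c f' :=
    (AEEqFun.coeFn_add f f').trans (h1.suppIn.ae_eq_cut.add h2.suppIn.ae_eq_cut)
  have e3 := Transmutation.volterraTranspose_ae_eq h1.lt hM hKG e
    (h1.integrable_cut.add h2.integrable_cut) ((vanishesOff_cut c f).add (vanishesOff_cut c f'))
  have e1 := h1.volterraTranspose_ae_eq hM hKG
  have e2 := h2.volterraTranspose_ae_eq hM hKG
  unfold VolterraTransposeGraph at h h' ⊢
  filter_upwards [AEEqFun.coeFn_add g g', h, h', e1, e2, e3] with x y1 y2 y3 y4 y5 y6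
  rw [y1, y6, Pi.add_apply, y2, y3, y4, y5]
  simp only [Pi.add_apply]
  rw [skew_add hM h1.integrable_cut h2.integrable_cut]
  ring

theorem IsModelKernel.graph_smul (hK : IsModelKernel a F q K) (c : ℂ)
    (hf : IsCarried b f) (h : VolterraTransposeGraph K f g) :
    VolterraTransposeGraph K (c • f) (c • g) := by
  obtain ⟨p, G, hG, -, hKG⟩ := hK b hf.pos hf.lt
  have hM := continuous_planeKernel hG.continuous
  have e : ⇑(c • f) =ᵐ[volume.restrict (Ioo (-a) a)] c • cut b f :=
    (AEEqFun.coeFn_smul c f).trans (hf.suppIn.ae_eq_cut.const_smul c)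
  have e3 := Transmutation.volterraTranspose_ae_eq hf.lt hM hKG e (hf.integrable_cut.smul c)
    (fun x hx => by rw [Pi.smul_apply, vanishesOff_cut b f x hx, smul_zero])
  have e1 := hf.volterraTranspose_ae_eq hM hKG
  unfold VolterraTransposeGraph at h ⊢
  filter_upwards [AEEqFun.coeFn_smul c g, h, e1, e3] with x y1 y2 y3 y4
  rw [y1, y4, Pi.smul_apply, y2, y3]
  simp only [Pi.add_apply, Pi.smul_apply, smul_eq_mul]
  rw [skew_smul]
  ring

/-- The difference `u` satisfies `u + Su = 0` almost everywhere, so it agrees almost everywhere with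
the continuous function `-Su`. That function solves the homogeneous equation at every point, and the
a priori bound with `ε = 0` makes it zero. -/
theorem IsModelKernel.graph_injective (hK : IsModelKernel a F q K) {f' : AEFun a} {b b' : ℝ}
    (hf : IsCarried b f) (hf' : IsCarried b' f') (h : VolterraTransposeGraph K f g)
    (h' : VolterraTransposeGraph K f' g) : f = f' := by
  obtain ⟨c, h1, h2⟩ := hf.exists_common hf'
  obtain ⟨p, G, hG, -, hKG⟩ := hK c h1.pos h1.lt
  have hM := continuous_planeKernel hG.continuous
  have e1 := h1.volterraTranspose_ae_eq hM hKG
  have e2 := h2.volterraTranspose_ae_eq hM hKG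
  have hi1 := h1.integrable_cut
  have hi2 := h2.integrable_cut
  set u := cut c f - cut c f'
  set v := skew c (planeKernel G) u
  have hui : Integrable u := hi1.sub hi2
  have hus : VanishesOff c u := fun x hx => by
    simp only [u, Pi.sub_apply, vanishesOff_cut c _ x hx, sub_self]
  have hvs := vanishesOff_skew hM hui hus
  have hvi := hvs.integrable (continuous_skew hM hui)
  have huv : u =ᵐ[volume] -v := by
    refine ae_eq_of_vanishesOff h1.lt hus
      (fun x hx => neg_eq_zero.2 (hvs x hx)) ?_
    filter_upwards [h, h', e1, e2] with x y1 y2 y3 y4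
    have y5 : (cut c f + skew c (planeKernel G) (cut c f)) x =
      (cut c f' + skew c (planeKernel G) (cut c f')) x := by rw [← y3, ← y4, ← y1, ← y2]
    simp only [Pi.add_apply] at y5
    simp only [u, v, Pi.neg_apply, Pi.sub_apply]
    rw [skew_sub hM hi1 hi2]
    linear_combination y5
  obtain ⟨A, hA0, hA⟩ := exists_kernel_bound hM c
  have hz : ∀ x, (-v) x = 0 := fun x => by
    have := norm_le_of_add_skew_of_vanishesOff (ε := 0) (g := 0) h1.pos.le hM hvi.neg
      (fun x hx => neg_eq_zero.2 (hvs x hx)) hA (fun x _ => by simp)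
      (fun x _ => by rw [← skew_congr_ae huv x]; simp) x
    rw [mul_zero] at this
    exact norm_le_zero_iff.1 this
  refine AEEqFun.ext ?_
  filter_upwards [h1.suppIn.ae_eq_cut, h2.suppIn.ae_eq_cut,
    ae_restrict_of_ae huv] with x y1 y2 y3
  rw [hz x] at y3
  rw [y1, y2]
  exact sub_eq_zero.1 y3

end Transpose

/-! ### Operators between spaces of compactly supported functions -/

namespace CSpace

variable {a b : ℝ} {X Y : Submodule ℂ (AEFun a)} {N L : AEFun a → ℝ≥0∞}

theorem exists_toAEFun_eq (hb : b < a) {f : AEFun a} (hf : f ∈ X) (hs : SuppIn f (Icc (-b) b)) :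
    ∃ φ : CSpace X N, φ.toAEFun = f :=
  ⟨⟨f, hf, _, isCompact_Icc, Icc_subset_Ioo_of_lt hb, hs⟩, rfl⟩

theorem exists_continuousLinearMap_of_bound (ha : 0 < a) (R : AEFun a → AEFun a → Prop)
    (hfun : ∀ (φ : CSpace X N) (ψ ψ' : CSpace Y L), R φ.toAEFun ψ.toAEFun →
      R φ.toAEFun ψ'.toAEFun → ψ.toAEFun = ψ'.toAEFun)
    (hadd : ∀ (φ φ' : CSpace X N) (ψ ψ' : CSpace Y L), R φ.toAEFun ψ.toAEFun →
      R φ'.toAEFun ψ'.toAEFun → R (φ.toAEFun + φ'.toAEFun) (ψ.toAEFun + ψ'.toAEFun))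
    (hsmul : ∀ (c : ℂ) (φ : CSpace X N) (ψ : CSpace Y L), R φ.toAEFun ψ.toAEFun →
      R (c • φ.toAEFun) (c • ψ.toAEFun))
    (hfin : ∀ φ : CSpace X N, N φ.toAEFun < ⊤)
    (hbd : ∀ b, 0 < b → b < a → ∃ C : ℝ, 0 ≤ C ∧ ∀ f ∈ X, SuppIn f (Icc (-b) b) →
      ∀ B : ℝ, 0 ≤ B → N f ≤ ENNReal.ofReal B →
      ∃ g ∈ Y, SuppIn g (Icc (-b) b) ∧ R f g ∧ L g ≤ ENNReal.ofReal (C * B)) :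
    ∃ T : CSpace X N →L[ℂ] CSpace Y L, ∀ φ, R φ.toAEFun (T φ).toAEFun := by
  refine exists_continuousLinearMap ha R hfun hadd hsmul hfin fun b hb0 hb => ?_
  obtain ⟨C, hC, h⟩ := hbd b hb0 hb
  refine ⟨C.toNNReal, fun φ hφ B hB => ?_⟩
  obtain ⟨g, hg, hgs, hR, hL⟩ := h φ.toAEFun φ.2.1 hφ B B.2
    (by rwa [ENNReal.ofReal_coe_nnreal])
  obtain ⟨ψ, rfl⟩ := exists_toAEFun_eq (N := L) hb hg hgs
  refine ⟨ψ, hgs, hR, hL.trans (le_of_eq ?_)⟩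
  rw [ENNReal.ofReal_mul hC, ENNReal.ofReal_coe_nnreal, ENNReal.coe_mul]
  rfl

theorem isTransposeOf_weakDualPrecomp {R : AEFun a → AEFun a → Prop}
    (hfun : ∀ (φ : CSpace X N) (ψ ψ' : CSpace Y L), R φ.toAEFun ψ.toAEFun →
      R φ.toAEFun ψ'.toAEFun → ψ.toAEFun = ψ'.toAEFun)
    (T : CSpace X N →L[ℂ] CSpace Y L) (hT : ∀ φ, R φ.toAEFun (T φ).toAEFun)
    (A : WeakDual ℂ (CSpace Y L) → WeakDual ℂ (CSpace X N)) (hA : ∀ u φ, A u φ = u (T φ)) :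
    IsTransposeOf A R := by
  refine ⟨fun φ => ⟨T φ, hT φ⟩, fun u φ ψ h => ?_⟩
  rw [hA, toAEFun_injective (hfun φ _ _ (hT φ) h)]

end CSpace

section Operators

variable {F : FunctionClass} {a b B : ℝ} {f g : AEFun a} {q p ψ φ : ℝ → ℂ} {K : ℝ → ℝ → ℂ}
  {G : ℝ × ℝ → ℂ}

theorem isCarried_of_mem_FI (hb0 : 0 < b) (hb : b < a) (hf : f ∈ FI a F)
    (hs : SuppIn f (Icc (-b) b)) : IsCarried b f := by
  obtain ⟨hfin, ψ, h1, h2⟩ := exists_fBound hb hf hs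
  have hψ := h2 _ ENNReal.toReal_nonneg (ENNReal.ofReal_toReal hfin.ne).ge
  exact ⟨hb0, hb, locallyIntegrableOn_of_ae_eq (hψ.integrable hb0.le).locallyIntegrable h1, hs⟩

theorem isCarried_of_mem_W2I (hb0 : 0 < b) (hb : b < a) (hf : f ∈ W2I a F)
    (hs : SuppIn f (Icc (-b) b)) : IsCarried b f := by
  obtain ⟨χ, g, h1, -⟩ := hf
  exact ⟨hb0, hb, h1.left, hs⟩

theorem Fc.exists_isCarried (ha : 0 < a) (φ : Fc a F) : ∃ b, IsCarried b φ.toAEFun := by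
  obtain ⟨b, hb0, hb, hs⟩ := CSpace.exists_suppIn_Icc ha φ
  exact ⟨b, isCarried_of_mem_FI hb0 hb φ.2.1 hs⟩

theorem W2c.exists_isCarried (ha : 0 < a) (φ : W2c a F) : ∃ b, IsCarried b φ.toAEFun := by
  obtain ⟨b, hb0, hb, hs⟩ := CSpace.exists_suppIn_Icc ha φ
  exact ⟨b, isCarried_of_mem_W2I hb0 hb φ.2.1 hs⟩

theorem Fc.normF_lt_top (ha : 0 < a) (φ : Fc a F) : normF a F φ.toAEFun < ⊤ := by
  obtain ⟨b, hb0, hb, hs⟩ := CSpace.exists_suppIn_Icc ha φ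
  exact (exists_fBound hb φ.2.1 hs).1

theorem W2c.normW2_lt_top (ha : 0 < a) (φ : W2c a F) : normW2 a F φ.toAEFun < ⊤ := by
  obtain ⟨b, hb0, hb, hs⟩ := CSpace.exists_suppIn_Icc ha φ
  exact (exists_fBound_of_mem_W2I hb0 hb φ.2.1 hs).1

theorem exists_transpose_Fc (ha : 0 < a) (hK : IsModelKernel a F q K) :
    ∃ T : Fc a F →L[ℂ] Fc a F, ∀ φ, VolterraTransposeGraph K φ.toAEFun (T φ).toAEFun := by
  refine CSpace.exists_continuousLinearMap_of_bound ha (VolterraTransposeGraph K)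
    (fun _ _ _ => volterraTransposeGraph_unique)
    (fun φ φ' _ _ => ?_) (fun c φ _ => ?_) (Fc.normF_lt_top ha) fun b hb0 hb => ?_
  · obtain ⟨b, hb⟩ := Fc.exists_isCarried ha φ
    obtain ⟨b', hb'⟩ := Fc.exists_isCarried ha φ'
    exact hK.graph_add hb hb'
  · obtain ⟨b, hb⟩ := Fc.exists_isCarried ha φ
    exact hK.graph_smul c hb
  · obtain ⟨p, G, hG, -, hKG⟩ := hK b hb0 hb
    obtain ⟨C₁, hC₁, h₁⟩ := hG.exists_add_skew hb0.le
    obtain ⟨C₂, hC₂, h₂⟩ := exists_normF_le a F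
    refine ⟨C₂ * C₁, by positivity, fun f hf hs B hB hn => ?_⟩
    obtain ⟨-, ψ, hψ, hψB⟩ := exists_fBound hb hf hs
    have hψF := hψB B hB hn
    have hr := h₁ ψ B hψF
    have hc := mkClass_ae_eq (a := a) (hr.integrable hb0.le).aestronglyMeasurable
    obtain ⟨m, n⟩ := h₂ b _ _ _ hc hr
    refine ⟨_, m, suppIn_of_ae_eq hc hr.vanishesOff, ?_, by rwa [mul_assoc]⟩
    exact hc.trans (volterraTranspose_ae_eq hb (continuous_planeKernel hG.continuous) hKG hψ
      (hψF.integrable hb0.le) hψF.vanishesOff).symm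

/-- The inverse is built from the reversed graph: single-valuedness is the injectivity of `𝐓□`, and
the bound is that of `exists_solve`. -/
theorem exists_transpose_inv_Fc (ha : 0 < a) (hK : IsModelKernel a F q K) :
    ∃ T : Fc a F →L[ℂ] Fc a F, ∀ φ, VolterraTransposeGraph K (T φ).toAEFun φ.toAEFun := by
  refine CSpace.exists_continuousLinearMap_of_bound ha (fun f g => VolterraTransposeGraph K g f)
    (fun _ ψ ψ' => ?_) (fun _ _ ψ ψ' => ?_) (fun c _ ψ => ?_) (Fc.normF_lt_top ha)
    fun b hb0 hb => ?_
  · obtain ⟨b, hb⟩ := Fc.exists_isCarried ha ψ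
    obtain ⟨b', hb'⟩ := Fc.exists_isCarried ha ψ'
    exact hK.graph_injective hb hb'
  · obtain ⟨b, hb⟩ := Fc.exists_isCarried ha ψ
    obtain ⟨b', hb'⟩ := Fc.exists_isCarried ha ψ'
    exact hK.graph_add hb hb'
  · obtain ⟨b, hb⟩ := Fc.exists_isCarried ha ψ
    exact hK.graph_smul c hb
  · obtain ⟨p, G, hG, -, hKG⟩ := hK b hb0 hb
    obtain ⟨C₁, hC₁, h₁⟩ := hG.exists_solve hb0.le
    obtain ⟨C₂, hC₂, h₂⟩ := exists_normF_le a F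
    refine ⟨C₂ * C₁, by positivity, fun f hf hs B hB hn => ?_⟩
    obtain ⟨-, ψ, hψ, hψB⟩ := exists_fBound hb hf hs
    obtain ⟨η, hη, hηe⟩ := h₁ ψ B (hψB B hB hn)
    have hηi := hη.integrable hb0.le
    have hc := mkClass_ae_eq (a := a) hηi.aestronglyMeasurable
    obtain ⟨m, n⟩ := h₂ b _ _ _ hc hη
    refine ⟨_, m, suppIn_of_ae_eq hc hη.vanishesOff, ?_, by rwa [mul_assoc]⟩
    refine hψ.trans (Filter.EventuallyEq.symm ?_)
    refine (volterraTranspose_ae_eq hb (continuous_planeKernel hG.continuous) hKG hc hηi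
      hη.vanishesOff).trans (Filter.Eventually.of_forall hηe)

/-- The commutation relation for `φ = prim b (prim b ψ)`: the second derivative of `(1 + S)φ` is `(1
+ S)(φ'' - pφ)`, an expression controlled in `F`. -/
theorem IsGlobalSolution.add_skew_prim_prim (hG : IsGlobalSolution F p G) (hb : 0 ≤ b)
    (hψ : Integrable ψ) (hψs : VanishesOff b ψ) (hs : VanishesOff b (prim b (prim b ψ))) :
    prim b (prim b ψ) + skew b (planeKernel G) (prim b (prim b ψ)) =
      prim b (prim b ((ψ - p * prim b (prim b ψ)) +
        skew b (planeKernel G) (ψ - p * prim b (prim b ψ)))) := by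
  set φ := prim b (prim b ψ) with hφ
  have hφc : Continuous φ := continuous_prim_prim hψ
  have hpφ := integrable_mul_of_vanishesOff hG.integrable hφc hs
  have hM := continuous_planeKernel hG.continuous
  have hi := hψ.sub hpφ
  have hsk := vanishesOff_skew hM hi (hψs.sub (hs.mul_left p))
  have hski := hsk.integrable (continuous_skew hM hi)
  funext x
  rw [Pi.add_apply, skew_eq_prim_prim hb hG.integrable hG.continuous hG.eq hψ hψs hφ hs]
  have e := prim_prim_sub (b := b) hψ ((hpφ.sub hski)) x
  rw [show skew b (planeKernel G) (ψ - p * φ) - p * φ = -(p * φ - skew b (planeKernel G)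
    (ψ - p * φ)) by abel]
  rw [show ψ - p * φ + skew b (planeKernel G) (ψ - p * φ) = ψ - (p * φ - skew b (planeKernel G)
    (ψ - p * φ)) by abel, ← e]
  have e0 : ∀ u : ℝ → ℂ, prim b (-u) = -prim b u := fun u => by
    funext y; simp [prim]
  rw [e0, e0, Pi.neg_apply, hφ]
  ring

/-- The norm of `ψ - p ∬ψ`. -/
theorem IsGlobalSolution.exists_sub_mul (hG : IsGlobalSolution F p G) (hb : 0 ≤ b) :
    ∃ C : ℝ, 0 ≤ C ∧ ∀ ψ B, FBound F b ψ B → VanishesOff b (prim b (prim b ψ)) →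
      FBound F b (p * prim b (prim b ψ)) (C * B) := by
  obtain ⟨C₁, hC₁, h₁⟩ := exists_prim_prim F hb
  obtain ⟨C₂, hC₂, h₂⟩ := hG.mem.exists_mul b
  refine ⟨C₂ * C₁, by positivity, fun ψ B hψ hs => ?_⟩
  obtain ⟨k1, k2, -⟩ := h₁ ψ B hψ hs
  rw [mul_assoc]
  exact h₂ _ _ k1 (continuous_prim_prim (hψ.integrable hb)) k2

/-- By `add_skew_prim_prim` the second derivative of the image is `(1 + S)(φ'' - pφ)`, so bounds in
`F` for `1 + S` and for multiplication by `p` give the bound in `W²`. -/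
theorem exists_transpose_W2c (ha : 0 < a) (hK : IsModelKernel a F q K) :
    ∃ T : W2c a F →L[ℂ] W2c a F, ∀ φ, VolterraTransposeGraph K φ.toAEFun (T φ).toAEFun := by
  refine CSpace.exists_continuousLinearMap_of_bound ha (VolterraTransposeGraph K)
    (fun _ _ _ => volterraTransposeGraph_unique)
    (fun φ φ' _ _ => ?_) (fun c φ _ => ?_) (W2c.normW2_lt_top ha) fun b hb0 hb => ?_
  · obtain ⟨b, hb⟩ := W2c.exists_isCarried ha φ
    obtain ⟨b', hb'⟩ := W2c.exists_isCarried ha φ'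
    exact hK.graph_add hb hb'
  · obtain ⟨b, hb⟩ := W2c.exists_isCarried ha φ
    exact hK.graph_smul c hb
  · obtain ⟨p, G, hG, -, hKG⟩ := hK b hb0 hb
    obtain ⟨C₁, hC₁, h₁⟩ := hG.exists_add_skew hb0.le
    obtain ⟨C₂, hC₂, h₂⟩ := exists_normW2_le ha F hb0.le
    obtain ⟨C₃, hC₃, h₃⟩ := hG.exists_sub_mul hb0.le
    have hM := continuous_planeKernel hG.continuous
    refine ⟨C₂ * (C₁ * (1 + C₃)), by positivity, fun f hf hs B hB hn => ?_⟩
    obtain ⟨-, ψ, hψ, hψi, -, hφs, -, hψB⟩ := exists_fBound_of_mem_W2I hb0 hb hf hs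
    have hψF := hψB B hB hn
    have hr := h₁ _ _ (hψF.sub (h₃ ψ B hψF hφs))
    have he := hG.add_skew_prim_prim hb0.le hψi hψF.vanishesOff hφs
    have hφc := continuous_prim_prim (b := b) hψi
    have hφi := hφs.integrable hφc
    have hTs := hφs.add (vanishesOff_skew hM hφi hφs)
    have hc := mkClass_ae_eq (a := a)
      (hφc.add (continuous_skew (b := b) hM hφi)).aestronglyMeasurable
    obtain ⟨m, n, -⟩ := h₂ _ _ _ (by rw [← he]; exact hc) hr (by rw [← he]; exact hTs)
    refine ⟨_, m, suppIn_of_ae_eq hc hTs, ?_, n.trans (le_of_eq (by congr 1; ring))⟩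
    exact hc.trans (volterraTranspose_ae_eq hb hM hKG hψ hφi hφs).symm

/-- The preimage `φ` of `f` has second derivative `w + pφ`, where `w` is the preimage of `f''`. Both
preimages are bounded in `F`, and the supremum bound on `φ` needed for `pφ` is the a priori
estimate. -/
theorem exists_transpose_inv_W2c (ha : 0 < a) (hK : IsModelKernel a F q K) :
    ∃ T : W2c a F →L[ℂ] W2c a F, ∀ φ, VolterraTransposeGraph K (T φ).toAEFun φ.toAEFun := by
  refine CSpace.exists_continuousLinearMap_of_bound ha (fun f g => VolterraTransposeGraph K g f)
    (fun _ ψ ψ' => ?_) (fun _ _ ψ ψ' => ?_) (fun c _ ψ => ?_) (W2c.normW2_lt_top ha)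
    fun b hb0 hb => ?_
  · obtain ⟨b, hb⟩ := W2c.exists_isCarried ha ψ
    obtain ⟨b', hb'⟩ := W2c.exists_isCarried ha ψ'
    exact hK.graph_injective hb hb'
  · obtain ⟨b, hb⟩ := W2c.exists_isCarried ha ψ
    obtain ⟨b', hb'⟩ := W2c.exists_isCarried ha ψ'
    exact hK.graph_add hb hb'
  · obtain ⟨b, hb⟩ := W2c.exists_isCarried ha ψ
    exact hK.graph_smul c hb
  · obtain ⟨p, G, hG, -, hKG⟩ := hK b hb0 hb
    obtain ⟨C₁, hC₁, h₁⟩ := hG.exists_solve hb0.le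
    obtain ⟨C₂, hC₂, h₂⟩ := exists_normW2_le ha F hb0.le
    obtain ⟨C₃, hC₃, h₃⟩ := exists_prim_prim F hb0.le
    obtain ⟨C₄, hC₄, h₄⟩ := hG.mem.exists_mul b
    have hM := continuous_planeKernel hG.continuous
    obtain ⟨A, hA0, hA⟩ := exists_kernel_bound hM b
    have hV : 0 ≤ volterraConst b A := by unfold volterraConst; positivity
    refine ⟨C₂ * (C₁ + C₄ * (C₁ * C₃ + volterraConst b A * C₃)), by positivity,
      fun f hf hs B hB hn => ?_⟩
    obtain ⟨-, ψ, hψ, hψi, -, hfs, -, hψB⟩ := exists_fBound_of_mem_W2I hb0 hb hf hs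
    have hψF := hψB B hB hn
    obtain ⟨k1, k2, -⟩ := h₃ ψ B hψF hfs
    obtain ⟨φ, hφ, hφe⟩ := h₁ _ _ k1
    obtain ⟨w, hw, hwe⟩ := h₁ _ _ hψF
    have hφi := hφ.integrable hb0.le
    have hwi := hw.integrable hb0.le
    have hφs := hφ.vanishesOff
    have he := eq_prim_prim_of_add_skew hb0.le hG.integrable hG.continuous hG.eq hψi
      hψF.vanishesOff rfl hfs hφi hφs hφe hwi hw.vanishesOff hwe
    have hφc : Continuous φ := by
      have : φ = prim b (prim b ψ) - skew b (planeKernel G) φ :=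
        funext fun x => eq_sub_of_add_eq (hφe x)
      rw [this]
      exact (continuous_prim_prim hψi).sub (continuous_skew hM hφi)
    have hφn : ∀ x, ‖φ x‖ ≤ (C₁ * C₃ + volterraConst b A * C₃) * B := fun x => by
      refine (norm_le_of_add_skew_of_vanishesOff hb0.le hM hφi hφs hA (fun x _ => k2 x)
        (fun x _ => hφe x) x).trans ?_
      have : 0 ≤ C₁ * C₃ * B := by positivity
      nlinarith
    have hφ' : FBound F b φ ((C₁ * C₃ + volterraConst b A * C₃) * B) := hφ.mono (by
      have : 0 ≤ volterraConst b A * C₃ * B := by positivity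
      nlinarith)
    have hr := hw.add (h₄ _ _ hφ' hφc hφn)
    have hc := mkClass_ae_eq (a := a) hφc.aestronglyMeasurable
    obtain ⟨m, n, -⟩ := h₂ _ _ _ (by rw [← he]; exact hc) hr (by rw [← he]; exact hφs)
    refine ⟨_, m, suppIn_of_ae_eq hc hφs, ?_, n.trans (le_of_eq (by congr 1; ring))⟩
    refine hψ.trans (Filter.EventuallyEq.symm ?_)
    exact (volterraTranspose_ae_eq hb hM hKG hc hφi hφs).trans (Filter.Eventually.of_forall hφe)

/-- The continuous inclusion of `W²_c(I; F)` in `F_c(I)`, whose transpose restricts functionals. -/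
theorem exists_restriction (ha : 0 < a) (F : FunctionClass) :
    ∃ T : W2c a F →L[ℂ] Fc a F, ∀ φ, (T φ).toAEFun = φ.toAEFun := by
  refine CSpace.exists_continuousLinearMap_of_bound ha (fun f g => g = f)
    (fun _ _ _ h h' => h.trans h'.symm) (fun _ _ _ _ h h' => by rw [h, h'])
    (fun c _ _ h => by rw [h]) (W2c.normW2_lt_top ha) fun b hb0 hb => ?_
  obtain ⟨C₁, hC₁, h₁⟩ := exists_prim_prim F hb0.le
  obtain ⟨C₂, hC₂, h₂⟩ := exists_normF_le a F
  refine ⟨C₂ * C₁, by positivity, fun f hf hs B hB hn => ?_⟩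
  obtain ⟨-, ψ, hψ, -, -, hfs, -, hψB⟩ := exists_fBound_of_mem_W2I hb0 hb hf hs
  obtain ⟨m, n⟩ := h₂ b f _ _ hψ (h₁ ψ B (hψB B hB hn) hfs).1
  exact ⟨f, m, hs, rfl, by rwa [mul_assoc]⟩

theorem HasWeakDeriv2.add {f' g' : AEFun a} (h : HasWeakDeriv2 f g) (h' : HasWeakDeriv2 f' g') :
    HasWeakDeriv2 (f + f') (g + g') := by
  obtain ⟨χ, h1, h2⟩ := h
  obtain ⟨χ', h1', h2'⟩ := h'
  exact ⟨χ + χ', h1.add h1', h2.add h2'⟩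

theorem HasWeakDeriv2.smul (c : ℂ) (h : HasWeakDeriv2 f g) : HasWeakDeriv2 (c • f) (c • g) := by
  obtain ⟨χ, h1, h2⟩ := h
  exact ⟨c • χ, h1.smul c, h2.smul c⟩

theorem exists_secondDeriv (ha : 0 < a) (F : FunctionClass) :
    ∃ T : W2c a F →L[ℂ] Fc a F, ∀ φ, HasWeakDeriv2 φ.toAEFun (T φ).toAEFun := by
  refine CSpace.exists_continuousLinearMap_of_bound ha HasWeakDeriv2
    (fun _ _ _ => HasWeakDeriv2.unique) (fun _ _ _ _ => HasWeakDeriv2.add)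
    (fun c _ _ => HasWeakDeriv2.smul c) (W2c.normW2_lt_top ha) fun b hb0 hb => ?_
  obtain ⟨C₂, hC₂, h₂⟩ := exists_normF_le a F
  refine ⟨C₂, hC₂, fun f hf hs B hB hn => ?_⟩
  obtain ⟨-, ψ, -, -, -, -, hψ2, hψB⟩ := exists_fBound_of_mem_W2I hb0 hb hf hs
  obtain ⟨χ, g, h1, h2, -⟩ := hf
  have hg := hψ2 g ⟨χ, h1, h2⟩
  obtain ⟨m, n⟩ := h₂ b g _ _ hg (hψB B hB hn)
  exact ⟨g, m, h2.suppIn (h1.suppIn hs), ⟨χ, h1, h2⟩, n⟩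

theorem mulGraph_unique {g' : AEFun a} (h : MulGraph q f g) (h' : MulGraph q f g') : g = g' :=
  AEEqFun.ext (h.trans h'.symm)

theorem mulGraph_add {f' g' : AEFun a} (h : MulGraph q f g) (h' : MulGraph q f' g') :
    MulGraph q (f + f') (g + g') := by
  unfold MulGraph at h h' ⊢
  filter_upwards [AEEqFun.coeFn_add f f', AEEqFun.coeFn_add g g', h, h'] with x h1 h2 h3 h4
  rw [h1, h2, Pi.add_apply, Pi.add_apply, h3, h4, mul_add]

theorem mulGraph_smul (c : ℂ) (h : MulGraph q f g) : MulGraph q (c • f) (c • g) := by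
  unfold MulGraph at h ⊢
  filter_upwards [AEEqFun.coeFn_smul c f, AEEqFun.coeFn_smul c g, h] with x h1 h2 h3
  rw [h1, h2, Pi.smul_apply, Pi.smul_apply, h3, smul_eq_mul, smul_eq_mul]
  ring

theorem mulGraph_of_eqOn {η : ℝ → ℂ} (hp : ∀ s ∈ Icc (-b) b, p s = q s)
    (hf : f =ᵐ[volume.restrict (Ioo (-a) a)] η) (hη : VanishesOff b η)
    (hg : g =ᵐ[volume.restrict (Ioo (-a) a)] p * η) : MulGraph q f g := by
  unfold MulGraph
  filter_upwards [hf, hg] with x h1 h2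
  rw [h1, h2, Pi.mul_apply]
  by_cases hx : x ∈ Icc (-b) b
  · rw [hp x hx]
  · rw [hη x hx, mul_zero, mul_zero]

theorem exists_multiplication (ha : 0 < a) (hK : IsModelKernel a F q K) :
    ∃ T : W2c a F →L[ℂ] Fc a F, ∀ φ, MulGraph q φ.toAEFun (T φ).toAEFun := by
  refine CSpace.exists_continuousLinearMap_of_bound ha (MulGraph q)
    (fun _ _ _ => mulGraph_unique) (fun _ _ _ _ => mulGraph_add)
    (fun c _ _ => mulGraph_smul c) (W2c.normW2_lt_top ha) fun b hb0 hb => ?_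
  obtain ⟨p, G, hG, hpq, -⟩ := hK b hb0 hb
  obtain ⟨C₁, hC₁, h₁⟩ := hG.exists_sub_mul hb0.le
  obtain ⟨C₂, hC₂, h₂⟩ := exists_normF_le a F
  refine ⟨C₂ * C₁, by positivity, fun f hf hs B hB hn => ?_⟩
  obtain ⟨-, ψ, hψ, hψi, -, hfs, -, hψB⟩ := exists_fBound_of_mem_W2I hb0 hb hf hs
  have hr := h₁ ψ B (hψB B hB hn) hfs
  have hc := mkClass_ae_eq (a := a) (hr.integrable hb0.le).aestronglyMeasurable
  obtain ⟨m, n⟩ := h₂ b _ _ _ hc hr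
  exact ⟨_, m, suppIn_of_ae_eq hc hr.vanishesOff, mulGraph_of_eqOn hpq hψ hfs hc,
    by rwa [mul_assoc]⟩

end Operators

/-! ### The operator on regular functionals -/

section Regular

variable {F : FunctionClass} {a b : ℝ} {q ψ γ h : ℝ → ℂ} {K : ℝ → ℝ → ℂ} {M : ℝ × ℝ → ℂ}

/-- The sign of `x` on the region `|t| < |x|`, and `0` elsewhere. -/
def coneSign (x t : ℝ) : ℂ := (if |t| < x then 1 else 0) - if |t| < -x then 1 else 0

theorem norm_coneSign_le (x t : ℝ) : ‖coneSign x t‖ ≤ 1 := by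
  unfold coneSign
  have := abs_nonneg t
  split_ifs <;> first | (exfalso; linarith) | simp

theorem measurable_coneSign : Measurable fun z : ℝ × ℝ => coneSign z.1 z.2 := by
  unfold coneSign
  refine (Measurable.ite (measurableSet_lt ?_ ?_) measurable_const measurable_const).sub
    (Measurable.ite (measurableSet_lt ?_ ?_) measurable_const measurable_const) <;> fun_prop

theorem integral_mul_coneSign_right (h : ℝ → ℂ) (x : ℝ) :
    ∫ t, h t * coneSign x t = ∫ t in (-x)..x, h t := by
  rcases le_total 0 x with hx | hx
  · rw [intervalIntegral.integral_of_le (by linarith), integral_Ioc_eq_integral_Ioo,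
      ← integral_indicator measurableSet_Ioo]
    refine integral_congr_ae (Filter.Eventually.of_forall fun t => ?_)
    have h2 : ¬ |t| < -x := by linarith [abs_nonneg t]
    by_cases ht : |t| < x
    · simp only [coneSign, ht, h2, if_true, if_false]
      rw [indicator_of_mem (show t ∈ Ioo (-x) x from abs_lt.1 ht)]; simp
    · simp only [coneSign, ht, h2, if_false]
      rw [indicator_of_notMem fun h : t ∈ Ioo (-x) x => ht (abs_lt.2 h)]; simp
  · rw [intervalIntegral.integral_of_ge (by linarith), integral_Ioc_eq_integral_Ioo,
      ← integral_indicator measurableSet_Ioo, ← integral_neg]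
    refine integral_congr_ae (Filter.Eventually.of_forall fun t => ?_)
    have h2 : ¬ |t| < x := by linarith [abs_nonneg t]
    by_cases ht : |t| < -x
    · simp only [coneSign, ht, h2, if_true, if_false]
      have : t ∈ Ioo x (-x) := ⟨by linarith [(abs_lt.1 ht).1], (abs_lt.1 ht).2⟩
      rw [indicator_of_mem this]; simp
    · simp only [coneSign, ht, h2, if_false]
      rw [indicator_of_notMem fun h => ht (abs_lt.2 ⟨by linarith [h.1], h.2⟩)]; simp

/-- The slice of the double cone at fixed `t` consists of `x > |t|` with sign `+` and `x < -|t|`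
with sign `-`. Slicing at fixed `x` gives the integral in `𝐓` instead, so one function on the plane
encodes both operators. -/
theorem integral_mul_coneSign_left (hh : Integrable h) (hs : VanishesOff b h) {t : ℝ}
    (ht : |t| ≤ b) :
    ∫ x, h x * coneSign x t = (∫ x in |t|..b, h x) - ∫ x in (-b)..(-|t|), h x := by
  rw [intervalIntegral.integral_of_le ht, intervalIntegral.integral_of_le (neg_le_neg ht),
    ← integral_indicator measurableSet_Ioc, ← integral_indicator measurableSet_Ioc,
    ← integral_sub (hh.indicator measurableSet_Ioc) (hh.indicator measurableSet_Ioc)]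
  refine integral_congr_ae ?_
  filter_upwards [Measure.ae_ne volume (-b), Measure.ae_ne volume (-|t|)] with x h1 h2
  by_cases hx : x ∈ Icc (-b) b
  · have e1 : (Ioc |t| b).indicator h x = h x * if |t| < x then 1 else 0 := by
      by_cases h3 : |t| < x
      · rw [indicator_of_mem (show x ∈ Ioc |t| b from ⟨h3, hx.2⟩), if_pos h3, mul_one]
      · rw [indicator_of_notMem fun h4 : x ∈ Ioc |t| b => h3 h4.1, if_neg h3, mul_zero]
    have e2 : (Ioc (-b) (-|t|)).indicator h x = h x * if |t| < -x then 1 else 0 := by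
      by_cases h3 : |t| < -x
      · rw [indicator_of_mem (show x ∈ Ioc (-b) (-|t|) from
          ⟨lt_of_le_of_ne hx.1 h1.symm, by linarith⟩), if_pos h3, mul_one]
      · rw [indicator_of_notMem fun h4 : x ∈ Ioc (-b) (-|t|) => h3 (by
          have := lt_of_le_of_ne h4.2 h2
          linarith), if_neg h3, mul_zero]
    rw [e1, e2, coneSign, mul_sub]
  · have h0 := hs x hx
    have e : ∀ s : Set ℝ, s.indicator h x = 0 := fun s => by
      by_cases hxs : x ∈ s
      · rw [indicator_of_mem hxs, h0]
      · exact indicator_of_notMem hxs h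
    rw [e, e, h0, zero_mul, sub_zero]

theorem VanishesOff.integrable_mul (hs : VanishesOff b ψ) (hψ : Integrable ψ) {V : ℝ → ℂ}
    (hV : Continuous V) : Integrable fun x => ψ x * V x := by
  have : IntegrableOn (fun x => ψ x * V x) (Icc (-b) b) :=
    hψ.integrableOn.mul_continuousOn hV.continuousOn isCompact_Icc
  refine (integrableOn_iff_integrable_of_support_subset ?_).1 this
  intro x hx
  by_contra hxb
  exact hx (by simp only [hs x hxb, zero_mul])

theorem integrable_prod_coneSign (hM : Continuous M) (hγ : Integrable γ) (hγs : VanishesOff b γ)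
    (hψ : Integrable ψ) (hψs : VanishesOff b ψ) :
    Integrable (fun z : ℝ × ℝ => ψ z.1 * γ z.2 * M z * coneSign z.1 z.2)
      (volume.prod volume) := by
  have hI : Integrable (fun z : ℝ × ℝ => ψ z.1 * γ z.2) (volume.prod volume) := hψ.mul_prod hγ
  obtain ⟨A, hA0, hA⟩ := exists_kernel_bound hM b
  refine (hI.norm.const_mul A).mono' ((hI.aestronglyMeasurable.mul
    hM.aestronglyMeasurable).mul measurable_coneSign.aestronglyMeasurable)
    (Filter.Eventually.of_forall fun z => ?_)
  by_cases h1 : z.1 ∈ Icc (-b) b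
  · by_cases h2 : z.2 ∈ Icc (-b) b
    · rw [norm_mul, norm_mul _ (M z)]
      calc _ ≤ ‖ψ z.1 * γ z.2‖ * A * 1 := by
            gcongr
            · exact hA _ h1 _ h2
            · exact norm_coneSign_le _ _
        _ = _ := by ring
    · simp [hγs _ h2]
  · simp [hψs _ h1]

/-- Fubini: the two sides are the two orders of integration over the double cone. -/
theorem integral_volterra_mul (hM : Continuous M) (hγ : Integrable γ)
    (hγs : VanishesOff b γ) (hψ : Integrable ψ) (hψs : VanishesOff b ψ) :
    ∫ x, ψ x * ∫ t in (-x)..x, γ t * M (x, t) = ∫ t, γ t * skew b M ψ t := by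
  have e1 : ∀ x, ψ x * ∫ t in (-x)..x, γ t * M (x, t) =
      ∫ t, ψ x * γ t * M (x, t) * coneSign x t := fun x => by
    rw [← integral_mul_coneSign_right, ← integral_const_mul]
    exact integral_congr_ae (Filter.Eventually.of_forall fun t => by ring)
  have e2 : ∀ t, γ t * skew b M ψ t = ∫ x, ψ x * γ t * M (x, t) * coneSign x t := fun t => by
    by_cases ht : t ∈ Icc (-b) b
    · have hi : Integrable fun x => ψ x * M (x, t) :=
        hψs.integrable_mul hψ (hM.comp (by fun_prop : Continuous fun x : ℝ => (x, t)))
      rw [skew_eq_abs hM hψ, ← integral_mul_coneSign_left hi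
        (fun x hx => by rw [hψs x hx, zero_mul]) (abs_le.2 ht), ← integral_const_mul]
      exact integral_congr_ae (Filter.Eventually.of_forall fun t => by ring)
    · simp [hγs t ht]
  simp_rw [e1, e2]
  exact integral_integral_swap (integrable_prod_coneSign hM hγ hγs hψ hψs)

theorem setIntegral_Ioo_of_vanishesOff (hb : b < a) (hs : VanishesOff b h) :
    ∫ x in Ioo (-a) a, h x = ∫ x, h x :=
  setIntegral_eq_integral_of_forall_compl_eq_zero fun x hx =>
    hs x fun hxb => hx (Icc_subset_Ioo_of_lt hb hxb)

theorem volterra_eqOn (hK : ∀ t ∈ Icc (-b) b, ∀ x ∈ Icc (-b) b, K t x = M (t, x)) (g : ℝ → ℂ)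
    {x : ℝ} (hx : x ∈ Icc (-b) b) :
    volterra K g x = g x + ∫ t in (-x)..x, cut b g t * M (x, t) := by
  unfold volterra
  congr 1
  refine intervalIntegral.integral_congr fun t ht => ?_
  have ht' : t ∈ Icc (-b) b := uIcc_subset_Icc ⟨by linarith [hx.2], by linarith [hx.1]⟩ hx ht
  simp only [hK x hx t ht', cut, indicator_of_mem ht']
  ring

theorem continuous_volterra_integral (hM : Continuous M) (hγ : Integrable γ) :
    Continuous fun x => ∫ t in (-x)..x, γ t * M (x, t) :=
  continuous_intervalIntegral_mul hγ.locallyIntegrable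
    (g := fun x t => M (x, t)) hM continuous_neg continuous_id

theorem IsModelKernel.locallyIntegrableOn_volterra (ha : 0 < a) (hK : IsModelKernel a F q K)
    {g : ℝ → ℂ} (hg : LocallyIntegrableOn g (Ioo (-a) a)) :
    LocallyIntegrableOn (volterra K g) (Ioo (-a) a) := by
  rw [locallyIntegrableOn_iff isOpen_Ioo.isLocallyClosed]
  intro L hLI hL
  obtain ⟨b, hb0, hb, hLb⟩ := exists_subset_Icc ha hL hLI
  obtain ⟨p, G, hG, -, hKG⟩ := hK b hb0 hb
  have hc := continuous_volterra_integral (continuous_planeKernel hG.continuous)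
    (integrable_cut hb hg)
  refine IntegrableOn.congr_fun ?_ (fun x hx => (volterra_eqOn hKG g (hLb hx)).symm)
    hL.measurableSet
  exact (hg.integrableOn_compact_subset hLI hL).add (hc.continuousOn.integrableOn_compact hL)

/-- On the support of a test function both pairings involve `g` only on `[-b, b]`. So `g` may be cut
off to an integrable function, and Fubini applies. -/
theorem IsRegular.volterra (ha : 0 < a) (hK : IsModelKernel a F q K)
    {X : Submodule ℂ (AEFun a)} {N : AEFun a → ℝ≥0∞}
    (hX : ∀ φ : CSpace X N, ∃ b, IsCarried b φ.toAEFun)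
    {T : CSpace X N → CSpace X N} (hT : ∀ φ, VolterraTransposeGraph K φ.toAEFun (T φ).toAEFun)
    {g : ℝ → ℂ} {u v : WeakDual ℂ (CSpace X N)} (hv : ∀ φ, v φ = u (T φ)) (hu : IsRegular g u) :
    IsRegular (volterra K g) v := by
  refine ⟨hK.locallyIntegrableOn_volterra ha hu.1, fun φ => ?_⟩
  obtain ⟨b, hφ⟩ := hX φ
  obtain ⟨p, G, hG, -, hKG⟩ := hK b hφ.pos hφ.lt
  have hM := continuous_planeKernel hG.continuous
  have hγ : Integrable (cut b g) := integrable_cut hφ.lt hu.1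
  have hγs := vanishesOff_cut b g
  have hψ := hφ.integrable_cut
  have hψs := vanishesOff_cut b φ.toAEFun
  set ψ := cut b φ.toAEFun
  have hV := continuous_volterra_integral hM hγ
  have hVi := hψs.integrable_mul hψ hV
  have hsk := vanishesOff_skew hM hψ hψs
  have hski : Integrable fun t => cut b g t * skew b (planeKernel G) ψ t :=
    integrable_mul_of_vanishesOff hγ (continuous_skew hM hψ) hsk
  obtain ⟨hgφ, -⟩ := hu.2 φ
  have e1 : (fun x => Transmutation.volterra K g x * φ.toAEFun x)
      =ᵐ[volume.restrict (Ioo (-a) a)] fun x => g x * φ.toAEFun x +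
        ψ x * ∫ t in (-x)..x, cut b g t * planeKernel G (x, t) := by
    filter_upwards [hφ.suppIn.ae_eq_cut] with x hx
    by_cases hxb : x ∈ Icc (-b) b
    · rw [volterra_eqOn hKG g hxb, hx]
      ring
    · rw [hx, vanishesOff_cut b _ x hxb, hψs x hxb]
      ring
  have e2 : (fun x => g x * (T φ).toAEFun x)
      =ᵐ[volume.restrict (Ioo (-a) a)] fun x => g x * φ.toAEFun x +
        cut b g x * skew b (planeKernel G) ψ x := by
    filter_upwards [hφ.suppIn.ae_eq_cut, hT φ, hφ.volterraTranspose_ae_eq hM hKG] with x y1 y2 y3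
    rw [y2, y3, Pi.add_apply, y1, mul_add]
    congr 1
    by_cases hxb : x ∈ Icc (-b) b
    · rw [show cut b g x = g x from indicator_of_mem hxb g]
    · rw [show skew b (planeKernel G) (cut b φ.toAEFun) x = 0 from hsk x hxb, mul_zero,
        mul_zero]
  refine ⟨(hgφ.add hVi.integrableOn).congr e1.symm, ?_⟩
  rw [hv, (hu.2 (T φ)).2, integral_congr_ae e1, integral_congr_ae e2,
    integral_add hgφ hVi.integrableOn, integral_add hgφ hski.integrableOn,
    setIntegral_Ioo_of_vanishesOff (h := fun x => ψ x * _) hφ.lt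
      (fun x hx => mul_eq_zero_of_left (hψs x hx) _),
    setIntegral_Ioo_of_vanishesOff (h := fun x => cut b g x * _) hφ.lt
      (fun x hx => mul_eq_zero_of_left (hγs x hx) _),
    integral_volterra_mul hM hγ hγs hψ hψs]

end Regular

/-- The commutation relation `(𝐓□φ)'' = 𝐓□(φ'' - qφ)`. -/
theorem IsModelKernel.hasWeakDeriv2_transpose {F : FunctionClass} {a b : ℝ} {q : ℝ → ℂ}
    {K : ℝ → ℝ → ℂ} (ha : 0 < a) (hK : IsModelKernel a F q K) (hb0 : 0 < b) (hb : b < a)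
    {f f₂ qf Tf Te : AEFun a} (hf : f ∈ W2I a F) (hs : SuppIn f (Icc (-b) b))
    (h₂ : HasWeakDeriv2 f f₂) (hq : MulGraph q f qf) (hT : VolterraTransposeGraph K f Tf)
    (hTe : VolterraTransposeGraph K (f₂ - qf) Te) : HasWeakDeriv2 Tf Te := by
  obtain ⟨p, G, hG, hpq, hKG⟩ := hK b hb0 hb
  have hM := continuous_planeKernel hG.continuous
  obtain ⟨hfin, ψ, hψ, hψi, -, hφs, hψ2, hψB⟩ := exists_fBound_of_mem_W2I hb0 hb hf hs
  have hψF := hψB _ ENNReal.toReal_nonneg (ENNReal.ofReal_toReal hfin.ne).ge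
  have hφc := continuous_prim_prim (b := b) hψi
  have hpi := integrable_mul_of_vanishesOff hG.integrable hφc hφs
  have hχi := hψi.sub hpi
  have hχs := hψF.vanishesOff.sub (hφs.mul_left p)
  have he := hG.add_skew_prim_prim hb0.le hψi hψF.vanishesOff hφs
  have e1 := hT.trans (volterraTranspose_ae_eq hb hM hKG hψ (hφs.integrable hφc) hφs)
  -- `Tf` is now a twofold primitive of the function that represents `Te`.
  rw [he] at e1
  have hqf : qf =ᵐ[volume.restrict (Ioo (-a) a)] p * prim b (prim b ψ) := by
    unfold MulGraph at hq
    filter_upwards [hq, hψ] with x h1 h2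
    rw [h1, h2, Pi.mul_apply]
    by_cases hx : x ∈ Icc (-b) b
    · rw [hpq x hx]
    · rw [hφs x hx, mul_zero, mul_zero]
  have e2 := hTe.trans (volterraTranspose_ae_eq hb hM hKG
    ((AEEqFun.coeFn_sub f₂ qf).trans ((hψ2 f₂ h₂).sub hqf)) hχi hχs)
  have hski := (vanishesOff_skew hM hχi hχs).integrable (continuous_skew hM hχi)
  have hc := continuous_prim (b := b) (hχi.add hski)
  have hmc := mkClass_ae_eq (a := a) hc.aestronglyMeasurable
  refine ⟨_, hasWeakDeriv_prim (b := b) ha ?_ e1 hmc,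
    hasWeakDeriv_prim (b := b) ha (hχi.add hski) hmc e2⟩
  have hTs := hφs.add (vanishesOff_skew hM (hφs.integrable hφc) hφs)
  rw [he] at hTs
  exact (hTs.of_hasDerivAt (hasDerivAt_prim hc)).integrable hc

end Transmutation

end

/-! ### Passage to the duals -/

open Transmutation in
theorem mainTheorem11 (a : ℝ) (ha : 0 < a) (F : FunctionClass) (q : ℝ → ℂ)
    (hq : MemFloc a F q) :
    -- the integral equation has a unique continuous solution `H`, which gives the kernel of `𝐓`
    ∃ H : ℝ → ℝ → ℂ, IsGoursatSolution a q H ∧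
      (∀ H' : ℝ → ℝ → ℂ, IsGoursatSolution a q H' →
        ∀ u v : ℝ, |u| + |v| < a → H' u v = H u v) ∧
      -- `𝐓` on `(W²_c(I;F))'` and on `(F_c(I))'`: linear, continuous, invertible
      ∃ (TW : WeakDual ℂ (W2c a F) ≃L[ℂ] WeakDual ℂ (W2c a F))
        (TF : WeakDual ℂ (Fc a F) ≃L[ℂ] WeakDual ℂ (Fc a F)),
        IsTransposeOf TW (VolterraTransposeGraph (kernel H)) ∧
        IsTransposeOf TF (VolterraTransposeGraph (kernel H)) ∧
        -- both extend the Volterra operator on functions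
        (∀ g u, IsRegular g u → IsRegular (volterra (kernel H) g) (TW u)) ∧
        (∀ g u, IsRegular g u → IsRegular (volterra (kernel H) g) (TF u)) ∧
        -- restriction `u ↦ u`, second derivative `u ↦ u''` and multiplication `u ↦ q u`
        -- from `(F_c(I))'` to `(W²_c(I;F))'`
        ∃ J D Q : WeakDual ℂ (Fc a F) →L[ℂ] WeakDual ℂ (W2c a F),
          IsTransposeOf J (fun φ ψ => ψ = φ) ∧
          IsTransposeOf D HasWeakDeriv2 ∧
          IsTransposeOf Q (MulGraph q) ∧
          (∀ u, TW (J u) = J (TF u)) ∧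
          -- the transmutation property `(𝐓u)'' - q 𝐓u = 𝐓(u'')`
          ∀ u, D (TF u) - Q (TF u) = TW (D u) := by
  obtain ⟨H, hH, hHu, hK⟩ := hq.exists_isModelKernel
  obtain ⟨TW, hTW⟩ := exists_transpose_W2c ha hK
  obtain ⟨SW, hSW⟩ := exists_transpose_inv_W2c ha hK
  obtain ⟨TF, hTF⟩ := exists_transpose_Fc ha hK
  obtain ⟨SF, hSF⟩ := exists_transpose_inv_Fc ha hK
  obtain ⟨J, hJ⟩ := exists_restriction ha F
  obtain ⟨D, hD⟩ := exists_secondDeriv ha F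
  obtain ⟨Q, hQ⟩ := exists_multiplication ha hK
  have hW := W2c.exists_isCarried (F := F) ha
  have hF := Fc.exists_isCarried (F := F) ha
  -- Here `TW` and `TF` are `𝐓□` on test functions. One composition with the inverse is
  -- single-valuedness of `𝐓□`, the other is its injectivity.
  have hTSW : ∀ φ, TW (SW φ) = φ := fun φ =>
    CSpace.toAEFun_injective (volterraTransposeGraph_unique (hTW (SW φ)) (hSW φ))
  have hSTW : ∀ φ, SW (TW φ) = φ := fun φ => by
    obtain ⟨b, hb⟩ := hW (SW (TW φ))
    obtain ⟨b', hb'⟩ := hW φ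
    exact CSpace.toAEFun_injective (hK.graph_injective hb hb' (hSW (TW φ)) (hTW φ))
  have hTSF : ∀ φ, TF (SF φ) = φ := fun φ =>
    CSpace.toAEFun_injective (volterraTransposeGraph_unique (hTF (SF φ)) (hSF φ))
  have hSTF : ∀ φ, SF (TF φ) = φ := fun φ => by
    obtain ⟨b, hb⟩ := hF (SF (TF φ))
    obtain ⟨b', hb'⟩ := hF φ
    exact CSpace.toAEFun_injective (hK.graph_injective hb hb' (hSF (TF φ)) (hTF φ))
  refine ⟨H, hH, hHu, weakDualPrecompEquiv TW SW hTSW hSTW, weakDualPrecompEquiv TF SF hTSF hSTF,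
    CSpace.isTransposeOf_weakDualPrecomp (fun _ _ _ => volterraTransposeGraph_unique) TW hTW _
      (weakDualPrecompEquiv_apply TW SW hTSW hSTW),
    CSpace.isTransposeOf_weakDualPrecomp (fun _ _ _ => volterraTransposeGraph_unique) TF hTF _
      (weakDualPrecompEquiv_apply TF SF hTSF hSTF),
    fun g u hu => hu.volterra ha hK hW hTW (weakDualPrecompEquiv_apply TW SW hTSW hSTW u),
    fun g u hu => hu.volterra ha hK hF hTF (weakDualPrecompEquiv_apply TF SF hTSF hSTF u),
    weakDualPrecomp J, weakDualPrecomp D, weakDualPrecomp Q,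
    CSpace.isTransposeOf_weakDualPrecomp (fun _ _ _ h h' => h.trans h'.symm) J hJ _
      (weakDualPrecomp_apply J),
    CSpace.isTransposeOf_weakDualPrecomp (fun _ _ _ => HasWeakDeriv2.unique) D hD _
      (weakDualPrecomp_apply D),
    CSpace.isTransposeOf_weakDualPrecomp (fun _ _ _ => mulGraph_unique) Q hQ _
      (weakDualPrecomp_apply Q), fun u => ?_, fun u => ?_⟩
  · refine DFunLike.ext _ _ fun φ => ?_
    rw [weakDualPrecompEquiv_apply, weakDualPrecomp_apply, weakDualPrecomp_apply,
      weakDualPrecompEquiv_apply]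
    congr 1
    -- Both sides are `𝐓□φ`, given by the same graph in `F_c(I)` and in `W²_c(I; F)`.
    refine CSpace.toAEFun_injective ?_
    rw [hJ]
    refine volterraTransposeGraph_unique (hTW φ) ?_
    have := hTF (J φ)
    rwa [hJ] at this
  · refine DFunLike.ext _ _ fun φ => ?_
    -- The commutation relation `𝐓□(φ'' - qφ) = (𝐓□φ)''`, of which the transmutation property is the
    -- transpose.
    have key : TF (D φ - Q φ) = D (TW φ) := by
      obtain ⟨b, hb⟩ := hW φ
      exact CSpace.toAEFun_injective (HasWeakDeriv2.unique
        (hK.hasWeakDeriv2_transpose ha hb.pos hb.lt φ.2.1 hb.suppIn (hD φ) (hQ φ) (hTW φ)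
          (hTF (D φ - Q φ))) (hD (TW φ)))
    have e1 : weakDualPrecompEquiv TW SW hTSW hSTW (weakDualPrecomp D u) φ = u (D (TW φ)) := by
      rw [weakDualPrecompEquiv_apply, weakDualPrecomp_apply]
    have e2 : weakDualPrecomp D (weakDualPrecompEquiv TF SF hTSF hSTF u) φ = u (TF (D φ)) := by
      rw [weakDualPrecomp_apply, weakDualPrecompEquiv_apply]
    have e3 : weakDualPrecomp Q (weakDualPrecompEquiv TF SF hTSF hSTF u) φ = u (TF (Q φ)) := by
      rw [weakDualPrecomp_apply, weakDualPrecompEquiv_apply]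
    refine (congrArg₂ (· - ·) e2 e3).trans (Eq.trans ?_ e1.symm)
    rw [← key, map_sub, map_sub]
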